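/- Let $k$ be a field of characteristic zero. For an integer $m\ge 2$ and a primitive $m$-th root of unity $q\in k$, let $T_{m^2}(q)$ be the Taft Hopf algebra: the $k$-algebra generated by $h,x$ subject to $h^m=1$, $x^m=0$, $xh=q\,hx$, with $\Delta(h)=h\otimes h$, $\Delta(x)=x\otimes h+1\otimes x$, $\varepsilon(h)=1$, $\varepsilon(x)=0$, $S(h)=h^{-1}$, $S(x)=-xh^{-1}$. A Hopf algebra $E$ over $k$ is said to factor through Hopf algebras $A$ and $B$ if there are injective Hopf algebra maps $i:A\to E$ and $j:B\to E$ such that the linear map $A\otimes B\to E$, $a\otimes b\mapsto i(a)j(b)$, is bijective. Let $m,n\ge 2$ be integers, let $q,\overline q\in k$ be primitive roots of unity of orders $m$ and $n$ respectively, let $d=\gcd(m,n)$, and let $\nu(d)=|U_d(k)|$ be the number of elements $\omega\in k$ with $\omega^d=1$. Let $\mathbb T_{n^2}(\overline q)$ denote the Taft Hopf algebra with parameters $n$ and $\overline q$. Then the number $\sharp^{n,m}_{\overline q,q}$ of isomorphism classes of Hopf algebras that factor through $\mathbb T_{n^2}(\overline q)$ and $T_{m^2}(q)$ is given by $$\sharp^{n,m}_{\overline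 q,q}=\begin{cases} 3, & \text{if } m=n=2,\\ \nu(d), & \text{if } m\ne n,\ \text{or } m=n\ge 3 \text{ and } \overline q\notin\{q,q^{n-1}\},\\ \frac{\nu(d)}{2}+1, & \text{if } m=n\ge 3,\ \overline q=q \text{ and } \nu(d) \text{ is even},\\ \frac{\nu(d)+1}{2}, & \text{if } m=n\ge 3,\ \overline q=q \text{ and } \nu(d)\text{ is odd},\\ \nu(d)+1, & \text{if } m=n\ge 3 \text{ and } \overline q=q^{n-1}. \end{cases}$$ -/

import Mathlib

open scoped TensorProduct

universe u

/-! ### The Taft algebras -/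

section TaftAlgebra

variable {k : Type u} [Field k]

/-- The two generators of a Taft algebra. -/
inductive TaftGen : Type
  | h
  | x

/-- The defining relations `h ^ m = 1`, `x ^ m = 0`, `x h = q h x` on the free algebra on `h`, `x`. -/
inductive TaftRel (q : k) (m : ℕ) : FreeAlgebra k TaftGen → FreeAlgebra k TaftGen → Prop
  | h_pow : TaftRel q m (FreeAlgebra.ι k TaftGen.h ^ m) 1
  | x_pow : TaftRel q m (FreeAlgebra.ι k TaftGen.x ^ m) 0
  | x_mul_h : TaftRel q m (FreeAlgebra.ι k TaftGen.x * FreeAlgebra.ι k TaftGen.h)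
      (q • (FreeAlgebra.ι k TaftGen.h * FreeAlgebra.ι k TaftGen.x))

/-- The associative unital `k`-algebra generated by `h`, `x` subject to
`h ^ m = 1`, `x ^ m = 0`, `x h = q h x`. -/
def TaftAlgebra (q : k) (m : ℕ) : Type u := RingQuot (TaftRel q m)

namespace TaftAlgebra

noncomputable instance instRing (q : k) (m : ℕ) : Ring (TaftAlgebra q m) :=
  inferInstanceAs (Ring (RingQuot (TaftRel q m)))

noncomputable instance instAlgebra (q : k) (m : ℕ) : Algebra k (TaftAlgebra q m) :=
  inferInstanceAs (Algebra k (RingQuot (TaftRel q m)))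

/-- The quotient map from the free algebra. -/
noncomputable def mk (q : k) (m : ℕ) : FreeAlgebra k TaftGen →ₐ[k] TaftAlgebra q m :=
  RingQuot.mkAlgHom k (TaftRel q m)

/-- The generator `h`. -/
noncomputable def h (q : k) (m : ℕ) : TaftAlgebra q m := mk q m (FreeAlgebra.ι k TaftGen.h)

/-- The generator `x`. -/
noncomputable def x (q : k) (m : ℕ) : TaftAlgebra q m := mk q m (FreeAlgebra.ι k TaftGen.x)

theorem h_pow (q : k) (m : ℕ) : h q m ^ m = 1 := by
  have := RingQuot.mkAlgHom_rel k (TaftRel.h_pow (q := q) (m := m))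
  rw [map_pow, map_one] at this
  exact this

theorem x_pow (q : k) (m : ℕ) : x q m ^ m = 0 := by
  have := RingQuot.mkAlgHom_rel k (TaftRel.x_pow (q := q) (m := m))
  rw [map_pow, map_zero] at this
  exact this

theorem x_mul_h (q : k) (m : ℕ) : x q m * h q m = q • (h q m * x q m) := by
  have := RingQuot.mkAlgHom_rel k (TaftRel.x_mul_h (q := q) (m := m))
  rw [map_mul, map_smul, map_mul] at this
  exact this

/-- The universal property of the Taft algebra. -/
noncomputable def lift {q : k} {m : ℕ} {B : Type*} [Ring B] [Algebra k B] (g y : B)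
    (hg : g ^ m = 1) (hy : y ^ m = 0) (hgy : y * g = q • (g * y)) : TaftAlgebra q m →ₐ[k] B :=
  RingQuot.liftAlgHom k
    ⟨FreeAlgebra.lift k (fun i => match i with | TaftGen.h => g | TaftGen.x => y), by
      intro a b hab
      cases hab with
      | h_pow => simpa using hg
      | x_pow => simpa using hy
      | x_mul_h => simpa using hgy⟩

section lift

variable {q : k} {m : ℕ} {B : Type*} [Ring B] [Algebra k B] (g y : B)
    (hg : g ^ m = 1) (hy : y ^ m = 0) (hgy : y * g = q • (g * y))

theorem lift_h : lift g y hg hy hgy (h q m) = g := by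
  unfold lift h mk
  exact (RingQuot.liftAlgHom_mkAlgHom_apply _ _ _ _).trans (by simp)

theorem lift_x : lift g y hg hy hgy (x q m) = y := by
  unfold lift x mk
  exact (RingQuot.liftAlgHom_mkAlgHom_apply _ _ _ _).trans (by simp)

end lift

/-- Induction principle: `h` and `x` generate the Taft algebra. -/
theorem induction {q : k} {m : ℕ} {P : TaftAlgebra q m → Prop}
    (scalar : ∀ c : k, P (algebraMap k _ c)) (gen_h : P (h q m)) (gen_x : P (x q m))
    (mul : ∀ a b, P a → P b → P (a * b)) (add : ∀ a b, P a → P b → P (a + b))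
    (a : TaftAlgebra q m) : P a := by
  obtain ⟨a, rfl⟩ : ∃ b, mk q m b = a := RingQuot.mkAlgHom_surjective k (TaftRel q m) a
  induction a using FreeAlgebra.induction with
  | grade0 r => rw [AlgHom.commutes]; exact scalar r
  | grade1 i =>
    cases i with
    | h => exact gen_h
    | x => exact gen_x
  | mul a b ha hb => rw [map_mul]; exact mul _ _ ha hb
  | add a b ha hb => rw [map_add]; exact add _ _ ha hb

theorem algHom_ext {q : k} {m : ℕ} {B : Type*} [Ring B] [Algebra k B]
    {f g : TaftAlgebra q m →ₐ[k] B} (hh : f (h q m) = g (h q m)) (hx : f (x q m) = g (x q m)) :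
    f = g := by
  ext a
  induction a using TaftAlgebra.induction with
  | scalar c => rw [AlgHom.commutes, AlgHom.commutes]
  | gen_h => exact hh
  | gen_x => exact hx
  | mul a b ha hb => rw [map_mul, map_mul, ha, hb]
  | add a b ha hb => rw [map_add, map_add, ha, hb]

/-! The `q`-binomial theorem at a primitive root of unity, needed for the comultiplication. -/

/-- The `q`-binomial coefficient of `a ^ i * b ^ j` in `(a + b) ^ (i + j)` when `b a = q a b`. -/
def qBinom (q : k) : ℕ → ℕ → k
  | 0, _ => 1
  | _ + 1, 0 => 1
  | i + 1, j + 1 => qBinom q i (j + 1) + q ^ (i + 1) * qBinom q (i + 1) j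

/-- The `q`-integer `1 + q + ⋯ + q ^ (n - 1)`. -/
def qInt (q : k) (n : ℕ) : k := ∑ i ∈ Finset.range n, q ^ i

/-- The `q`-factorial. -/
def qFact (q : k) (n : ℕ) : k := ∏ i ∈ Finset.range n, qInt q (i + 1)

theorem qBinom_zero_right (q : k) (i : ℕ) : qBinom q i 0 = 1 := by
  cases i <;> simp [qBinom]

theorem qInt_add (q : k) (i j : ℕ) : qInt q (i + j) = qInt q i + q ^ i * qInt q j := by
  simp only [qInt, Finset.sum_range_add, Finset.mul_sum, pow_add]

theorem qFact_succ (q : k) (n : ℕ) : qFact q (n + 1) = qFact q n * qInt q (n + 1) := by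
  simp only [qFact, Finset.prod_range_succ]

theorem qBinom_mul (q : k) (i j : ℕ) :
    qBinom q i j * (qFact q i * qFact q j) = qFact q (i + j) := by
  induction i generalizing j with
  | zero => simp [qBinom, qFact]
  | succ i ihi =>
    induction j with
    | zero => simp [qBinom, qFact]
    | succ j ihj =>
      have h1 := ihi (j + 1)
      have e1 : i + 1 + (j + 1) = (i + j + 1) + 1 := by ring
      have e2 : i + (j + 1) = i + j + 1 := by ring
      have e3 : i + 1 + j = i + j + 1 := by ring
      have h3 : qInt q (i + j + 1 + 1) = qInt q (i + 1) + q ^ (i + 1) * qInt q (j + 1) := by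
        rw [← qInt_add]; congr 1; ring
      rw [e2] at h1
      rw [e3] at ihj
      rw [e1, qFact_succ q (i + j + 1), h3, qBinom, qFact_succ q i, qFact_succ q j]
      rw [qFact_succ q j] at h1
      rw [qFact_succ q i] at ihj
      linear_combination (qInt q (i + 1)) * h1 + q ^ (i + 1) * qInt q (j + 1) * ihj

theorem mul_pow_of_qComm {B : Type*} [Ring B] [Algebra k B] {q : k} {a b : B}
    (hab : b * a = q • (a * b)) (i : ℕ) : b * a ^ i = q ^ i • (a ^ i * b) := by
  induction i with
  | zero => simp
  | succ i ih =>
    rw [pow_succ, ← mul_assoc, ih, smul_mul_assoc, mul_assoc, hab, mul_smul_comm, smul_smul,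
      mul_assoc, ← pow_succ]

theorem add_pow_of_qComm {B : Type*} [Ring B] [Algebra k B] {q : k} {a b : B}
    (hab : b * a = q • (a * b)) (n : ℕ) :
    (a + b) ^ n = ∑ p ∈ Finset.HasAntidiagonal.antidiagonal n, qBinom q p.1 p.2 • (a ^ p.1 * b ^ p.2) := by
  induction n with
  | zero => simp [qBinom]
  | succ n ih =>
    have hL : ∀ p : ℕ × ℕ, (a + b) * (qBinom q p.1 p.2 • (a ^ p.1 * b ^ p.2)) =
        qBinom q p.1 p.2 • (a ^ (p.1 + 1) * b ^ p.2) +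
          (q ^ p.1 * qBinom q p.1 p.2) • (a ^ p.1 * b ^ (p.2 + 1)) := by
      intro p
      rw [add_mul, mul_smul_comm, mul_smul_comm, ← mul_assoc, ← mul_assoc,
        mul_pow_of_qComm hab, smul_mul_assoc, smul_smul, mul_assoc _ b, ← pow_succ', ← pow_succ',
        mul_comm (q ^ p.1)]
    rw [pow_succ', ih, Finset.mul_sum, Finset.sum_congr rfl (fun p _ => hL p),
      Finset.sum_add_distrib]
    cases n with
    | zero => simp [Finset.Nat.antidiagonal_succ, qBinom, add_comm]
    | succ n =>
      rw [Finset.Nat.sum_antidiagonal_succ' (n := n)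
          (f := fun p : ℕ × ℕ => qBinom q p.1 p.2 • (a ^ (p.1 + 1) * b ^ p.2)),
        Finset.Nat.sum_antidiagonal_succ (n := n)
          (f := fun p : ℕ × ℕ => (q ^ p.1 * qBinom q p.1 p.2) • (a ^ p.1 * b ^ (p.2 + 1))),
        Finset.Nat.sum_antidiagonal_succ (n := n + 1), Finset.Nat.sum_antidiagonal_succ' (n := n)]
      simp only [qBinom, qBinom_zero_right, add_smul, Finset.sum_add_distrib]
      simp only [pow_zero, one_mul, mul_one]
      abel

theorem qInt_eq_zero {q : k} {m : ℕ} (hq : IsPrimitiveRoot q m) (hm : 1 < m) : qInt q m = 0 :=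
  hq.geom_sum_eq_zero hm

theorem qFact_ne_zero {q : k} {m : ℕ} (hq : IsPrimitiveRoot q m) {i : ℕ} (hi : i < m) :
    qFact q i ≠ 0 := by
  rw [qFact, Finset.prod_ne_zero_iff]
  intro j hj h0
  rw [Finset.mem_range] at hj
  have h1 : q ^ (j + 1) - 1 = 0 := by
    rw [← geom_sum_mul]
    rw [qInt] at h0
    rw [h0, zero_mul]
  exact hq.pow_ne_one_of_pos_of_lt (Nat.succ_ne_zero j) (by omega) (sub_eq_zero.mp h1)

theorem qBinom_eq_zero {q : k} {m : ℕ} (hq : IsPrimitiveRoot q m) {i j : ℕ} (hi : i ≠ 0)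
    (hj : j ≠ 0) (hij : i + j = m) : qBinom q i j = 0 := by
  have h0 : qFact q (i + j) = 0 := by
    obtain ⟨l, hl⟩ : ∃ l, i + j = l + 1 := ⟨i + j - 1, by omega⟩
    rw [hl, qFact_succ, ← hl, hij, qInt_eq_zero hq (by omega), mul_zero]
  have h1 := qBinom_mul q i j
  rw [h0] at h1
  exact (mul_eq_zero.mp h1).resolve_right
    (mul_ne_zero (qFact_ne_zero hq (by omega)) (qFact_ne_zero hq (by omega)))

theorem add_pow_eq_zero_of_qComm {B : Type*} [Ring B] [Algebra k B] {q : k} {m : ℕ}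
    (hq : IsPrimitiveRoot q m) {a b : B} (hab : b * a = q • (a * b)) (ha : a ^ m = 0)
    (hb : b ^ m = 0) : (a + b) ^ m = 0 := by
  rw [add_pow_of_qComm hab]
  refine Finset.sum_eq_zero fun p hp => ?_
  rw [Finset.HasAntidiagonal.mem_antidiagonal] at hp
  rcases Nat.eq_zero_or_pos p.1 with h1 | h1
  · have : p.2 = m := by omega
    rw [this, hb, mul_zero, smul_zero]
  rcases Nat.eq_zero_or_pos p.2 with h2 | h2
  · have : p.1 = m := by omega
    rw [this, ha, zero_mul, smul_zero]
  rw [qBinom_eq_zero hq h1.ne' h2.ne' hp, zero_smul]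

/-! The Hopf algebra structure. -/

section Hopf

variable (q : k) (m : ℕ)

/-- The comultiplication: `h ↦ h ⊗ h`, `x ↦ x ⊗ h + 1 ⊗ x`. -/
noncomputable def comulHom (hq : IsPrimitiveRoot q m) :
    TaftAlgebra q m →ₐ[k] TaftAlgebra q m ⊗[k] TaftAlgebra q m :=
  lift (h q m ⊗ₜ[k] h q m) (x q m ⊗ₜ[k] h q m + 1 ⊗ₜ[k] x q m)
    (by rw [Algebra.TensorProduct.tmul_pow, h_pow, Algebra.TensorProduct.one_def])
    (by
      refine add_pow_eq_zero_of_qComm hq ?_ ?_ ?_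
      · rw [Algebra.TensorProduct.tmul_mul_tmul, Algebra.TensorProduct.tmul_mul_tmul, x_mul_h,
          one_mul, mul_one, TensorProduct.tmul_smul]
      · rw [Algebra.TensorProduct.tmul_pow, x_pow, TensorProduct.zero_tmul]
      · rw [Algebra.TensorProduct.tmul_pow, x_pow, TensorProduct.tmul_zero])
    (by
      rw [add_mul, mul_add, smul_add]
      simp only [Algebra.TensorProduct.tmul_mul_tmul, x_mul_h, one_mul, mul_one,
        TensorProduct.tmul_smul, TensorProduct.smul_tmul'])

/-- The counit: `h ↦ 1`, `x ↦ 0`. -/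
noncomputable def counitHom (hm : m ≠ 0) : TaftAlgebra q m →ₐ[k] k :=
  lift 1 0 (one_pow m) (zero_pow hm) (by simp)

/-- The inverse of `h` is `h ^ (m - 1)`. -/
theorem h_mul_h_pow (hm : m ≠ 0) : h q m * h q m ^ (m - 1) = 1 := by
  rw [← pow_succ', Nat.sub_add_cancel (Nat.one_le_iff_ne_zero.mpr hm), h_pow]

theorem h_pow_mul_h (hm : m ≠ 0) : h q m ^ (m - 1) * h q m = 1 := by
  rw [← pow_succ, Nat.sub_add_cancel (Nat.one_le_iff_ne_zero.mpr hm), h_pow]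

theorem h_pow_mul_x (hm : m ≠ 0) :
    h q m ^ (m - 1) * x q m = q • (x q m * h q m ^ (m - 1)) := by
  have h1 : h q m ^ (m - 1) * (x q m * h q m) * h q m ^ (m - 1) =
      h q m ^ (m - 1) * (q • (h q m * x q m)) * h q m ^ (m - 1) := by rw [x_mul_h]
  rw [mul_assoc, mul_assoc, h_mul_h_pow q m hm, mul_one, mul_smul_comm, ← mul_assoc,
    h_pow_mul_h q m hm, one_mul, smul_mul_assoc] at h1
  exact h1

/-- The antipode, as an algebra homomorphism to the opposite algebra: `h ↦ h⁻¹`, `x ↦ -x h⁻¹`,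
where `h⁻¹ = h ^ (m - 1)`. -/
noncomputable def antipodeHom (hm : m ≠ 0) : TaftAlgebra q m →ₐ[k] (TaftAlgebra q m)ᵐᵒᵖ :=
  lift (MulOpposite.op (h q m ^ (m - 1))) (MulOpposite.op (-(x q m * h q m ^ (m - 1))))
    (by rw [← MulOpposite.op_pow, ← pow_mul, mul_comm, pow_mul, h_pow, one_pow,
      MulOpposite.op_one])
    (by
      have key : ∀ i : ℕ, ∃ c : k,
          (x q m * h q m ^ (m - 1)) ^ i = c • (x q m ^ i * (h q m ^ (m - 1)) ^ i) := by
        intro i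
        induction i with
        | zero => exact ⟨1, by simp⟩
        | succ i ih =>
          obtain ⟨c, hc⟩ := ih
          refine ⟨q ^ i * c, ?_⟩
          have hx := mul_pow_of_qComm (h_pow_mul_x q m hm) i
          rw [pow_succ', hc, mul_smul_comm, mul_assoc, ← mul_assoc (h q m ^ (m - 1)), hx,
            smul_mul_assoc, mul_smul_comm, smul_smul, mul_comm c, mul_assoc (x q m ^ i),
            ← pow_succ', ← mul_assoc, ← pow_succ']
      obtain ⟨c, hc⟩ := key m
      rw [← MulOpposite.op_pow, neg_pow, hc, x_pow, zero_mul, smul_zero, mul_zero,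
        MulOpposite.op_zero])
    (by
      rw [← MulOpposite.op_mul, ← MulOpposite.op_mul, ← MulOpposite.op_smul, mul_neg, neg_mul,
        smul_neg, ← mul_assoc, h_pow_mul_x q m hm, smul_mul_assoc])

/-- The antipode as a linear map. -/
noncomputable def antipodeLin (hm : m ≠ 0) : TaftAlgebra q m →ₗ[k] TaftAlgebra q m :=
  (MulOpposite.opLinearEquiv k).symm.toLinearMap ∘ₗ (antipodeHom q m hm).toLinearMap

theorem antipodeLin_mul (hm : m ≠ 0) (a b : TaftAlgebra q m) :
    antipodeLin q m hm (a * b) = antipodeLin q m hm b * antipodeLin q m hm a := by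
  simp [antipodeLin]

theorem antipodeLin_algebraMap (hm : m ≠ 0) (c : k) :
    antipodeLin q m hm (algebraMap k _ c) = algebraMap k _ c := by
  simp [antipodeLin, AlgHom.commutes]

theorem antipodeLin_h (hm : m ≠ 0) : antipodeLin q m hm (h q m) = h q m ^ (m - 1) := by
  simp [antipodeLin, antipodeHom, lift_h]

theorem antipodeLin_x (hm : m ≠ 0) :
    antipodeLin q m hm (x q m) = -(x q m * h q m ^ (m - 1)) := by
  simp [antipodeLin, antipodeHom, lift_x]

theorem comulHom_h (hq : IsPrimitiveRoot q m) :
    comulHom q m hq (h q m) = h q m ⊗ₜ[k] h q m := lift_h ..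

theorem comulHom_x (hq : IsPrimitiveRoot q m) :
    comulHom q m hq (x q m) = x q m ⊗ₜ[k] h q m + 1 ⊗ₜ[k] x q m := lift_x ..

theorem counitHom_h (hm : m ≠ 0) : counitHom q m hm (h q m) = 1 := lift_h ..

theorem counitHom_x (hm : m ≠ 0) : counitHom q m hm (x q m) = 0 := lift_x ..

/-- The bialgebra structure of the Taft algebra. -/
noncomputable instance instBialgebra [NeZero m] [hq : Fact (IsPrimitiveRoot q m)] :
    Bialgebra k (TaftAlgebra q m) :=
  Bialgebra.ofAlgHom (comulHom q m hq.out) (counitHom q m (NeZero.ne m))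
    (algHom_ext
      (by simp [comulHom_h])
      (by simp [comulHom_x, comulHom_h, TensorProduct.add_tmul, TensorProduct.tmul_add,
        Algebra.TensorProduct.one_def, add_assoc]))
    (algHom_ext
      (by simp [comulHom_h, counitHom_h])
      (by simp [comulHom_x, counitHom_x]))
    (algHom_ext
      (by simp [comulHom_h, counitHom_h])
      (by simp [comulHom_x, counitHom_h, counitHom_x]))

theorem comul_def [NeZero m] [hq : Fact (IsPrimitiveRoot q m)] (a : TaftAlgebra q m) :
    Coalgebra.comul (R := k) a = comulHom q m hq.out a := rfl

theorem counit_def [NeZero m] [hq : Fact (IsPrimitiveRoot q m)] (a : TaftAlgebra q m) :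
    Coalgebra.counit (R := k) a = counitHom q m (NeZero.ne m) a := rfl

theorem antipode_left_mul (hm : m ≠ 0) (t s : TaftAlgebra q m ⊗[k] TaftAlgebra q m) (c : k)
    (ht : LinearMap.mul' k _ ((antipodeLin q m hm).rTensor _ t) = algebraMap k _ c) :
    LinearMap.mul' k _ ((antipodeLin q m hm).rTensor _ (t * s)) =
      c • LinearMap.mul' k _ ((antipodeLin q m hm).rTensor _ s) := by
  have key : ∀ (t : TaftAlgebra q m ⊗[k] TaftAlgebra q m) (a b : TaftAlgebra q m),
      LinearMap.mul' k _ ((antipodeLin q m hm).rTensor _ (t * a ⊗ₜ[k] b)) =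
        antipodeLin q m hm a * LinearMap.mul' k _ ((antipodeLin q m hm).rTensor _ t) * b := by
    intro t a b
    induction t using TensorProduct.induction_on with
    | zero => simp
    | tmul y z => simp [antipodeLin_mul, mul_assoc]
    | add y z hy hz => rw [add_mul, map_add, map_add, hy, hz, map_add, map_add, mul_add, add_mul]
  induction s using TensorProduct.induction_on with
  | zero => simp
  | tmul a b =>
    rw [key, ht, ← Algebra.commutes, mul_assoc, Algebra.smul_def]
    simp
  | add y z hy hz => rw [mul_add, map_add, map_add, hy, hz, map_add, map_add, smul_add]

theorem antipode_right_mul (hm : m ≠ 0) (t s : TaftAlgebra q m ⊗[k] TaftAlgebra q m) (c : k)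
    (hs : LinearMap.mul' k _ ((antipodeLin q m hm).lTensor _ s) = algebraMap k _ c) :
    LinearMap.mul' k _ ((antipodeLin q m hm).lTensor _ (t * s)) =
      c • LinearMap.mul' k _ ((antipodeLin q m hm).lTensor _ t) := by
  have key : ∀ (s : TaftAlgebra q m ⊗[k] TaftAlgebra q m) (a b : TaftAlgebra q m),
      LinearMap.mul' k _ ((antipodeLin q m hm).lTensor _ (a ⊗ₜ[k] b * s)) =
        a * LinearMap.mul' k _ ((antipodeLin q m hm).lTensor _ s) * antipodeLin q m hm b := by
    intro s a b
    induction s using TensorProduct.induction_on with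
    | zero => simp
    | tmul y z => simp [antipodeLin_mul, mul_assoc]
    | add y z hy hz => rw [mul_add, map_add, map_add, hy, hz, map_add, map_add, mul_add, add_mul]
  induction t using TensorProduct.induction_on with
  | zero => simp
  | tmul a b =>
    rw [key, hs, ← Algebra.commutes, mul_assoc, Algebra.smul_def]
    simp
  | add y z hy hz => rw [add_mul, map_add, map_add, hy, hz, map_add, map_add, smul_add]

/-- The Hopf algebra structure of the Taft algebra. -/
noncomputable instance instHopfAlgebra [NeZero m] [hq : Fact (IsPrimitiveRoot q m)] :
    HopfAlgebra k (TaftAlgebra q m) where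
  antipode := antipodeLin q m (NeZero.ne m)
  mul_antipode_rTensor_comul := by
    ext a
    simp only [LinearMap.comp_apply, Algebra.linearMap_apply, comul_def, counit_def]
    induction a using TaftAlgebra.induction with
    | scalar c =>
      rw [AlgHom.commutes, AlgHom.commutes, Algebra.TensorProduct.algebraMap_apply]
      simp [antipodeLin_algebraMap]
    | gen_h => simp [comulHom_h, counitHom_h, antipodeLin_h, h_pow_mul_h q m (NeZero.ne m)]
    | gen_x =>
      have h1 : antipodeLin q m (NeZero.ne m) 1 = 1 := by
        simpa using antipodeLin_algebraMap q m (NeZero.ne m) 1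
      simp [comulHom_x, counitHom_x, antipodeLin_x, h1, mul_assoc,
        h_pow_mul_h q m (NeZero.ne m)]
    | mul a b ha hb =>
      rw [map_mul, antipode_left_mul q m _ _ _ _ ha, hb, map_mul, map_mul, Algebra.smul_def]
    | add a b ha hb => rw [map_add, map_add, map_add, ha, hb, map_add, map_add]
  mul_antipode_lTensor_comul := by
    ext a
    simp only [LinearMap.comp_apply, Algebra.linearMap_apply, comul_def, counit_def]
    induction a using TaftAlgebra.induction with
    | scalar c =>
      have h1 : antipodeLin q m (NeZero.ne m) 1 = 1 := by
        simpa using antipodeLin_algebraMap q m (NeZero.ne m) 1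
      rw [AlgHom.commutes, AlgHom.commutes, Algebra.TensorProduct.algebraMap_apply]
      simp [h1]
    | gen_h => simp [comulHom_h, counitHom_h, antipodeLin_h, h_mul_h_pow q m (NeZero.ne m)]
    | gen_x => simp [comulHom_x, counitHom_x, antipodeLin_x, antipodeLin_h]
    | mul a b ha hb =>
      rw [map_mul, antipode_right_mul q m _ _ _ _ hb, ha, map_mul, map_mul, Algebra.smul_def,
        Algebra.commutes]
    | add a b ha hb => rw [map_add, map_add, map_add, ha, hb, map_add, map_add]

end Hopf

end TaftAlgebra

/-- The Taft Hopf algebra `T_{m²}(q)` for a primitive `m`-th root of unity `q`. -/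
noncomputable def taftHopf {q : k} {m : ℕ} (hm : 2 ≤ m) (hq : IsPrimitiveRoot q m) :
    HopfAlgCat.{u} k :=
  haveI : NeZero m := ⟨by omega⟩
  haveI : Fact (IsPrimitiveRoot q m) := ⟨hq⟩
  HopfAlgCat.of k (TaftAlgebra q m)

end TaftAlgebra

/-! ### Factorization of Hopf algebras -/

section Factorization

variable {k : Type u} [Field k]

/-- `E` factors through `A` and `H`: there are injective Hopf algebra maps `i : A → E`,
`j : H → E` such that `A ⊗ H → E`, `a ⊗ h ↦ i a * j h`, is bijective. (A bialgebra map between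
Hopf algebras automatically commutes with the antipodes.) -/
def FactorsThrough (E A H : HopfAlgCat.{u} k) : Prop :=
  ∃ (i : A →ₐc[k] E) (j : H →ₐc[k] E), Function.Injective i ∧ Function.Injective j ∧
    Function.Bijective (LinearMap.mul' k E ∘ₗ
      TensorProduct.map (i : A →ₗ[k] E) (j : H →ₗ[k] E))

/-- Isomorphism of Hopf algebras, on the Hopf algebras that factor through `A` and `H`. -/
def factorizationSetoid (A H : HopfAlgCat.{u} k) :
    Setoid {E : HopfAlgCat.{u} k // FactorsThrough E A H} where
  r E F := Nonempty (E.1 ≃ₐc[k] F.1)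
  iseqv :=
    ⟨fun _ => ⟨BialgEquiv.refl k _⟩, fun ⟨e⟩ => ⟨e.symm⟩, fun ⟨e⟩ ⟨f⟩ => ⟨e.trans f⟩⟩

/-- The number (a cardinal) of isomorphism types of Hopf algebras that factor through
`A` and `H`. -/
noncomputable def numFactorizationTypes (A H : HopfAlgCat.{u} k) : Cardinal.{u + 1} :=
  Cardinal.mk (Quotient (factorizationSetoid A H))

end Factorization

/-!
Let `E` factor through two Taft algebras, with generators `H`, `X` and `h`, `x` and parameters `p`
and `q`. The product map `A ⊗ B → E` is an isomorphism of coalgebras, so the group-like and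
skew-primitive elements of `E` are those of `A ⊗ B`. There they are determined by letting characters
act on the left and on the right, for which the monomials are joint eigenvectors, and by the skew
derivation dual to `x`: apart from multiples of `1 - g`, skew-primitives occur only over `H` and
`h`, where they come from `X` and `x`. Hence `h X h⁻¹` is a multiple of `X` and `x X - α X x` a
multiple of `1 - H h`, and one obtains the relations `h H = H h`, `h X = α X h`, `x H = α H x`,
`x X = α X x + l (1 - H h)`, where `α` is a common root of unity and `α = q = p⁻¹` if `l ≠ 0`.

Conversely, the algebra with these relations acts on `A ⊗ B`, with `x` acting on `A` through a
Jackson derivative, and so it is no smaller than `A ⊗ B`. An isomorphism carries each pair of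
generators to a rescaling of one of the two pairs. If it exchanges the pairs, then `p = q` and `α`
is inverted; otherwise `α` is preserved, and a nonzero `l` can be normalized to `1`.
-/

section CoalgebraAction

variable {R C D : Type*} [CommSemiring R] [AddCommMonoid C] [Module R C] [AddCommMonoid D]
  [Module R D]

/-- The functional `c ⊗ d ↦ f c * f' d`. -/
noncomputable def tensorFunctional (f : Module.Dual R C) (f' : Module.Dual R D) :
    Module.Dual R (C ⊗[R] D) :=
  TensorProduct.dualDistrib R C D (f ⊗ₜ[R] f')

@[simp]
theorem tensorFunctional_tmul (f : Module.Dual R C) (f' : Module.Dual R D) (c : C) (d : D) :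
    tensorFunctional f f' (c ⊗ₜ[R] d) = f c * f' d :=
  TensorProduct.dualDistrib_apply f f' c d

variable [Coalgebra R C] [Coalgebra R D]

/-- The action `(id ⊗ f) ∘ Δ` of a functional `f` on a coalgebra, also known as `f ⇀ c`. -/
noncomputable def rightAct : Module.Dual R C →ₗ[R] Module.End R C where
  toFun f := (TensorProduct.rid R C).toLinearMap ∘ₗ f.lTensor C ∘ₗ Coalgebra.comul
  map_add' f g := by rw [LinearMap.lTensor_add, LinearMap.add_comp, LinearMap.comp_add]
  map_smul' r f := by
    rw [LinearMap.lTensor_smul, LinearMap.smul_comp, LinearMap.comp_smul, RingHom.id_apply]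

/-- The action `(f ⊗ id) ∘ Δ` of a functional `f` on a coalgebra, also known as `c ↼ f`. -/
noncomputable def leftAct : Module.Dual R C →ₗ[R] Module.End R C where
  toFun f := (TensorProduct.lid R C).toLinearMap ∘ₗ f.rTensor C ∘ₗ Coalgebra.comul
  map_add' f g := by rw [LinearMap.rTensor_add, LinearMap.add_comp, LinearMap.comp_add]
  map_smul' r f := by
    rw [LinearMap.rTensor_smul, LinearMap.smul_comp, LinearMap.comp_smul, RingHom.id_apply]

theorem rightAct_apply (f : Module.Dual R C) (c : C) :
    rightAct f c = TensorProduct.rid R C (f.lTensor C (Coalgebra.comul c)) := rfl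

theorem leftAct_apply (f : Module.Dual R C) (c : C) :
    leftAct f c = TensorProduct.lid R C (f.rTensor C (Coalgebra.comul c)) := rfl

theorem rightAct_counit (c : C) : rightAct (Coalgebra.counit (R := R)) c = c := by
  simp [rightAct_apply]

theorem counit_rightAct (f : Module.Dual R C) (c : C) :
    Coalgebra.counit (R := R) (rightAct f c) = f c := by
  have counit_rid (t : C ⊗[R] C) :
      Coalgebra.counit (R := R) (TensorProduct.rid R C (f.lTensor C t)) =
        f (TensorProduct.lid R C ((Coalgebra.counit (R := R)).rTensor C t)) := by
    induction t with
    | zero => simp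
    | tmul a b => simp [mul_comm]
    | add a b ha hb => simp only [map_add, ha, hb]
  rw [rightAct_apply, counit_rid, Coalgebra.rTensor_counit_comul, TensorProduct.lid_tmul, one_smul]

theorem rightAct_of_comul_eq {z g e : C}
    (hz : Coalgebra.comul (R := R) z = z ⊗ₜ[R] g + e ⊗ₜ[R] z) (f : Module.Dual R C) :
    rightAct f z = f g • z + f z • e := by
  simp [rightAct_apply, hz]

theorem leftAct_of_comul_eq {z g e : C}
    (hz : Coalgebra.comul (R := R) z = z ⊗ₜ[R] g + e ⊗ₜ[R] z) (f : Module.Dual R C) :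
    leftAct f z = f z • g + f e • z := by
  simp [leftAct_apply, hz]

theorem rightAct_of_isGroupLikeElem {g : C} (hg : IsGroupLikeElem R g) (f : Module.Dual R C) :
    rightAct f g = f g • g := by
  simp [rightAct_apply, hg.comul_eq_tmul_self]

theorem leftAct_of_isGroupLikeElem {g : C} (hg : IsGroupLikeElem R g) (f : Module.Dual R C) :
    leftAct f g = f g • g := by
  simp [leftAct_apply, hg.comul_eq_tmul_self]

theorem rightAct_tensorFunctional (f : Module.Dual R C) (f' : Module.Dual R D) :
    rightAct (tensorFunctional f f') = TensorProduct.map (rightAct f) (rightAct f') := by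
  have rid_lTensor (s : C ⊗[R] C) (t : D ⊗[R] D) :
      TensorProduct.rid R (C ⊗[R] D) ((tensorFunctional f f').lTensor (C ⊗[R] D)
        (TensorProduct.AlgebraTensorModule.tensorTensorTensorComm R R R R C C D D (s ⊗ₜ[R] t))) =
      TensorProduct.rid R C (f.lTensor C s) ⊗ₜ[R] TensorProduct.rid R D (f'.lTensor D t) := by
    induction s with
    | zero => simp
    | add a b ha hb => simp only [map_add, TensorProduct.add_tmul, ha, hb]
    | tmul a b =>
      induction t with
      | zero => simp
      | add a b ha hb => simp only [map_add, TensorProduct.tmul_add, ha, hb]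
      | tmul c d => simp [TensorProduct.smul_tmul', TensorProduct.tmul_smul, smul_smul, mul_comm]
  ext c d
  simp [rightAct_apply, TensorProduct.comul_tmul, rid_lTensor]

theorem leftAct_tensorFunctional (f : Module.Dual R C) (f' : Module.Dual R D) :
    leftAct (tensorFunctional f f') = TensorProduct.map (leftAct f) (leftAct f') := by
  have lid_rTensor (s : C ⊗[R] C) (t : D ⊗[R] D) :
      TensorProduct.lid R (C ⊗[R] D) ((tensorFunctional f f').rTensor (C ⊗[R] D)
        (TensorProduct.AlgebraTensorModule.tensorTensorTensorComm R R R R C C D D (s ⊗ₜ[R] t))) =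
      TensorProduct.lid R C (f.rTensor C s) ⊗ₜ[R] TensorProduct.lid R D (f'.rTensor D t) := by
    induction s with
    | zero => simp
    | add a b ha hb => simp only [map_add, TensorProduct.add_tmul, ha, hb]
    | tmul a b =>
      induction t with
      | zero => simp
      | add a b ha hb => simp only [map_add, TensorProduct.tmul_add, ha, hb]
      | tmul c d => simp [TensorProduct.smul_tmul', TensorProduct.tmul_smul, smul_smul, mul_comm]
  ext c d
  simp [leftAct_apply, TensorProduct.comul_tmul, lid_rTensor]

theorem tensorFunctional_rightAct_comm (f : Module.Dual R C) (f' : Module.Dual R D)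
    (z : C ⊗[R] D) :
    tensorFunctional f Coalgebra.counit
        (rightAct (tensorFunctional Coalgebra.counit f') z) =
      tensorFunctional Coalgebra.counit f'
        (rightAct (tensorFunctional f Coalgebra.counit) z) := by
  induction z with
  | zero => simp
  | add a b ha hb => simp only [map_add, ha, hb]
  | tmul c d =>
    simp only [rightAct_tensorFunctional, TensorProduct.map_tmul, rightAct_counit,
      tensorFunctional_tmul, counit_rightAct]

end CoalgebraAction

section BialgebraAction

variable {R A : Type*} [CommSemiring R] [Semiring A] [Bialgebra R A]

theorem rightAct_one (f : Module.Dual R A) : rightAct f 1 = f 1 • 1 :=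
  rightAct_of_isGroupLikeElem IsGroupLikeElem.one f

theorem rid_lTensor_tmul_mul (f : Module.Dual R A) (y z : A) (t : A ⊗[R] A) :
    TensorProduct.rid R A (f.lTensor A (y ⊗ₜ[R] z * t)) =
      y * TensorProduct.rid R A ((f ∘ₗ LinearMap.mulLeft R z).lTensor A t) := by
  induction t with
  | zero => simp
  | tmul a b => simp
  | add a b ha hb => rw [mul_add, map_add, map_add, ha, hb, map_add, map_add, mul_add]

theorem rightAct_mul_of_isGroupLikeElem {g : A} (hg : IsGroupLikeElem R g) (f : Module.Dual R A)
    (a : A) : rightAct f (g * a) = g * rightAct (f ∘ₗ LinearMap.mulLeft R g) a := by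
  rw [rightAct_apply, Bialgebra.comul_mul, hg.comul_eq_tmul_self, rid_lTensor_tmul_mul,
    rightAct_apply]

theorem rightAct_mul_of_comul_eq {z g e : A}
    (hz : Coalgebra.comul (R := R) z = z ⊗ₜ[R] g + e ⊗ₜ[R] z) (f : Module.Dual R A) (a : A) :
    rightAct f (z * a) = z * rightAct (f ∘ₗ LinearMap.mulLeft R g) a +
      e * rightAct (f ∘ₗ LinearMap.mulLeft R z) a := by
  rw [rightAct_apply, Bialgebra.comul_mul, hz, add_mul, map_add, map_add, rid_lTensor_tmul_mul,
    rid_lTensor_tmul_mul, rightAct_apply, rightAct_apply]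

/-- For a multiplicative functional `χ`, the operator `rightAct χ` as an algebra map. -/
noncomputable def rightActAlgHom (χ : A →ₐ[R] R) : A →ₐ[R] A :=
  (Algebra.TensorProduct.rid R R A).toAlgHom.comp
    ((Algebra.TensorProduct.map (AlgHom.id R A) χ).comp (Bialgebra.comulAlgHom R A))

/-- For a multiplicative functional `χ`, the operator `leftAct χ` as an algebra map. -/
noncomputable def leftActAlgHom (χ : A →ₐ[R] R) : A →ₐ[R] A :=
  (Algebra.TensorProduct.lid R A).toAlgHom.comp
    ((Algebra.TensorProduct.map χ (AlgHom.id R A)).comp (Bialgebra.comulAlgHom R A))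

theorem rightActAlgHom_toLinearMap (χ : A →ₐ[R] R) :
    (rightActAlgHom χ).toLinearMap = rightAct χ.toLinearMap := rfl

theorem leftActAlgHom_toLinearMap (χ : A →ₐ[R] R) :
    (leftActAlgHom χ).toLinearMap = leftAct χ.toLinearMap := rfl

end BialgebraAction

section JointEigenvectors

variable {R V ι : Type*} [CommRing R] [AddCommGroup V] [Module R V]

theorem basis_repr_apply_of_apply_eq_smul (b : Module.Basis ι R V) {T : Module.End R V}
    {μ : ι → R} (hT : ∀ i, T (b i) = μ i • b i) (v : V) (i : ι) :
    b.repr (T v) i = μ i * b.repr v i := by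
  suffices b.coord i ∘ₗ T = μ i • b.coord i from LinearMap.congr_fun this v
  refine b.ext fun j => ?_
  obtain rfl | hij := eq_or_ne j i
  · simp [hT]
  · simp [hT, hij]

theorem linearIndependent_of_forall_apply_eq_smul [IsDomain R] [Module.IsTorsionFree R V]
    {J : Type*} {T : J → Module.End R V} (comm : ∀ i j, Commute (T i) (T j)) {v : ι → V}
    (hv : ∀ i, v i ≠ 0) {μ : ι → J → R} (hμ : Function.Injective μ)
    (hT : ∀ i j, T j (v i) = μ i j • v i) : LinearIndependent R v := by
  refine ((Module.End.independent_iInf_maxGenEigenspace_of_forall_mapsTo T fun i j c =>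
    Module.End.mapsTo_maxGenEigenspace_of_comm (comm j i) c).comp hμ).linearIndependent _
    (fun i => ?_) hv
  simp only [Function.comp_apply, Submodule.mem_iInf]
  exact fun j => Module.End.mem_maxGenEigenspace _ _ _ |>.mpr ⟨1, by simp [hT]⟩

end JointEigenvectors

namespace TaftAlgebra

variable {k : Type u} [Field k] {q : k} {m : ℕ}

theorem induction_left {P : TaftAlgebra q m → Prop} (one : P 1)
    (h_mul : ∀ a, P a → P (h q m * a)) (x_mul : ∀ a, P a → P (x q m * a))
    (smul : ∀ (c : k) a, P a → P (c • a)) (add : ∀ a b, P a → P b → P (a + b))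
    (a : TaftAlgebra q m) : P a := by
  suffices mul_left : ∀ b, P b → P (a * b) by simpa using mul_left 1 one
  induction a using TaftAlgebra.induction with
  | scalar c => intro b hb; rw [← Algebra.smul_def]; exact smul c b hb
  | gen_h => exact h_mul
  | gen_x => exact x_mul
  | mul a b ha hb => intro c hc; rw [mul_assoc]; exact ha _ (hb _ hc)
  | add a b ha hb => intro c hc; rw [add_mul]; exact add _ _ (ha _ hc) (hb _ hc)

theorem x_mul_h_pow (a : ℕ) : x q m * h q m ^ a = q ^ a • (h q m ^ a * x q m) :=
  mul_pow_of_qComm (x_mul_h q m) a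

theorem isUnit_h [NeZero m] : IsUnit (h q m) :=
  .of_pow_eq_one (h_pow q m) (NeZero.ne m)

/-- The rescaling endomorphism `h ↦ s h`, `x ↦ t x`, where `s ^ m = 1`. -/
noncomputable def scale (s t : k) (hs : s ^ m = 1) : TaftAlgebra q m →ₐ[k] TaftAlgebra q m :=
  lift (s • h q m) (t • x q m) (by rw [smul_pow, h_pow, hs, one_smul])
    (by rw [smul_pow, x_pow, smul_zero])
    (by rw [smul_mul_smul_comm, x_mul_h, smul_mul_smul_comm, smul_comm, mul_comm t])

theorem scale_h (s t : k) (hs : s ^ m = 1) : scale s t hs (h q m) = s • h q m := lift_h ..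

theorem scale_x (s t : k) (hs : s ^ m = 1) : scale s t hs (x q m) = t • x q m := lift_x ..

theorem scale_monomial (s t : k) (hs : s ^ m = 1) (a i : ℕ) :
    scale s t hs (h q m ^ a * x q m ^ i) = (s ^ a * t ^ i) • (h q m ^ a * x q m ^ i) := by
  rw [map_mul, map_pow, map_pow, scale_h, scale_x, smul_pow, smul_pow, smul_mul_smul_comm]

theorem scale_mul_scale (s t s' t' : k) (hs : s ^ m = 1) (hs' : s' ^ m = 1) :
    scale s t hs * scale s' t' hs' =
      scale (q := q) (s * s') (t * t') (by rw [mul_pow, hs, hs', one_mul]) :=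
  algHom_ext (by simp [scale_h, smul_smul, mul_comm]) (by simp [scale_x, smul_smul, mul_comm])

theorem scale_one_one : scale (q := q) 1 1 (one_pow m) = 1 :=
  algHom_ext (by simp [scale_h]) (by simp [scale_x])

theorem scale_commute (s t s' t' : k) (hs : s ^ m = 1) (hs' : s' ^ m = 1) :
    Commute (scale (q := q) s t hs) (scale s' t' hs') := by
  simp only [Commute, SemiconjBy, scale_mul_scale, mul_comm]

theorem scale_pow (s t : k) (hs : s ^ m = 1) (i : ℕ) :
    scale (q := q) s t hs ^ i = scale (s ^ i) (t ^ i) (by rw [pow_right_comm, hs, one_pow]) := by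
  induction i with
  | zero => simp only [pow_zero, scale_one_one]
  | succ i ih => simp only [pow_succ, ih, scale_mul_scale]

/-- The character `h ↦ s`, `x ↦ 0`, where `s ^ m = 1`. -/
noncomputable def character [NeZero m] (s : k) (hs : s ^ m = 1) : TaftAlgebra q m →ₐ[k] k :=
  lift s 0 hs (zero_pow (NeZero.ne m)) (by simp)

theorem character_h [NeZero m] (s : k) (hs : s ^ m = 1) : character s hs (h q m) = s := lift_h ..

theorem character_x [NeZero m] (s : k) (hs : s ^ m = 1) : character s hs (x q m) = 0 := lift_x ..

section Hopf

variable [hq : Fact (IsPrimitiveRoot q m)]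

variable (q m) in
theorem q_pow_eq_one : q ^ m = 1 := hq.out.pow_eq_one

theorem qInt_ne_zero {i : ℕ} (h0 : i ≠ 0) (hi : i < m) : qInt q i ≠ 0 := by
  obtain ⟨j, rfl⟩ := Nat.exists_eq_succ_of_ne_zero h0
  exact right_ne_zero_of_mul (qFact_succ q j ▸ qFact_ne_zero hq.out hi)

theorem pow_fin_inj {a b : Fin m} (hab : q ^ (a : ℕ) = q ^ (b : ℕ)) : a = b :=
  Fin.ext (hq.out.pow_inj a.2 b.2 hab)

theorem pow_fin_eq_one [NeZero m] {a : Fin m} (ha : q ^ (a : ℕ) = 1) : a = 0 :=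
  pow_fin_inj (q := q) (by simpa using ha)

variable [NeZero m]

theorem comul_h : Coalgebra.comul (R := k) (h q m) = h q m ⊗ₜ[k] h q m :=
  comulHom_h q m hq.out

theorem comul_x : Coalgebra.comul (R := k) (x q m) = x q m ⊗ₜ[k] h q m + 1 ⊗ₜ[k] x q m :=
  comulHom_x q m hq.out

theorem counit_h : Coalgebra.counit (R := k) (h q m) = 1 := counitHom_h q m (NeZero.ne m)

theorem counit_x : Coalgebra.counit (R := k) (x q m) = 0 := counitHom_x q m (NeZero.ne m)

theorem isGroupLikeElem_h : IsGroupLikeElem k (h q m) := ⟨counit_h, comul_h⟩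

instance : Nontrivial (TaftAlgebra q m) :=
  (Bialgebra.counitAlgHom k (TaftAlgebra q m)).toRingHom.domain_nontrivial

theorem rightAct_character (s : k) (hs : s ^ m = 1) :
    rightAct (character (q := q) s hs).toLinearMap = (scale s s hs).toLinearMap := by
  rw [← rightActAlgHom_toLinearMap]
  congr 1
  apply algHom_ext
  · simp [rightActAlgHom, comul_h, character_h, scale_h]
  · simp [rightActAlgHom, comul_x, character_h, character_x, scale_x]

theorem leftAct_character (s : k) (hs : s ^ m = 1) :
    leftAct (character (q := q) s hs).toLinearMap = (scale s 1 hs).toLinearMap := by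
  rw [← leftActAlgHom_toLinearMap]
  congr 1
  apply algHom_ext
  · simp [leftActAlgHom, comul_h, character_h, scale_h]
  · simp [leftActAlgHom, comul_x, character_x, scale_x]

end Hopf

section SkewDerivation

variable [m.AtLeastTwo] [hq : Fact (IsPrimitiveRoot q m)]

/-- The two-dimensional representation `h ↦ diag (1, q)`, `x ↦ E₁₂`. -/
noncomputable def matrixRep : TaftAlgebra q m →ₐ[k] Matrix (Fin 2) (Fin 2) k :=
  lift (Matrix.diagonal ![1, q]) !![0, 1; 0, 0]
    (by
      rw [Matrix.diagonal_pow, ← Matrix.diagonal_one]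
      congr 1
      ext i
      fin_cases i <;> simp [q_pow_eq_one q m])
    (by
      have sq_eq_zero : (!![0, 1; 0, 0] : Matrix (Fin 2) (Fin 2) k) ^ 2 = 0 := by
        simp [pow_two, ← Matrix.ext_iff, Fin.forall_fin_two]
      exact pow_eq_zero_of_le Nat.AtLeastTwo.prop sq_eq_zero)
    (by
      ext i j
      fin_cases i <;> fin_cases j <;> simp [Matrix.diagonal, Matrix.mul_apply])

theorem matrixRep_h : matrixRep (h q m) = Matrix.diagonal ![1, q] := lift_h ..

theorem matrixRep_x : matrixRep (x q m) = !![0, 1; 0, 0] := lift_x ..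

theorem matrixRep_one_one (a : TaftAlgebra q m) :
    matrixRep a 1 1 = character q (q_pow_eq_one q m) a := by
  induction a using induction_left with
  | one => simp
  | h_mul a ha => simp [matrixRep_h, character_h, ha]
  | x_mul a _ => simp [matrixRep_x, character_x, Matrix.mul_apply]
  | smul c a ha => simp [ha]
  | add a b ha hb => simp [ha, hb]

/-- The skew derivation with `h ↦ 0` and `x ↦ 1`, obeying `D (a * b) = ε a * D b + D a * χ b` for
the character `χ` with `h ↦ q`; it is realized as a matrix coefficient. -/
noncomputable def skewDer : TaftAlgebra q m →ₗ[k] k :=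
  Matrix.entryLinearMap k k 0 1 ∘ₗ matrixRep.toLinearMap

theorem skewDer_apply (a : TaftAlgebra q m) : skewDer a = matrixRep a 0 1 := rfl

theorem skewDer_h_mul (a : TaftAlgebra q m) : skewDer (h q m * a) = skewDer a := by
  simp [skewDer_apply, matrixRep_h]

theorem skewDer_x_mul (a : TaftAlgebra q m) :
    skewDer (x q m * a) = character q (q_pow_eq_one q m) a := by
  rw [← matrixRep_one_one, skewDer_apply, map_mul, matrixRep_x, Matrix.mul_apply]
  simp

theorem skewDer_one : skewDer (1 : TaftAlgebra q m) = 0 := by simp [skewDer_apply]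

theorem skewDer_h_pow (a : ℕ) : skewDer (h q m ^ a) = 0 := by
  induction a with
  | zero => rw [pow_zero, skewDer_one]
  | succ a ih => rw [pow_succ', skewDer_h_mul, ih]

theorem skewDer_h : skewDer (h q m) = 0 := by simpa using skewDer_h_pow (q := q) (m := m) 1

theorem skewDer_x : skewDer (x q m) = 1 := by
  simpa using skewDer_x_mul (1 : TaftAlgebra q m)

theorem skewDer_comp_mulLeft_h : skewDer ∘ₗ LinearMap.mulLeft k (h q m) = skewDer :=
  LinearMap.ext skewDer_h_mul

theorem skewDer_comp_mulLeft_x : skewDer ∘ₗ LinearMap.mulLeft k (x q m) =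
    (character q (q_pow_eq_one q m)).toLinearMap :=
  LinearMap.ext skewDer_x_mul

theorem rightAct_skewDer_one : rightAct skewDer (1 : TaftAlgebra q m) = 0 := by
  rw [rightAct_one, skewDer_one, zero_smul]

theorem rightAct_skewDer_h_mul (a : TaftAlgebra q m) :
    rightAct skewDer (h q m * a) = h q m * rightAct skewDer a := by
  rw [rightAct_mul_of_isGroupLikeElem isGroupLikeElem_h, skewDer_comp_mulLeft_h]

theorem rightAct_skewDer_x_mul (a : TaftAlgebra q m) :
    rightAct skewDer (x q m * a) =
      x q m * rightAct skewDer a + scale q q (q_pow_eq_one q m) a := by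
  rw [rightAct_mul_of_comul_eq comul_x, skewDer_comp_mulLeft_h, skewDer_comp_mulLeft_x,
    rightAct_character, one_mul, AlgHom.toLinearMap_apply]

theorem rightAct_skewDer_x_pow (i : ℕ) :
    rightAct skewDer (x q m ^ i) = qInt q i • x q m ^ (i - 1) := by
  induction i with
  | zero => simp [rightAct_skewDer_one, qInt]
  | succ i ih =>
    rw [pow_succ', rightAct_skewDer_x_mul, ih, map_pow, scale_x, smul_pow, mul_smul_comm,
      ← pow_succ', Nat.add_sub_cancel, qInt, qInt, Finset.sum_range_succ, add_smul]
    congr 1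
    cases i <;> simp

theorem x_pow_ne_zero {i : ℕ} (hi : i < m) : x q m ^ i ≠ 0 := by
  induction i with
  | zero => simp
  | succ i ih =>
    intro h0
    have h1 := rightAct_skewDer_x_pow (q := q) (m := m) (i + 1)
    rw [h0, map_zero, Nat.add_sub_cancel] at h1
    exact smul_ne_zero (qInt_ne_zero i.succ_ne_zero hi) (ih (by omega)) h1.symm

end SkewDerivation

section MonomialBasis

/-- The monomials `h ^ a * x ^ i` with `0 ≤ a, i < m`. -/
noncomputable def monomial (q : k) (m : ℕ) (I : Fin m × Fin m) : TaftAlgebra q m :=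
  h q m ^ (I.1 : ℕ) * x q m ^ (I.2 : ℕ)

theorem monomial_ne_zero [m.AtLeastTwo] [Fact (IsPrimitiveRoot q m)] (I : Fin m × Fin m) :
    monomial q m I ≠ 0 := fun h0 =>
  x_pow_ne_zero I.2.2 ((isUnit_h.pow _).mul_right_eq_zero.mp h0)

theorem linearIndependent_monomial [m.AtLeastTwo] [Fact (IsPrimitiveRoot q m)] :
    LinearIndependent k (monomial q m) := by
  refine linearIndependent_of_forall_apply_eq_smul
    (T := ![AlgHom.toEnd (scale q 1 (q_pow_eq_one q m)), AlgHom.toEnd (scale 1 q (one_pow m))])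
    (μ := fun I => ![q ^ (I.1 : ℕ), q ^ (I.2 : ℕ)]) ?_ monomial_ne_zero ?_ ?_
  · intro i j
    fin_cases i <;> fin_cases j <;> exact (scale_commute ..).map AlgHom.toEnd
  · rintro ⟨a, i⟩ ⟨b, j⟩ hab
    exact Prod.ext (pow_fin_inj (congrFun hab 0)) (pow_fin_inj (congrFun hab 1))
  · simp [Fin.forall_fin_two, monomial, scale_monomial]

theorem h_pow_mul_x_pow_mem_span_monomial [NeZero m] (a i : ℕ) :
    h q m ^ a * x q m ^ i ∈ Submodule.span k (Set.range (monomial q m)) := by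
  rcases lt_or_ge i m with hi | hi
  · rw [pow_eq_pow_mod a (h_pow q m)]
    exact Submodule.subset_span ⟨(⟨a % m, Nat.mod_lt _ (NeZero.pos m)⟩, ⟨i, hi⟩), rfl⟩
  · rw [pow_eq_zero_of_le hi (x_pow q m), mul_zero]
    exact Submodule.zero_mem _

theorem span_monomial [NeZero m] : ⊤ ≤ Submodule.span k (Set.range (monomial q m)) := by
  have mul_mem (y : TaftAlgebra q m)
      (hy : ∀ a i : ℕ, y * (h q m ^ a * x q m ^ i) ∈ Submodule.span k (Set.range (monomial q m))) :
      ∀ z ∈ Submodule.span k (Set.range (monomial q m)),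
        y * z ∈ Submodule.span k (Set.range (monomial q m)) := by
    intro z hz
    induction hz using Submodule.span_induction with
    | mem z hz => obtain ⟨I, rfl⟩ := hz; exact hy _ _
    | zero => rw [mul_zero]; exact Submodule.zero_mem _
    | add z w _ _ hz hw => rw [mul_add]; exact Submodule.add_mem _ hz hw
    | smul c z _ hz => rw [mul_smul_comm]; exact Submodule.smul_mem _ _ hz
  rintro a -
  induction a using induction_left with
  | one => simpa using h_pow_mul_x_pow_mem_span_monomial (q := q) (m := m) 0 0
  | h_mul a ha =>
    refine mul_mem _ (fun a i => ?_) a ha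
    rw [← mul_assoc, ← pow_succ']
    exact h_pow_mul_x_pow_mem_span_monomial _ _
  | x_mul a ha =>
    refine mul_mem _ (fun a i => ?_) a ha
    rw [← mul_assoc, x_mul_h_pow, smul_mul_assoc, mul_assoc, ← pow_succ']
    exact Submodule.smul_mem _ _ (h_pow_mul_x_pow_mem_span_monomial _ _)
  | smul c a ha => exact Submodule.smul_mem _ _ ha
  | add a b ha hb => exact Submodule.add_mem _ ha hb

/-- The monomials as a basis of the Taft algebra. -/
noncomputable def monomialBasis (q : k) (m : ℕ) [m.AtLeastTwo] [Fact (IsPrimitiveRoot q m)] :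
    Module.Basis (Fin m × Fin m) k (TaftAlgebra q m) :=
  Module.Basis.mk linearIndependent_monomial span_monomial

theorem monomialBasis_apply [m.AtLeastTwo] [Fact (IsPrimitiveRoot q m)] (I : Fin m × Fin m) :
    monomialBasis q m I = h q m ^ (I.1 : ℕ) * x q m ^ (I.2 : ℕ) :=
  Module.Basis.mk_apply ..

end MonomialBasis

end TaftAlgebra

section SkewPrimitive

variable {R A : Type*} [CommRing R] [Ring A] [Bialgebra R A]

theorem counit_eq_zero_of_comul_eq {z g : A} (hg : IsGroupLikeElem R g)
    (hz : Coalgebra.comul (R := R) z = z ⊗ₜ[R] g + 1 ⊗ₜ[R] z) :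
    Coalgebra.counit (R := R) z = 0 := by
  have counit_counit := congrArg (Coalgebra.counit (R := R))
    (rightAct_of_comul_eq hz (Coalgebra.counit (R := R)))
  simpa [rightAct_counit, hg.counit_eq_one] using counit_counit

theorem smul_rightAct_of_comul_eq {z g w : A} {c c' : R} (hg : IsGroupLikeElem R g)
    (hz : Coalgebra.comul (R := R) z = z ⊗ₜ[R] g + 1 ⊗ₜ[R] z) (hzw : z = c • w + c' • (1 - g))
    {f : Module.Dual R A} (hfg : f g = 0) (hf1 : f 1 = 0) : c • rightAct f w = f z • 1 := by
  have hfz := rightAct_of_comul_eq hz f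
  rw [hfg, zero_smul, zero_add] at hfz
  rw [← hfz, hzw, map_add, map_smul, map_smul, map_sub, rightAct_one,
    rightAct_of_isGroupLikeElem hg, hfg, hf1]
  simp

end SkewPrimitive

namespace TaftAlgebra

section TensorCoalgebra

variable {k : Type u} [Field k] {p : k} {n : ℕ} {q : k} {m : ℕ}

/-- The character of a tensor product of two Taft algebras sending `h ⊗ 1`, `1 ⊗ h` to `s`, `t` and
`x ⊗ 1`, `1 ⊗ x` to `0`. -/
noncomputable def tensorCharacter [NeZero n] [NeZero m] {s t : k} (hs : s ^ n = 1)
    (ht : t ^ m = 1) : Module.Dual k (TaftAlgebra p n ⊗[k] TaftAlgebra q m) :=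
  tensorFunctional (character s hs).toLinearMap (character t ht).toLinearMap

theorem tensorCharacter_h_pow [NeZero n] [NeZero m] {s t : k} (hs : s ^ n = 1) (ht : t ^ m = 1)
    (a b : ℕ) : tensorCharacter hs ht ((h p n ^ a) ⊗ₜ[k] (h q m ^ b)) = s ^ a * t ^ b := by
  simp [tensorCharacter, character_h]

variable [n.AtLeastTwo] [m.AtLeastTwo] [hp : Fact (IsPrimitiveRoot p n)]
  [hq : Fact (IsPrimitiveRoot q m)]

variable (p n q m) in
/-- The basis of the tensor product of two Taft algebras given by the tensors of two monomials. -/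
noncomputable def tensorBasis : Module.Basis ((Fin n × Fin n) × (Fin m × Fin m)) k
    (TaftAlgebra p n ⊗[k] TaftAlgebra q m) :=
  (monomialBasis p n).tensorProduct (monomialBasis q m)

theorem tensorBasis_apply (I : (Fin n × Fin n) × (Fin m × Fin m)) :
    tensorBasis p n q m I = (h p n ^ (I.1.1 : ℕ) * x p n ^ (I.1.2 : ℕ)) ⊗ₜ[k]
      (h q m ^ (I.2.1 : ℕ) * x q m ^ (I.2.2 : ℕ)) := by
  rw [tensorBasis, Module.Basis.tensorProduct_apply, monomialBasis_apply, monomialBasis_apply]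

theorem tensorBasis_h (a : Fin n) (b : Fin m) :
    tensorBasis p n q m ((a, 0), (b, 0)) = (h p n ^ (a : ℕ)) ⊗ₜ[k] (h q m ^ (b : ℕ)) := by
  simp [tensorBasis_apply]

theorem tensorBasis_x (i : Fin n) (j : Fin m) :
    tensorBasis p n q m ((0, i), (0, j)) = (x p n ^ (i : ℕ)) ⊗ₜ[k] (x q m ^ (j : ℕ)) := by
  simp [tensorBasis_apply]

theorem tensorBasis_zero : tensorBasis p n q m ((0, 0), (0, 0)) = 1 := by
  simp [tensorBasis_apply, Algebra.TensorProduct.one_def]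

theorem repr_rightAct_tensorCharacter {s t : k} (hs : s ^ n = 1) (ht : t ^ m = 1)
    (z : TaftAlgebra p n ⊗[k] TaftAlgebra q m) (I : (Fin n × Fin n) × (Fin m × Fin m)) :
    (tensorBasis p n q m).repr (rightAct (tensorCharacter hs ht) z) I =
      (s ^ (I.1.1 : ℕ) * s ^ (I.1.2 : ℕ) * (t ^ (I.2.1 : ℕ) * t ^ (I.2.2 : ℕ))) *
        (tensorBasis p n q m).repr z I := by
  refine basis_repr_apply_of_apply_eq_smul (μ := fun I => s ^ (I.1.1 : ℕ) * s ^ (I.1.2 : ℕ) *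
    (t ^ (I.2.1 : ℕ) * t ^ (I.2.2 : ℕ))) (tensorBasis p n q m) (fun I => ?_) z I
  rw [tensorBasis_apply, tensorCharacter, rightAct_tensorFunctional, rightAct_character,
    rightAct_character, TensorProduct.map_tmul, AlgHom.toLinearMap_apply, AlgHom.toLinearMap_apply,
    scale_monomial, scale_monomial, TensorProduct.smul_tmul_smul]

theorem repr_leftAct_tensorCharacter {s t : k} (hs : s ^ n = 1) (ht : t ^ m = 1)
    (z : TaftAlgebra p n ⊗[k] TaftAlgebra q m) (I : (Fin n × Fin n) × (Fin m × Fin m)) :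
    (tensorBasis p n q m).repr (leftAct (tensorCharacter hs ht) z) I =
      (s ^ (I.1.1 : ℕ) * t ^ (I.2.1 : ℕ)) * (tensorBasis p n q m).repr z I := by
  refine basis_repr_apply_of_apply_eq_smul (μ := fun I => s ^ (I.1.1 : ℕ) * t ^ (I.2.1 : ℕ))
    (tensorBasis p n q m) (fun I => ?_) z I
  rw [tensorBasis_apply, tensorCharacter, leftAct_tensorFunctional, leftAct_character,
    leftAct_character, TensorProduct.map_tmul, AlgHom.toLinearMap_apply, AlgHom.toLinearMap_apply,
    scale_monomial, scale_monomial, TensorProduct.smul_tmul_smul, one_pow, one_pow, mul_one,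
    mul_one]

theorem tensorCharacter_eq_of_isGroupLikeElem {g : TaftAlgebra p n ⊗[k] TaftAlgebra q m}
    (hg : IsGroupLikeElem k g) {s t : k} (hs : s ^ n = 1) (ht : t ^ m = 1)
    {I : (Fin n × Fin n) × (Fin m × Fin m)} (hI : (tensorBasis p n q m).repr g I ≠ 0) :
    tensorCharacter hs ht g =
        s ^ (I.1.1 : ℕ) * s ^ (I.1.2 : ℕ) * (t ^ (I.2.1 : ℕ) * t ^ (I.2.2 : ℕ)) ∧
      tensorCharacter hs ht g = s ^ (I.1.1 : ℕ) * t ^ (I.2.1 : ℕ) := by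
  have right_weight := repr_rightAct_tensorCharacter hs ht g I
  have left_weight := repr_leftAct_tensorCharacter hs ht g I
  rw [rightAct_of_isGroupLikeElem hg, map_smul] at right_weight
  rw [leftAct_of_isGroupLikeElem hg, map_smul] at left_weight
  exact ⟨mul_right_cancel₀ hI right_weight, mul_right_cancel₀ hI left_weight⟩

/-- The two actions of a character on a group-like element agree, so only monomials without
`x`-part occur; the value of the characters then pins down the monomial. -/
theorem exists_eq_h_pow_of_isGroupLikeElem {g : TaftAlgebra p n ⊗[k] TaftAlgebra q m}
    (hg : IsGroupLikeElem k g) :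
    ∃ (a : Fin n) (b : Fin m), g = (h p n ^ (a : ℕ)) ⊗ₜ[k] (h q m ^ (b : ℕ)) := by
  set B := tensorBasis p n q m with hB
  have x_exponents {I} (hI : B.repr g I ≠ 0) : I.1.2 = 0 ∧ I.2.2 = 0 := by
    obtain ⟨right_p, left_p⟩ :=
      tensorCharacter_eq_of_isGroupLikeElem hg (q_pow_eq_one p n) (one_pow m) hI
    obtain ⟨right_q, left_q⟩ :=
      tensorCharacter_eq_of_isGroupLikeElem hg (one_pow n) (q_pow_eq_one q m) hI
    rw [left_p] at right_p
    rw [left_q] at right_q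
    simp only [one_pow, mul_one, one_mul, left_eq_mul₀, ne_eq, pow_eq_zero_iff',
      hp.out.ne_zero (NeZero.ne n), hq.out.ne_zero (NeZero.ne m), false_and, not_false_eq_true]
      at right_p right_q
    exact ⟨pow_fin_eq_one right_p, pow_fin_eq_one right_q⟩
  have h_exponents {I J} (hI : B.repr g I ≠ 0) (hJ : B.repr g J ≠ 0) :
      J.1.1 = I.1.1 ∧ J.2.1 = I.2.1 := by
    have hp_pow := (tensorCharacter_eq_of_isGroupLikeElem hg (q_pow_eq_one p n) (one_pow m) hJ).2
    have hq_pow := (tensorCharacter_eq_of_isGroupLikeElem hg (one_pow n) (q_pow_eq_one q m) hJ).2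
    rw [(tensorCharacter_eq_of_isGroupLikeElem hg _ _ hI).2] at hp_pow hq_pow
    simp only [one_pow, mul_one, one_mul] at hp_pow hq_pow
    exact ⟨pow_fin_inj hp_pow.symm, pow_fin_inj hq_pow.symm⟩
  obtain ⟨⟨⟨a, i⟩, ⟨b, j⟩⟩, hI⟩ : ∃ I, B.repr g I ≠ 0 :=
    Finsupp.ne_iff.mp (B.repr.map_ne_zero_iff.mpr hg.ne_zero)
  obtain ⟨rfl, rfl⟩ : i = 0 ∧ j = 0 := x_exponents hI
  have support_subset : ((B.repr g).support : Set ((Fin n × Fin n) × (Fin m × Fin m))) ⊆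
      {((a, 0), (b, 0))} := fun J hJ => by
    rw [Finset.mem_coe, Finsupp.mem_support_iff] at hJ
    exact Prod.ext (Prod.ext (h_exponents hI hJ).1 (x_exponents hJ).1)
      (Prod.ext (h_exponents hI hJ).2 (x_exponents hJ).2)
  rw [← B.mem_span_image, Set.image_singleton, Submodule.mem_span_singleton, hB, tensorBasis_h]
    at support_subset
  obtain ⟨c, rfl⟩ := support_subset
  have hc : c = 1 := by simpa [Bialgebra.counit_pow, counit_h] using hg.counit_eq_one
  exact ⟨a, b, by rw [hc, one_smul]⟩

section SkewPrimitiveWeights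

variable {u : Fin n} {v : Fin m} {g z : TaftAlgebra p n ⊗[k] TaftAlgebra q m}
  {J : (Fin n × Fin n) × (Fin m × Fin m)}

theorem left_weight_of_comul_eq (hg : g = (h p n ^ (u : ℕ)) ⊗ₜ[k] (h q m ^ (v : ℕ)))
    (hz : Coalgebra.comul (R := k) z = z ⊗ₜ[k] g + 1 ⊗ₜ[k] z)
    (hJ : (tensorBasis p n q m).repr z J ≠ 0) (hJg : J ≠ ((u, 0), (v, 0))) {s t : k}
    (hs : s ^ n = 1) (ht : t ^ m = 1) : s ^ (J.1.1 : ℕ) * t ^ (J.2.1 : ℕ) = 1 := by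
  have left_weight := repr_leftAct_tensorCharacter hs ht z J
  rw [leftAct_of_comul_eq hz, hg, ← tensorBasis_h, map_add, map_smul, map_smul, Finsupp.add_apply,
    Finsupp.smul_apply, Module.Basis.repr_self, Finsupp.single_eq_of_ne hJg, smul_zero,
    zero_add] at left_weight
  refine mul_right_cancel₀ hJ (left_weight.symm.trans ?_)
  simp [tensorCharacter, Algebra.TensorProduct.one_def]

theorem right_weight_of_comul_eq (hg : g = (h p n ^ (u : ℕ)) ⊗ₜ[k] (h q m ^ (v : ℕ)))
    (hz : Coalgebra.comul (R := k) z = z ⊗ₜ[k] g + 1 ⊗ₜ[k] z)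
    (hJ : (tensorBasis p n q m).repr z J ≠ 0) (hJ1 : J ≠ ((0, 0), (0, 0))) {s t : k}
    (hs : s ^ n = 1) (ht : t ^ m = 1) :
    s ^ (J.1.1 : ℕ) * s ^ (J.1.2 : ℕ) * (t ^ (J.2.1 : ℕ) * t ^ (J.2.2 : ℕ)) =
      s ^ (u : ℕ) * t ^ (v : ℕ) := by
  have right_weight := repr_rightAct_tensorCharacter hs ht z J
  rw [rightAct_of_comul_eq hz, ← tensorBasis_zero, map_add, map_smul, map_smul, Finsupp.add_apply,
    Finsupp.smul_apply, Finsupp.smul_apply, Module.Basis.repr_self, Finsupp.single_eq_of_ne hJ1,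
    smul_zero, add_zero, hg, tensorCharacter_h_pow] at right_weight
  exact mul_right_cancel₀ hJ right_weight.symm

theorem exists_eq_of_comul_eq (hg : g = (h p n ^ (u : ℕ)) ⊗ₜ[k] (h q m ^ (v : ℕ)))
    (hz : Coalgebra.comul (R := k) z = z ⊗ₜ[k] g + 1 ⊗ₜ[k] z) :
    ∃ c₀ c₁ c₂ : k, z = c₀ • 1 + c₁ • g +
      c₂ • ((x p n ^ (u : ℕ)) ⊗ₜ[k] (x q m ^ (v : ℕ))) := by
  have support_subset : (((tensorBasis p n q m).repr z).support : Set _) ⊆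
      {((0, 0), (0, 0)), ((u, 0), (v, 0)), ((0, u), (0, v))} := by
    intro J hJ
    rw [Finset.mem_coe, Finsupp.mem_support_iff] at hJ
    refine or_iff_not_imp_left.mpr fun hJ1 => or_iff_not_imp_left.mpr fun hJg => ?_
    have left_p := left_weight_of_comul_eq hg hz hJ hJg (q_pow_eq_one p n) (one_pow m)
    have left_q := left_weight_of_comul_eq hg hz hJ hJg (one_pow n) (q_pow_eq_one q m)
    have right_p := right_weight_of_comul_eq hg hz hJ hJ1 (q_pow_eq_one p n) (one_pow m)
    have right_q := right_weight_of_comul_eq hg hz hJ hJ1 (one_pow n) (q_pow_eq_one q m)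
    simp only [one_pow, mul_one, one_mul] at left_p left_q right_p right_q
    rw [left_p, one_mul] at right_p
    rw [left_q, one_mul] at right_q
    exact Prod.ext (Prod.ext (pow_fin_eq_one left_p) (pow_fin_inj right_p))
      (Prod.ext (pow_fin_eq_one left_q) (pow_fin_inj right_q))
  rw [← Module.Basis.mem_span_image, Set.image_insert_eq, Set.image_insert_eq,
    Set.image_singleton, Submodule.mem_span_triple, tensorBasis_zero, tensorBasis_h, tensorBasis_x,
    ← hg] at support_subset
  obtain ⟨c₀, c₁, c₂, hc⟩ := support_subset
  exact ⟨c₀, c₁, c₂, hc.symm⟩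

end SkewPrimitiveWeights

theorem eq_zero_of_smul_x_pow_tmul_x_pow_eq {i j : ℕ} (hi : i < n) (hj : j < m) {c d : k}
    (hc : c ≠ 0) (hcd : c • ((x p n ^ i) ⊗ₜ[k] (x q m ^ j)) = d • 1) : i = 0 ∧ j = 0 := by
  have heq := congrArg ((tensorBasis p n q m).coord ((0, ⟨i, hi⟩), (0, ⟨j, hj⟩))) hcd
  rw [← tensorBasis_zero, ← tensorBasis_x ⟨i, hi⟩ ⟨j, hj⟩] at heq
  by_contra hij
  have hne : (((0, 0), (0, 0)) : (Fin n × Fin n) × (Fin m × Fin m)) ≠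
      ((0, ⟨i, hi⟩), (0, ⟨j, hj⟩)) := fun h0 => hij <| by
    simp only [Prod.mk.injEq, true_and, Fin.ext_iff, Fin.val_zero] at h0
    exact ⟨h0.1.symm, h0.2.symm⟩
  simp [Finsupp.single_eq_of_ne' hne, hc] at heq

section SkewPrimitive

variable {u : Fin n} {v : Fin m} {g z : TaftAlgebra p n ⊗[k] TaftAlgebra q m} {c c' : k}

theorem exists_eq_x_pow_add_of_comul_eq (hgl : IsGroupLikeElem k g)
    (hg : g = (h p n ^ (u : ℕ)) ⊗ₜ[k] (h q m ^ (v : ℕ)))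
    (hz : Coalgebra.comul (R := k) z = z ⊗ₜ[k] g + 1 ⊗ₜ[k] z) :
    ∃ c c' : k, z = c • ((x p n ^ (u : ℕ)) ⊗ₜ[k] (x q m ^ (v : ℕ))) + c' • (1 - g) := by
  obtain ⟨c₀, c₁, c₂, rfl⟩ := exists_eq_of_comul_eq hg hz
  have counit_eq := counit_eq_zero_of_comul_eq hgl hz
  simp only [map_add, map_smul, Bialgebra.counit_one, hgl.counit_eq_one, TensorProduct.counit_tmul,
    Bialgebra.counit_pow, counit_x, smul_eq_mul, mul_one] at counit_eq
  by_cases huv : (u : ℕ) = 0 ∧ (v : ℕ) = 0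
  · refine ⟨0, 0, ?_⟩
    rw [huv.1, huv.2] at hg counit_eq ⊢
    simp only [pow_zero, mul_one, ← Algebra.TensorProduct.one_def] at hg counit_eq ⊢
    rw [hg, ← add_smul, ← add_smul, counit_eq]
    module
  · have hprod : (0 : k) ^ (v : ℕ) * 0 ^ (u : ℕ) = 0 := by
      rcases not_and_or.mp huv with hu | hv
      · rw [zero_pow hu, mul_zero]
      · rw [zero_pow hv, zero_mul]
    rw [hprod, mul_zero, add_zero] at counit_eq
    refine ⟨c₂, c₀, ?_⟩
    rw [eq_neg_of_add_eq_zero_right counit_eq]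
    module

theorem left_exponent_of_comul_eq (hgl : IsGroupLikeElem k g)
    (hg : g = (h p n ^ (u : ℕ)) ⊗ₜ[k] (h q m ^ (v : ℕ)))
    (hz : Coalgebra.comul (R := k) z = z ⊗ₜ[k] g + 1 ⊗ₜ[k] z)
    (hzc : z = c • ((x p n ^ (u : ℕ)) ⊗ₜ[k] (x q m ^ (v : ℕ))) + c' • (1 - g)) (hc : c ≠ 0)
    (hu : (u : ℕ) ≠ 0) : (u : ℕ) = 1 ∧ (v : ℕ) = 0 := by
  have hact := smul_rightAct_of_comul_eq hgl hz hzc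
    (f := tensorFunctional skewDer Coalgebra.counit) (by simp [hg, skewDer_h_pow])
    (by simp [Algebra.TensorProduct.one_def, skewDer_one])
  rw [rightAct_tensorFunctional, TensorProduct.map_tmul, rightAct_counit, rightAct_skewDer_x_pow,
    TensorProduct.smul_tmul', smul_smul] at hact
  have := eq_zero_of_smul_x_pow_tmul_x_pow_eq (by omega) v.2
    (mul_ne_zero hc (qInt_ne_zero hu u.2)) hact
  omega

theorem right_exponent_of_comul_eq (hgl : IsGroupLikeElem k g)
    (hg : g = (h p n ^ (u : ℕ)) ⊗ₜ[k] (h q m ^ (v : ℕ)))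
    (hz : Coalgebra.comul (R := k) z = z ⊗ₜ[k] g + 1 ⊗ₜ[k] z)
    (hzc : z = c • ((x p n ^ (u : ℕ)) ⊗ₜ[k] (x q m ^ (v : ℕ))) + c' • (1 - g)) (hc : c ≠ 0)
    (hv : (v : ℕ) ≠ 0) : (u : ℕ) = 0 ∧ (v : ℕ) = 1 := by
  have hact := smul_rightAct_of_comul_eq hgl hz hzc
    (f := tensorFunctional Coalgebra.counit skewDer) (by simp [hg, skewDer_h_pow])
    (by simp [Algebra.TensorProduct.one_def, skewDer_one])
  rw [rightAct_tensorFunctional, TensorProduct.map_tmul, rightAct_counit, rightAct_skewDer_x_pow,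
    TensorProduct.tmul_smul, smul_smul] at hact
  have := eq_zero_of_smul_x_pow_tmul_x_pow_eq u.2 (by omega)
    (mul_ne_zero hc (qInt_ne_zero hv v.2)) hact
  omega

theorem skewPrimitive_tensor (hgl : IsGroupLikeElem k g)
    (hz : Coalgebra.comul (R := k) z = z ⊗ₜ[k] g + 1 ⊗ₜ[k] z) :
    (∃ c : k, z = c • (1 - g)) ∨
    (g = h p n ⊗ₜ 1 ∧ ∃ c c' : k, z = c • (x p n ⊗ₜ 1) + c' • (1 - g)) ∨
    (g = 1 ⊗ₜ h q m ∧ ∃ c c' : k, z = c • (1 ⊗ₜ x q m) + c' • (1 - g)) := by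
  obtain ⟨u, v, hg⟩ := exists_eq_h_pow_of_isGroupLikeElem hgl
  obtain ⟨c, c', hzc⟩ := exists_eq_x_pow_add_of_comul_eq hgl hg hz
  by_cases hc : c = 0
  · exact .inl ⟨c', by rw [hzc, hc, zero_smul, zero_add]⟩
  by_cases hu : (u : ℕ) = 0
  · by_cases hv : (v : ℕ) = 0
    · left
      have hc0 := counit_eq_zero_of_comul_eq hgl hz
      simp [hzc, hgl.counit_eq_one, hu, hv, hc] at hc0
    · obtain ⟨hu, hv⟩ := right_exponent_of_comul_eq hgl hg hz hzc hc hv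
      rw [hu, hv, pow_zero, pow_one] at hg hzc
      exact .inr (.inr ⟨hg, c, c', hzc⟩)
  · obtain ⟨hu, hv⟩ := left_exponent_of_comul_eq hgl hg hz hzc hc hu
    rw [hu, hv, pow_zero, pow_one] at hg hzc
    exact .inr (.inl ⟨hg, c, c', hzc⟩)

end SkewPrimitive

end TensorCoalgebra

end TaftAlgebra

section MulMap

variable {R A B E : Type*} [CommSemiring R] [Semiring A] [Bialgebra R A] [Semiring B]
  [Bialgebra R B] [Semiring E] [Bialgebra R E]

/-- The linear map `a ⊗ b ↦ i a * j b`. -/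
noncomputable def mulMap (i : A →ₐc[R] E) (j : B →ₐc[R] E) : A ⊗[R] B →ₗ[R] E :=
  LinearMap.mul' R E ∘ₗ TensorProduct.map (i : A →ₗ[R] E) (j : B →ₗ[R] E)

@[simp]
theorem mulMap_tmul (i : A →ₐc[R] E) (j : B →ₐc[R] E) (a : A) (b : B) :
    mulMap i j (a ⊗ₜ[R] b) = i a * j b := by
  simp [mulMap]

theorem mulMap_one (i : A →ₐc[R] E) (j : B →ₐc[R] E) : mulMap i j 1 = 1 := by
  simp [Algebra.TensorProduct.one_def]

theorem comul_mulMap (i : A →ₐc[R] E) (j : B →ₐc[R] E) (z : A ⊗[R] B) :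
    Coalgebra.comul (R := R) (mulMap i j z) =
      TensorProduct.map (mulMap i j) (mulMap i j) (Coalgebra.comul (R := R) z) := by
  have map_mul_map (s : A ⊗[R] A) (t : B ⊗[R] B) :
      TensorProduct.map (i : A →ₗ[R] E) (i : A →ₗ[R] E) s *
          TensorProduct.map (j : B →ₗ[R] E) (j : B →ₗ[R] E) t =
        TensorProduct.map (mulMap i j) (mulMap i j)
          (TensorProduct.AlgebraTensorModule.tensorTensorTensorComm R R R R A A B B
            (s ⊗ₜ[R] t)) := by
    induction s with
    | zero => simp
    | add s s' hs hs' => simp only [map_add, add_mul, TensorProduct.add_tmul, hs, hs']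
    | tmul a a' =>
      induction t with
      | zero => simp
      | add t t' ht ht' => simp only [map_add, mul_add, TensorProduct.tmul_add, ht, ht']
      | tmul b b' => simp
  induction z with
  | zero => simp
  | add y z hy hz => simp only [map_add, hy, hz]
  | tmul a b =>
    rw [mulMap_tmul, Bialgebra.comul_mul, ← CoalgHomClass.map_comp_comul_apply,
      ← CoalgHomClass.map_comp_comul_apply, TensorProduct.comul_tmul]
    exact map_mul_map _ _

theorem counit_mulMap (i : A →ₐc[R] E) (j : B →ₐc[R] E) (z : A ⊗[R] B) :
    Coalgebra.counit (R := R) (mulMap i j z) = Coalgebra.counit (R := R) z := by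
  induction z with
  | zero => simp
  | add y z hy hz => simp only [map_add, hy, hz]
  | tmul a b => simp [mul_comm]

theorem ext_of_mulMap_surjective {M : Type*} [AddCommMonoid M] [Module R M] {i : A →ₐc[R] E}
    {j : B →ₐc[R] E} (hij : Function.Surjective (mulMap i j)) {φ ψ : E →ₗ[R] M}
    (hφψ : ∀ a b, φ (i a * j b) = ψ (i a * j b)) : φ = ψ :=
  (LinearMap.cancel_right hij).mp (TensorProduct.ext' fun a b => by simpa using hφψ a b)

variable {i : A →ₐc[R] E} {j : B →ₐc[R] E} (hij : Function.Bijective (mulMap i j))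

/-- A bijective product map, as an isomorphism of coalgebras. -/
noncomputable def mulEquiv : A ⊗[R] B ≃ₗc[R] E :=
  CoalgEquiv.ofBijective (f := ({ mulMap i j with
    counit_comp := LinearMap.ext fun z => counit_mulMap i j z
    map_comp_comul := LinearMap.ext fun z => (comul_mulMap i j z).symm } : A ⊗[R] B →ₗc[R] E)) hij

theorem mulEquiv_tmul (a : A) (b : B) : mulEquiv hij (a ⊗ₜ b) = i a * j b := mulMap_tmul i j a b

theorem mulEquiv_one : mulEquiv hij 1 = 1 := mulMap_one i j

/-- The functional `i a * j b ↦ f a * f' b` on a product of two bialgebras. -/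
noncomputable def productFunctional (f : Module.Dual R A) (f' : Module.Dual R B) :
    Module.Dual R E :=
  tensorFunctional f f' ∘ₗ (mulEquiv hij).symm.toLinearMap

theorem productFunctional_mulEquiv (f : Module.Dual R A) (f' : Module.Dual R B) (z : A ⊗[R] B) :
    productFunctional hij f f' (mulEquiv hij z) = tensorFunctional f f' z :=
  congrArg (tensorFunctional f f') ((mulEquiv hij).symm_apply_apply z)

theorem productFunctional_mul (f : Module.Dual R A) (f' : Module.Dual R B) (a : A) (b : B) :
    productFunctional hij f f' (i a * j b) = f a * f' b := by
  rw [← mulEquiv_tmul hij, productFunctional_mulEquiv, tensorFunctional_tmul]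

theorem productFunctional_left (f : Module.Dual R A) (f' : Module.Dual R B) (a : A) :
    productFunctional hij f f' (i a) = f a * f' 1 := by
  simpa using productFunctional_mul hij f f' a 1

theorem productFunctional_right (f : Module.Dual R A) (f' : Module.Dual R B) (b : B) :
    productFunctional hij f f' (j b) = f 1 * f' b := by
  simpa using productFunctional_mul hij f f' 1 b

theorem productFunctional_one (f : Module.Dual R A) (f' : Module.Dual R B) :
    productFunctional hij f f' 1 = f 1 * f' 1 := by
  simpa using productFunctional_left hij f f' 1

theorem rightAct_mulEquiv (f : Module.Dual R A) (f' : Module.Dual R B) (z : A ⊗[R] B) :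
    rightAct (productFunctional hij f f') (mulEquiv hij z) =
      mulEquiv hij (rightAct (tensorFunctional f f') z) := by
  rw [rightAct_apply, ← CoalgHomClass.map_comp_comul_apply, rightAct_apply]
  induction Coalgebra.comul (R := R) z with
  | zero => simp
  | add s t hs ht => simp only [map_add, hs, ht]
  | tmul y z => simpa using congrArg (· • mulEquiv hij y) (productFunctional_mulEquiv hij f f' z)

theorem productFunctional_rightAct_comm (f : Module.Dual R A) (f' : Module.Dual R B) (w : E) :
    productFunctional hij f Coalgebra.counit
        (rightAct (productFunctional hij Coalgebra.counit f') w) =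
      productFunctional hij Coalgebra.counit f'
        (rightAct (productFunctional hij f Coalgebra.counit) w) := by
  obtain ⟨z, rfl⟩ := EquivLike.surjective (mulEquiv hij) w
  simp only [rightAct_mulEquiv, productFunctional_mulEquiv]
  exact tensorFunctional_rightAct_comm f f' z

end MulMap

section Antipode

variable {R A B E : Type*} [CommSemiring R] [Semiring A] [HopfAlgebra R A] [Semiring B]
  [HopfAlgebra R B] [Semiring E] [Bialgebra R E] {i : A →ₐc[R] E} {j : B →ₐc[R] E}
  (hij : Function.Bijective (mulMap i j))

/-- The map `i a * j b ↦ j (S b) * i (S a)`, the antipode of a product of two Hopf algebras. -/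
noncomputable def productAntipode : E →ₗ[R] E :=
  mulMap j i ∘ₗ TensorProduct.map (HopfAlgebra.antipode R) (HopfAlgebra.antipode R) ∘ₗ
    (TensorProduct.comm R A B).toLinearMap ∘ₗ (mulEquiv hij).symm.toLinearMap

theorem productAntipode_mul (a : A) (b : B) : productAntipode hij (i a * j b) =
    j (HopfAlgebra.antipode R b) * i (HopfAlgebra.antipode R a) := by
  have symm_mul : (mulEquiv hij).symm (i a * j b) = a ⊗ₜ[R] b := by
    rw [← mulEquiv_tmul hij]
    exact (mulEquiv hij).symm_apply_apply _
  simp [productAntipode, symm_mul]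

theorem mul_productAntipode_rTensor_comul (a : A) (b : B) :
    LinearMap.mul' R E ((productAntipode hij).rTensor E (Coalgebra.comul (i a * j b))) =
      algebraMap R E (Coalgebra.counit (R := R) (i a * j b)) := by
  have of_tmul (s : A ⊗[R] A) (b₁ b₂ : B) :
      LinearMap.mul' R E ((productAntipode hij).rTensor E
          (TensorProduct.map (i : A →ₗ[R] E) (i : A →ₗ[R] E) s * (j b₁ ⊗ₜ[R] j b₂))) =
        j (HopfAlgebra.antipode R b₁) *
          i (LinearMap.mul' R A ((HopfAlgebra.antipode R).rTensor A s)) * j b₂ := by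
    induction s with
    | zero => simp
    | tmul a₁ a₂ => simp [productAntipode_mul, mul_assoc]
    | add s s' hs hs' => simp only [map_add, add_mul, mul_add, hs, hs']
  have of_comul (t : B ⊗[R] B) :
      LinearMap.mul' R E ((productAntipode hij).rTensor E
          (TensorProduct.map (i : A →ₗ[R] E) (i : A →ₗ[R] E) (Coalgebra.comul a) *
            TensorProduct.map (j : B →ₗ[R] E) (j : B →ₗ[R] E) t)) =
        Coalgebra.counit (R := R) a •
          j (LinearMap.mul' R B ((HopfAlgebra.antipode R).rTensor B t)) := by
    induction t with
    | zero => simp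
    | tmul b₁ b₂ =>
      rw [TensorProduct.map_tmul]
      refine (of_tmul _ _ _).trans ?_
      rw [HopfAlgebra.mul_antipode_rTensor_comul_apply, AlgHomClass.commutes,
        ← Algebra.commutes, mul_assoc, ← Algebra.smul_def]
      simp
    | add t t' ht ht' => simp only [map_add, mul_add, smul_add, ht, ht']
  rw [Bialgebra.comul_mul, ← CoalgHomClass.map_comp_comul_apply,
    ← CoalgHomClass.map_comp_comul_apply]
  refine (of_comul _).trans ?_
  rw [HopfAlgebra.mul_antipode_rTensor_comul_apply, AlgHomClass.commutes, Bialgebra.counit_mul,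
    map_mul, Algebra.smul_def]
  simp

theorem mul_productAntipode_lTensor_comul (a : A) (b : B) :
    LinearMap.mul' R E ((productAntipode hij).lTensor E (Coalgebra.comul (i a * j b))) =
      algebraMap R E (Coalgebra.counit (R := R) (i a * j b)) := by
  have of_tmul (t : B ⊗[R] B) (a₁ a₂ : A) :
      LinearMap.mul' R E ((productAntipode hij).lTensor E
          ((i a₁ ⊗ₜ[R] i a₂) * TensorProduct.map (j : B →ₗ[R] E) (j : B →ₗ[R] E) t)) =
        i a₁ * j (LinearMap.mul' R B ((HopfAlgebra.antipode R).lTensor B t)) *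
          i (HopfAlgebra.antipode R a₂) := by
    induction t with
    | zero => simp
    | tmul b₁ b₂ => simp [productAntipode_mul, mul_assoc]
    | add t t' ht ht' => simp only [map_add, add_mul, mul_add, ht, ht']
  have of_comul (s : A ⊗[R] A) :
      LinearMap.mul' R E ((productAntipode hij).lTensor E
          (TensorProduct.map (i : A →ₗ[R] E) (i : A →ₗ[R] E) s *
            TensorProduct.map (j : B →ₗ[R] E) (j : B →ₗ[R] E) (Coalgebra.comul b))) =
        Coalgebra.counit (R := R) b •
          i (LinearMap.mul' R A ((HopfAlgebra.antipode R).lTensor A s)) := by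
    induction s with
    | zero => simp
    | tmul a₁ a₂ =>
      rw [TensorProduct.map_tmul]
      refine (of_tmul _ _ _).trans ?_
      rw [HopfAlgebra.mul_antipode_lTensor_comul_apply, AlgHomClass.commutes,
        ← Algebra.commutes, mul_assoc, ← Algebra.smul_def]
      simp
    | add s s' hs hs' => simp only [map_add, add_mul, smul_add, hs, hs']
  rw [Bialgebra.comul_mul, ← CoalgHomClass.map_comp_comul_apply,
    ← CoalgHomClass.map_comp_comul_apply]
  refine (of_comul _).trans ?_
  rw [HopfAlgebra.mul_antipode_lTensor_comul_apply, AlgHomClass.commutes, Bialgebra.counit_mul,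
    mul_comm, map_mul, Algebra.smul_def]
  simp

/-- A bialgebra that factors through two Hopf algebras is a Hopf algebra. -/
noncomputable abbrev productHopfAlgebra : HopfAlgebra R E where
  antipode := productAntipode hij
  mul_antipode_rTensor_comul := ext_of_mulMap_surjective hij.surjective fun a b => by
    simpa using mul_productAntipode_rTensor_comul hij a b
  mul_antipode_lTensor_comul := ext_of_mulMap_surjective hij.surjective fun a b => by
    simpa using mul_productAntipode_lTensor_comul hij a b

end Antipode

section QCommutation

section Ring

variable {R E : Type*} [CommRing R] [Ring E] [Algebra R E]

theorem pow_mul_of_qComm {r : R} {a b : E} (hab : b * a = r • (a * b)) (i : ℕ) :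
    b ^ i * a = r ^ i • (a * b ^ i) := by
  induction i with
  | zero => simp
  | succ i ih =>
    rw [pow_succ', mul_assoc, ih, mul_smul_comm, ← mul_assoc, hab, smul_mul_assoc, smul_smul,
      mul_assoc, ← pow_succ', ← pow_succ]

/-- The `r`-commutator `[a, b]_r`. -/
def qCommutator (r : R) (a b : E) : E := a * b - r • (b * a)

theorem qCommutator_mul {r s t : R} {a b c : E} (hac : a * c = s • (c * a))
    (hbc : b * c = t • (c * b)) :
    qCommutator r a b * c = (s * t) • (c * qCommutator r a b) := by
  have mul_mul_comm {a b : E} {s t : R} (hac : a * c = s • (c * a)) (hbc : b * c = t • (c * b)) :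
      a * b * c = (s * t) • (c * (a * b)) := by
    rw [mul_assoc, hbc, mul_smul_comm, ← mul_assoc, hac, smul_mul_assoc, smul_smul, mul_comm t,
      mul_assoc]
  rw [qCommutator, sub_mul, smul_mul_assoc, mul_mul_comm hac hbc, mul_mul_comm hbc hac, mul_sub,
    smul_sub, mul_smul_comm, smul_comm r, mul_comm t]

theorem eq_smul_one_sub_of_conj_eq {u : Eˣ} {g z : E} {c : R}
    (hc : u * z * (u⁻¹ : Eˣ) = c • (1 - u * g * (u⁻¹ : Eˣ))) : z = c • (1 - g) := by
  have one_sub_conj : 1 - u * g * (u⁻¹ : Eˣ) = u * (1 - g) * (u⁻¹ : Eˣ) := by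
    rw [mul_sub, sub_mul, mul_one, Units.mul_inv]
  rwa [one_sub_conj, ← smul_mul_assoc, ← mul_smul_comm, Units.mul_left_inj,
    Units.mul_right_inj] at hc

end Ring

section Field

variable {k E : Type*} [Field k] [Ring E] [Algebra k E]

theorem pow_eq_one_of_qComm {c : k} {u z : E} {i : ℕ} (huz : u * z = c • (z * u))
    (hu : u ^ i = 1) (hz : z ≠ 0) : c ^ i = 1 := by
  have hzc := pow_mul_of_qComm huz i
  rw [hu, one_mul, mul_one] at hzc
  exact smul_left_injective k hz (hzc.symm.trans (one_smul k z).symm)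

theorem qComm_of_conj_eq {u : Eˣ} {g z : E} {p c c' : k} (hzg : z * g = p • (g * z))
    (hug : Commute (u : E) g) (huz : u * z * (u⁻¹ : Eˣ) = c • z + c' • (1 - g))
    (hg : IsUnit g) (hg1 : g ≠ 1) (hp : p ≠ 1) : u * z = c • (z * u) := by
  have conj_mul_g : u * z * (u⁻¹ : Eˣ) * g = p • (g * (u * z * (u⁻¹ : Eˣ))) := by
    rw [mul_assoc, (hug.units_inv_left).eq, ← mul_assoc, mul_assoc (u : E), hzg, mul_smul_comm,
      ← mul_assoc, hug.eq, smul_mul_assoc, mul_assoc, mul_assoc, mul_assoc]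
  have coeff_smul : (c' * (1 - p)) • (g * (1 - g)) = 0 := by
    rw [huz, add_mul, mul_add, smul_mul_assoc, smul_mul_assoc, hzg, mul_smul_comm, mul_smul_comm,
      ((Commute.one_left g).sub_left (Commute.refl g)).eq] at conj_mul_g
    linear_combination (norm := module) conj_mul_g
  have hc' : c' = 0 := by
    have hg1' : g * (1 - g) ≠ 0 := hg.mul_right_eq_zero.not.mpr (sub_ne_zero.mpr hg1.symm)
    exact (mul_eq_zero.mp ((smul_eq_zero.mp coeff_smul).resolve_right hg1')).resolve_right
      (sub_ne_zero.mpr hp.symm)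
  rw [hc', zero_smul, add_zero] at huz
  rw [← smul_mul_assoc, ← huz, Units.inv_mul_cancel_right]

theorem eq_one_of_mul_eq_smul_mul {g w c : E} {l r : k} (hl : l ≠ 0) (hw : w = l • (1 - g))
    (hwc : w * c = r • (c * w)) (hgc : Commute g c) (hc : IsUnit c) (hg : g ≠ 1) : r = 1 := by
  have hsub : c * (1 - g) ≠ 0 := hc.mul_right_eq_zero.not.mpr (sub_ne_zero.mpr hg.symm)
  rw [hw, smul_mul_assoc, mul_smul_comm, ((Commute.one_left c).sub_left hgc).eq, smul_comm] at hwc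
  exact smul_left_injective k hsub
    ((smul_right_injective E hl hwc).symm.trans (one_smul k _).symm)

end Field

section Bialgebra

variable {R E : Type*} [CommRing R] [Ring E] [Bialgebra R E]

theorem comul_conj {u v g z : E} (hu : IsGroupLikeElem R u) (hv : IsGroupLikeElem R v)
    (huv : u * v = 1) (hz : Coalgebra.comul (R := R) z = z ⊗ₜ[R] g + 1 ⊗ₜ[R] z) :
    Coalgebra.comul (R := R) (u * z * v) =
      (u * z * v) ⊗ₜ[R] (u * g * v) + 1 ⊗ₜ[R] (u * z * v) := by
  rw [Bialgebra.comul_mul, Bialgebra.comul_mul, hu.comul_eq_tmul_self, hv.comul_eq_tmul_self, hz,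
    mul_add, add_mul]
  simp [huv]

theorem comul_qCommutator {α β : R} {g z g' z' : E}
    (hz : Coalgebra.comul (R := R) z = z ⊗ₜ[R] g + 1 ⊗ₜ[R] z)
    (hz' : Coalgebra.comul (R := R) z' = z' ⊗ₜ[R] g' + 1 ⊗ₜ[R] z')
    (hg'g : g' * g = g * g') (hg'z : g' * z = α • (z * g')) (hz'g : z' * g = β • (g * z')) :
    Coalgebra.comul (R := R) (qCommutator α z' z) =
      qCommutator α z' z ⊗ₜ[R] (g * g') + 1 ⊗ₜ[R] qCommutator α z' z +
        (β - α) • (z ⊗ₜ[R] (g * z')) := by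
  rw [qCommutator, map_sub, map_smul, Bialgebra.comul_mul, Bialgebra.comul_mul, hz, hz']
  simp only [add_mul, mul_add, Algebra.TensorProduct.tmul_mul_tmul, one_mul, mul_one, hg'g, hg'z,
    hz'g, TensorProduct.tmul_smul, TensorProduct.sub_tmul, TensorProduct.tmul_sub,
    ← TensorProduct.smul_tmul']
  module

end Bialgebra

end QCommutation

namespace TaftAlgebra

section MixedRelations

variable {k E : Type*} [Field k] [Ring E] [Algebra k E] {p q : k} {n m : ℕ}

/-- The relations `h H = H h`, `h X = α X h`, `x H = α H x`, `x X = α X x + l (1 - H h)` between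
the generators `H`, `X` and `h`, `x` of two Taft algebras mapped to a common algebra. -/
structure MixedRelations (α l : k) (f : TaftAlgebra p n →ₐ[k] E) (g : TaftAlgebra q m →ₐ[k] E) :
    Prop where
  h_mul_h : g (h q m) * f (h p n) = f (h p n) * g (h q m)
  h_mul_x : g (h q m) * f (x p n) = α • (f (x p n) * g (h q m))
  x_mul_h : g (x q m) * f (h p n) = α • (f (h p n) * g (x q m))
  x_mul_x : g (x q m) * f (x p n) =
    α • (f (x p n) * g (x q m)) + l • (1 - f (h p n) * g (h q m))

theorem MixedRelations.map {F : Type*} [Ring F] [Algebra k F] {α l : k}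
    {f : TaftAlgebra p n →ₐ[k] E} {g : TaftAlgebra q m →ₐ[k] E} (hfg : MixedRelations α l f g)
    (φ : E →ₐ[k] F) : MixedRelations α l (φ.comp f) (φ.comp g) where
  h_mul_h := by simpa using congrArg φ hfg.h_mul_h
  h_mul_x := by simpa using congrArg φ hfg.h_mul_x
  x_mul_h := by simpa using congrArg φ hfg.x_mul_h
  x_mul_x := by simpa using congrArg φ hfg.x_mul_x

/-- The parameters `α`, `l` of the mixed relations for which the Hopf algebra presented by them
factors through the two Taft algebras. -/
structure Admissible (p q α l : k) (n m : ℕ) : Prop where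
  pow_left : α ^ n = 1
  pow_right : α ^ m = 1
  eq_right : l ≠ 0 → α = q
  mul_left_eq_one : l ≠ 0 → α * p = 1

end MixedRelations

section Factorization

variable {k E : Type*} [Field k] [Ring E] [Bialgebra k E] {p q : k} {n m : ℕ}
  [n.AtLeastTwo] [m.AtLeastTwo] [hp : Fact (IsPrimitiveRoot p n)] [hq : Fact (IsPrimitiveRoot q m)]

theorem isGroupLikeElem_map_h (i : TaftAlgebra p n →ₐc[k] E) : IsGroupLikeElem k (i (h p n)) :=
  isGroupLikeElem_h.map i

theorem comul_map_x (i : TaftAlgebra p n →ₐc[k] E) : Coalgebra.comul (R := k) (i (x p n)) =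
    i (x p n) ⊗ₜ[k] i (h p n) + 1 ⊗ₜ[k] i (x p n) := by
  rw [← CoalgHomClass.map_comp_comul_apply, comul_x]
  simp

theorem isUnit_map_h (i : TaftAlgebra p n →ₐc[k] E) : IsUnit (i (h p n)) := isUnit_h.map i

theorem map_h_pow (i : TaftAlgebra p n →ₐc[k] E) : i (h p n) ^ n = 1 := by
  rw [← map_pow, h_pow, map_one]

theorem map_x_mul_map_h (i : TaftAlgebra p n →ₐc[k] E) :
    i (x p n) * i (h p n) = p • (i (h p n) * i (x p n)) := by
  rw [← map_mul, x_mul_h, map_smul, map_mul]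

variable (p n) in
include hp in
theorem parameter_ne_one : p ≠ 1 := hp.out.ne_one Nat.AtLeastTwo.one_lt

variable {i : TaftAlgebra p n →ₐc[k] E} {j : TaftAlgebra q m →ₐc[k] E}
  (hij : Function.Bijective (mulMap i j))

include hij

theorem skewPrimitive_of_mulMap_bijective {g z : E} (hg : IsGroupLikeElem k g)
    (hz : Coalgebra.comul (R := k) z = z ⊗ₜ[k] g + 1 ⊗ₜ[k] z) :
    (∃ c : k, z = c • (1 - g)) ∨
    (g = i (h p n) ∧ ∃ c c' : k, z = c • i (x p n) + c' • (1 - g)) ∨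
    (g = j (h q m) ∧ ∃ c c' : k, z = c • j (x q m) + c' • (1 - g)) := by
  obtain ⟨g, rfl⟩ := EquivLike.surjective (mulEquiv hij) g
  obtain ⟨z, rfl⟩ := EquivLike.surjective (mulEquiv hij) z
  rw [isGroupLikeElem_map_equiv] at hg
  have comul_z : Coalgebra.comul (R := k) z = z ⊗ₜ[k] g + 1 ⊗ₜ[k] z := by
    have comul_symm := CoalgHomClass.map_comp_comul_apply (mulEquiv hij).symm (mulEquiv hij z)
    rw [hz, ← mulEquiv_one hij] at comul_symm
    simpa using comul_symm.symm
  have map_combination (c c' : k) (y : TaftAlgebra p n ⊗[k] TaftAlgebra q m) :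
      mulEquiv hij (c • y + c' • (1 - g)) =
        c • mulEquiv hij y + c' • (1 - mulEquiv hij g) := by
    rw [map_add, map_smul, map_smul, map_sub, mulEquiv_one]
  rcases skewPrimitive_tensor hg comul_z with ⟨c, hc⟩ | ⟨hg, c, c', hc⟩ | ⟨hg, c, c', hc⟩
  · exact .inl ⟨c, by rw [hc, map_smul, map_sub, mulEquiv_one]⟩
  · refine .inr (.inl ⟨by simp [hg, mulEquiv_tmul], c, c', ?_⟩)
    rw [hc, map_combination, mulEquiv_tmul, map_one, mul_one]
  · refine .inr (.inr ⟨by simp [hg, mulEquiv_tmul], c, c', ?_⟩)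
    rw [hc, map_combination, mulEquiv_tmul, map_one, one_mul]

theorem map_h_left_ne_one : i (h p n) ≠ 1 := fun h0 =>
  parameter_ne_one p n <| by
    have := congrArg (productFunctional hij (character p (q_pow_eq_one p n)).toLinearMap
      Coalgebra.counit) h0
    simpa [productFunctional_left, productFunctional_one, character_h] using this

theorem map_h_right_ne_one : j (h q m) ≠ 1 := fun h0 =>
  parameter_ne_one q m <| by
    have := congrArg (productFunctional hij Coalgebra.counit
      (character q (q_pow_eq_one q m)).toLinearMap) h0
    simpa [productFunctional_right, productFunctional_one, character_h] using this

theorem map_h_left_ne_map_h_right : i (h p n) ≠ j (h q m) := fun h0 =>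
  parameter_ne_one p n <| by
    have := congrArg (productFunctional hij (character p (q_pow_eq_one p n)).toLinearMap
      Coalgebra.counit) h0
    simpa [productFunctional_left, productFunctional_right, character_h, counit_h] using this

theorem map_h_mul_map_h_ne_one : i (h p n) * j (h q m) ≠ 1 := fun h0 =>
  parameter_ne_one p n <| by
    have := congrArg (productFunctional hij (character p (q_pow_eq_one p n)).toLinearMap
      Coalgebra.counit) h0
    simpa [productFunctional_mul, productFunctional_one, character_h, counit_h] using this

theorem map_x_left_ne (c : k) : i (x p n) ≠ c • (1 - i (h p n)) := fun h0 => by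
  have := congrArg (productFunctional hij skewDer Coalgebra.counit) h0
  simp [productFunctional_left, productFunctional_one, skewDer_one, skewDer_h, skewDer_x] at this

theorem map_x_right_ne (c : k) : j (x q m) ≠ c • (1 - j (h q m)) := fun h0 => by
  have := congrArg (productFunctional hij Coalgebra.counit skewDer) h0
  simp [productFunctional_right, productFunctional_one, skewDer_one, skewDer_h, skewDer_x] at this

theorem map_x_left_ne_zero : i (x p n) ≠ 0 := by simpa using map_x_left_ne hij 0

theorem map_x_right_ne_zero : j (x q m) ≠ 0 := by simpa using map_x_right_ne hij 0

theorem exists_qComm_h_x : Commute (j (h q m)) (i (h p n)) ∧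
    ∃ α : k, α ^ m = 1 ∧ j (h q m) * i (x p n) = α • (i (x p n) * j (h q m)) := by
  obtain ⟨u, hu⟩ := isUnit_map_h j
  have hu_gl : IsGroupLikeElem k (u : E) := hu ▸ isGroupLikeElem_map_h j
  have hu_inv_gl := hu_gl.of_mul_eq_one u.mul_inv u.inv_mul
  rcases skewPrimitive_of_mulMap_bijective hij
    ((hu_gl.mul (isGroupLikeElem_map_h i)).mul hu_inv_gl)
    (comul_conj hu_gl hu_inv_gl u.mul_inv (comul_map_x i)) with
    ⟨c, hc⟩ | ⟨hg, c, c', hc⟩ | ⟨hg, -⟩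
  · exact absurd (eq_smul_one_sub_of_conj_eq hc) (map_x_left_ne hij c)
  · rw [hg] at hc
    have hcomm : Commute (u : E) (i (h p n)) := (Units.mul_inv_eq_iff_eq_mul u).mp hg
    have hqcomm := qComm_of_conj_eq (map_x_mul_map_h i) hcomm hc (isUnit_map_h i)
      (map_h_left_ne_one hij) (parameter_ne_one p n)
    rw [hu] at hcomm hqcomm
    exact ⟨hcomm, c, pow_eq_one_of_qComm hqcomm (map_h_pow j) (map_x_left_ne_zero hij), hqcomm⟩
  · rw [← hu, Units.mul_inv_eq_iff_eq_mul, Units.mul_right_inj, hu] at hg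
    exact absurd hg (map_h_left_ne_map_h_right hij)

theorem exists_qComm_x_h :
    ∃ β : k, β ^ n = 1 ∧ j (x q m) * i (h p n) = β • (i (h p n) * j (x q m)) := by
  obtain ⟨u, hu⟩ := isUnit_map_h i
  have hu_gl : IsGroupLikeElem k (u : E) := hu ▸ isGroupLikeElem_map_h i
  have hu_inv_gl := hu_gl.of_mul_eq_one u.mul_inv u.inv_mul
  have hcomm : Commute ((u⁻¹ : Eˣ) : E) (j (h q m)) :=
    (hu ▸ (exists_qComm_h_x hij).1.symm : Commute (u : E) (j (h q m))).units_inv_left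
  have hconj : ↑u⁻¹ * j (h q m) * ↑(u⁻¹)⁻¹ = j (h q m) :=
    (Units.mul_inv_eq_iff_eq_mul u⁻¹).mpr hcomm
  have hz := comul_conj hu_inv_gl (inv_inv u ▸ hu_gl) (u⁻¹).mul_inv (comul_map_x j)
  rw [hconj] at hz
  rcases skewPrimitive_of_mulMap_bijective hij (isGroupLikeElem_map_h j) hz with
    ⟨c, hc⟩ | ⟨hg, -⟩ | ⟨-, c, c', hc⟩
  · rw [← hconj] at hc
    exact absurd (eq_smul_one_sub_of_conj_eq hc) (map_x_right_ne hij c)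
  · exact absurd hg.symm (map_h_left_ne_map_h_right hij)
  · have hqcomm := qComm_of_conj_eq (map_x_mul_map_h j) hcomm hc (isUnit_map_h j)
      (map_h_right_ne_one hij) (parameter_ne_one q m)
    have hu_inv_pow : ((u⁻¹ : Eˣ) : E) ^ n = 1 := by
      rw [← Units.val_pow_eq_pow_val, inv_pow, Units.val_eq_one, inv_eq_one, ← Units.val_eq_one,
        Units.val_pow_eq_pow_val, hu, map_h_pow]
    refine ⟨c, pow_eq_one_of_qComm hqcomm hu_inv_pow (map_x_right_ne_zero hij), ?_⟩
    rw [← hu]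
    calc j (x q m) * u = u * (↑u⁻¹ * j (x q m)) * u := by rw [Units.mul_inv_cancel_left]
      _ = c • (u * j (x q m)) := by
        rw [hqcomm, mul_smul_comm, smul_mul_assoc, mul_assoc, Units.inv_mul_cancel_right]

/-- Both mixed weights are read off from `Δ (x X - α X x)`, which contains `X ⊗ H x` with
coefficient `β - α`; the functionals dual to `X` and `x` detect this coefficient. -/
theorem weight_eq_of_qComm {α β : k} (hcomm : Commute (j (h q m)) (i (h p n)))
    (hα : j (h q m) * i (x p n) = α • (i (x p n) * j (h q m)))
    (hβ : j (x q m) * i (h p n) = β • (i (h p n) * j (x q m))) : β = α := by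
  set w := qCommutator α (j (x q m)) (i (x p n))
  have rightAct_w (f : Module.Dual k E) : rightAct f w = f (i (h p n) * j (h q m)) • w +
      f w • 1 + ((β - α) * f (i (h p n) * j (x q m))) • i (x p n) := by
    simp [rightAct_apply, w, comul_qCommutator (comul_map_x i) (comul_map_x j) hcomm.eq hα hβ,
      smul_smul]
  have hw := productFunctional_rightAct_comm hij skewDer skewDer w
  rw [rightAct_w, rightAct_w] at hw
  simp only [map_add, map_smul, smul_eq_mul, productFunctional_mul, productFunctional_left,
    productFunctional_one, skewDer_h, skewDer_one, skewDer_x, counit_h, counit_x,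
    Bialgebra.counit_one] at hw
  linear_combination hw

theorem exists_qCommutator_eq {α : k} (hcomm : Commute (j (h q m)) (i (h p n)))
    (hhx : j (h q m) * i (x p n) = α • (i (x p n) * j (h q m)))
    (hxh : j (x q m) * i (h p n) = α • (i (h p n) * j (x q m))) :
    ∃ l : k, qCommutator α (j (x q m)) (i (x p n)) = l • (1 - i (h p n) * j (h q m)) := by
  have comul_w := comul_qCommutator (comul_map_x i) (comul_map_x j) hcomm.eq hhx hxh
  rw [sub_self, zero_smul, add_zero] at comul_w
  rcases skewPrimitive_of_mulMap_bijective hij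
    ((isGroupLikeElem_map_h i).mul (isGroupLikeElem_map_h j)) comul_w with
    hl | ⟨hg, -⟩ | ⟨hg, -⟩
  · exact hl
  · exact absurd ((isUnit_map_h i).mul_eq_left.mp hg) (map_h_right_ne_one hij)
  · exact absurd ((isUnit_map_h j).mul_eq_right.mp hg) (map_h_left_ne_one hij)

theorem exists_mixedRelations : ∃ α l : k, Admissible p q α l n m ∧
    MixedRelations α l (i : TaftAlgebra p n →ₐ[k] E) (j : TaftAlgebra q m →ₐ[k] E) := by
  obtain ⟨hcomm, α, hαm, hhx⟩ := exists_qComm_h_x hij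
  obtain ⟨β, hαn, hxh⟩ := exists_qComm_x_h hij
  obtain rfl := weight_eq_of_qComm hij hcomm hhx hxh
  obtain ⟨l, hl⟩ := exists_qCommutator_eq hij hcomm hhx hxh
  have hβ0 : β ≠ 0 := by
    rintro rfl
    exact zero_ne_one ((zero_pow (NeZero.ne m)).symm.trans hαm)
  have hxh' : i (x p n) * j (h q m) = β⁻¹ • (j (h q m) * i (x p n)) := by
    rw [hhx, inv_smul_smul₀ hβ0]
  refine ⟨β, l, ⟨hαn, hαm, fun hl0 => ?_, fun hl0 => ?_⟩,
    ⟨hcomm.eq, hhx, hxh, sub_eq_iff_eq_add'.mp hl⟩⟩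
  · have := eq_one_of_mul_eq_smul_mul hl0 hl (qCommutator_mul (map_x_mul_map_h j) hxh')
      (hcomm.symm.mul_left (Commute.refl _)) (isUnit_map_h j) (map_h_mul_map_h_ne_one hij)
    exact (eq_of_mul_inv_eq_one this).symm
  · exact eq_one_of_mul_eq_smul_mul hl0 hl (qCommutator_mul hxh (map_x_mul_map_h i))
      ((Commute.refl _).mul_left hcomm) (isUnit_map_h i) (map_h_mul_map_h_ne_one hij)

end Factorization

end TaftAlgebra

/-- The generators of the two Taft algebras, those of the left one being `H` and `X`. -/
inductive BicrossedGen : Type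
  | H
  | X
  | h
  | x

section BicrossedRel

variable {k : Type u} [Field k]

open BicrossedGen FreeAlgebra in
/-- The relations of two Taft algebras together with the mixed relations
`TaftAlgebra.MixedRelations`. -/
inductive BicrossedRel (p q α l : k) (n m : ℕ) :
    FreeAlgebra k BicrossedGen → FreeAlgebra k BicrossedGen → Prop
  | H_pow : BicrossedRel p q α l n m (ι k H ^ n) 1
  | X_pow : BicrossedRel p q α l n m (ι k X ^ n) 0
  | X_mul_H : BicrossedRel p q α l n m (ι k X * ι k H) (p • (ι k H * ι k X))
  | h_pow : BicrossedRel p q α l n m (ι k h ^ m) 1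
  | x_pow : BicrossedRel p q α l n m (ι k x ^ m) 0
  | x_mul_h : BicrossedRel p q α l n m (ι k x * ι k h) (q • (ι k h * ι k x))
  | h_mul_H : BicrossedRel p q α l n m (ι k h * ι k H) (ι k H * ι k h)
  | h_mul_X : BicrossedRel p q α l n m (ι k h * ι k X) (α • (ι k X * ι k h))
  | x_mul_H : BicrossedRel p q α l n m (ι k x * ι k H) (α • (ι k H * ι k x))
  | x_mul_X : BicrossedRel p q α l n m (ι k x * ι k X)
      (α • (ι k X * ι k x) + l • (1 - ι k H * ι k h))

/-- The algebra generated by two Taft algebras subject to the mixed relations. -/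
def TaftBicrossed (p q α l : k) (n m : ℕ) : Type u := RingQuot (BicrossedRel p q α l n m)

end BicrossedRel

namespace TaftBicrossed

open TaftAlgebra

section Algebra

variable {k : Type u} [Field k] (p q α l : k) (n m : ℕ)

noncomputable instance instRing : Ring (TaftBicrossed p q α l n m) :=
  inferInstanceAs (Ring (RingQuot (BicrossedRel p q α l n m)))

noncomputable instance instAlgebra : Algebra k (TaftBicrossed p q α l n m) :=
  inferInstanceAs (Algebra k (RingQuot (BicrossedRel p q α l n m)))

/-- The quotient map from the free algebra. -/
noncomputable def mk : FreeAlgebra k BicrossedGen →ₐ[k] TaftBicrossed p q α l n m :=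
  RingQuot.mkAlgHom k (BicrossedRel p q α l n m)

variable {p q α l n m} in
theorem mk_rel {a b : FreeAlgebra k BicrossedGen} (hab : BicrossedRel p q α l n m a b) :
    mk p q α l n m a = mk p q α l n m b := RingQuot.mkAlgHom_rel k hab

/-- The homomorphism from the left Taft algebra. -/
noncomputable def inl : TaftAlgebra p n →ₐ[k] TaftBicrossed p q α l n m :=
  TaftAlgebra.lift (mk p q α l n m (FreeAlgebra.ι k .H)) (mk p q α l n m (FreeAlgebra.ι k .X))
    (by simpa using mk_rel .H_pow) (by simpa using mk_rel .X_pow) (by simpa using mk_rel .X_mul_H)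

/-- The homomorphism from the right Taft algebra. -/
noncomputable def inr : TaftAlgebra q m →ₐ[k] TaftBicrossed p q α l n m :=
  TaftAlgebra.lift (mk p q α l n m (FreeAlgebra.ι k .h)) (mk p q α l n m (FreeAlgebra.ι k .x))
    (by simpa using mk_rel .h_pow) (by simpa using mk_rel .x_pow) (by simpa using mk_rel .x_mul_h)

theorem inl_h : inl p q α l n m (h p n) = mk p q α l n m (FreeAlgebra.ι k .H) :=
  TaftAlgebra.lift_h ..

theorem inl_x : inl p q α l n m (x p n) = mk p q α l n m (FreeAlgebra.ι k .X) :=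
  TaftAlgebra.lift_x ..

theorem inr_h : inr p q α l n m (h q m) = mk p q α l n m (FreeAlgebra.ι k .h) :=
  TaftAlgebra.lift_h ..

theorem inr_x : inr p q α l n m (x q m) = mk p q α l n m (FreeAlgebra.ι k .x) :=
  TaftAlgebra.lift_x ..

theorem mixedRelations : MixedRelations α l (inl p q α l n m) (inr p q α l n m) := by
  constructor <;> simp only [inl_h, inl_x, inr_h, inr_x]
  · simpa using mk_rel .h_mul_H
  · simpa using mk_rel .h_mul_X
  · simpa using mk_rel .x_mul_H
  · simpa using mk_rel .x_mul_X

end Algebra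

section UniversalProperty

variable {k : Type u} [Field k] {p q α l : k} {n m : ℕ} {F : Type*} [Ring F] [Algebra k F]

/-- The homomorphism induced by two homomorphisms that satisfy the mixed relations. -/
noncomputable def lift (f : TaftAlgebra p n →ₐ[k] F) (g : TaftAlgebra q m →ₐ[k] F)
    (hfg : MixedRelations α l f g) : TaftBicrossed p q α l n m →ₐ[k] F :=
  RingQuot.liftAlgHom k
    ⟨FreeAlgebra.lift k fun
      | .H => f (h p n)
      | .X => f (x p n)
      | .h => g (h q m)
      | .x => g (x q m), by
      intro a b hab
      cases hab with
      | H_pow => simpa using congrArg f (h_pow p n)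
      | X_pow => simpa using congrArg f (x_pow p n)
      | X_mul_H => simpa using congrArg f (x_mul_h p n)
      | h_pow => simpa using congrArg g (h_pow q m)
      | x_pow => simpa using congrArg g (x_pow q m)
      | x_mul_h => simpa using congrArg g (x_mul_h q m)
      | h_mul_H => simpa using hfg.h_mul_h
      | h_mul_X => simpa using hfg.h_mul_x
      | x_mul_H => simpa using hfg.x_mul_h
      | x_mul_X => simpa using hfg.x_mul_x⟩

variable (f : TaftAlgebra p n →ₐ[k] F) (g : TaftAlgebra q m →ₐ[k] F)
  (hfg : MixedRelations α l f g)

theorem lift_mk_ι (i : BicrossedGen) : lift f g hfg (mk p q α l n m (FreeAlgebra.ι k i)) =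
    match i with
      | .H => f (h p n)
      | .X => f (x p n)
      | .h => g (h q m)
      | .x => g (x q m) :=
  (RingQuot.liftAlgHom_mkAlgHom_apply ..).trans (FreeAlgebra.lift_ι_apply ..)

@[simp]
theorem lift_inl (a : TaftAlgebra p n) : lift f g hfg (inl p q α l n m a) = f a :=
  DFunLike.congr_fun (TaftAlgebra.algHom_ext (f := (lift f g hfg).comp (inl p q α l n m))
    (by simp [inl_h, lift_mk_ι]) (by simp [inl_x, lift_mk_ι])) a

@[simp]
theorem lift_inr (b : TaftAlgebra q m) : lift f g hfg (inr p q α l n m b) = g b :=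
  DFunLike.congr_fun (TaftAlgebra.algHom_ext (f := (lift f g hfg).comp (inr p q α l n m))
    (by simp [inr_h, lift_mk_ι]) (by simp [inr_x, lift_mk_ι])) b

theorem lift_comp_inl : (lift f g hfg).comp (inl p q α l n m) = f := AlgHom.ext (lift_inl f g hfg)

theorem lift_comp_inr : (lift f g hfg).comp (inr p q α l n m) = g := AlgHom.ext (lift_inr f g hfg)

theorem induction {P : TaftBicrossed p q α l n m → Prop}
    (left : ∀ a, P (inl p q α l n m a)) (right : ∀ b, P (inr p q α l n m b))
    (mul : ∀ a b, P a → P b → P (a * b)) (add : ∀ a b, P a → P b → P (a + b))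
    (e : TaftBicrossed p q α l n m) : P e := by
  obtain ⟨a, rfl⟩ : ∃ a, mk p q α l n m a = e := RingQuot.mkAlgHom_surjective k _ e
  induction a using FreeAlgebra.induction with
  | grade0 r => simpa using left (algebraMap k _ r)
  | grade1 i =>
    cases i with
    | H => exact inl_h p q α l n m ▸ left _
    | X => exact inl_x p q α l n m ▸ left _
    | h => exact inr_h p q α l n m ▸ right _
    | x => exact inr_x p q α l n m ▸ right _
  | mul a b ha hb => exact map_mul (mk p q α l n m) a b ▸ mul _ _ ha hb
  | add a b ha hb => exact map_add (mk p q α l n m) a b ▸ add _ _ ha hb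

theorem algHom_ext {φ ψ : TaftBicrossed p q α l n m →ₐ[k] F}
    (hl : φ.comp (inl p q α l n m) = ψ.comp (inl p q α l n m))
    (hr : φ.comp (inr p q α l n m) = ψ.comp (inr p q α l n m)) : φ = ψ := by
  ext e
  induction e using TaftBicrossed.induction with
  | left a => exact DFunLike.congr_fun hl a
  | right b => exact DFunLike.congr_fun hr b
  | mul a b ha hb => rw [map_mul, map_mul, ha, hb]
  | add a b ha hb => rw [map_add, map_add, ha, hb]

end UniversalProperty

end TaftBicrossed

section Bialgebra

variable {k : Type u} [Field k] {p q α l : k} {n m : ℕ} [NeZero n] [NeZero m]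
  [Fact (IsPrimitiveRoot p n)] [Fact (IsPrimitiveRoot q m)]

theorem TaftAlgebra.MixedRelations.map_comp_comul {F : Type*} [Ring F] [Algebra k F]
    {f : TaftAlgebra p n →ₐ[k] F} {g : TaftAlgebra q m →ₐ[k] F} (hfg : MixedRelations α l f g) :
    MixedRelations α l
      ((Algebra.TensorProduct.map f f).comp (Bialgebra.comulAlgHom k (TaftAlgebra p n)))
      ((Algebra.TensorProduct.map g g).comp (Bialgebra.comulAlgHom k (TaftAlgebra q m))) := by
  constructor <;>
    simp only [AlgHom.comp_apply, Bialgebra.comulAlgHom_apply, comul_h, comul_x, map_add,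
      Algebra.TensorProduct.map_tmul, map_one, mul_add, add_mul,
      Algebra.TensorProduct.tmul_mul_tmul, hfg.h_mul_h, hfg.h_mul_x, hfg.x_mul_h, hfg.x_mul_x,
      mul_one, one_mul, TensorProduct.tmul_smul, ← TensorProduct.smul_tmul',
      TensorProduct.tmul_add, TensorProduct.add_tmul, TensorProduct.tmul_sub,
      TensorProduct.sub_tmul, Algebra.TensorProduct.one_def]
  all_goals module

theorem TaftAlgebra.MixedRelations.counit :
    MixedRelations α l (Bialgebra.counitAlgHom k (TaftAlgebra p n))
      (Bialgebra.counitAlgHom k (TaftAlgebra q m)) := by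
  constructor <;> simp [counit_h, counit_x]

namespace TaftBicrossed

open TaftAlgebra

variable (p q α l n m)

/-- The comultiplication extending those of the two Taft algebras. -/
noncomputable def comulHom : TaftBicrossed p q α l n m →ₐ[k]
    TaftBicrossed p q α l n m ⊗[k] TaftBicrossed p q α l n m :=
  lift _ _ (mixedRelations p q α l n m).map_comp_comul

/-- The counit extending those of the two Taft algebras. -/
noncomputable def counitHom : TaftBicrossed p q α l n m →ₐ[k] k := lift _ _ .counit

noncomputable instance instBialgebra : Bialgebra k (TaftBicrossed p q α l n m) :=
  Bialgebra.ofAlgHom (comulHom p q α l n m) (counitHom p q α l n m)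
    (by
      refine algHom_ext (TaftAlgebra.algHom_ext ?_ ?_) (TaftAlgebra.algHom_ext ?_ ?_) <;>
        simp [comulHom, comul_h, comul_x, TensorProduct.add_tmul, TensorProduct.tmul_add,
          Algebra.TensorProduct.one_def, add_assoc])
    (by
      refine algHom_ext (TaftAlgebra.algHom_ext ?_ ?_) (TaftAlgebra.algHom_ext ?_ ?_) <;>
        simp [comulHom, counitHom, comul_h, comul_x, counit_h, counit_x])
    (by
      refine algHom_ext (TaftAlgebra.algHom_ext ?_ ?_) (TaftAlgebra.algHom_ext ?_ ?_) <;>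
        simp [comulHom, counitHom, comul_h, comul_x, counit_h, counit_x])

/-- The left Taft algebra, mapped to the bialgebra it generates with the right one. -/
noncomputable def inlBialgHom : TaftAlgebra p n →ₐc[k] TaftBicrossed p q α l n m :=
  BialgHom.ofAlgHom (inl p q α l n m) (lift_comp_inl _ _ .counit)
    (lift_comp_inl _ _ (mixedRelations p q α l n m).map_comp_comul).symm

/-- The right Taft algebra, mapped to the bialgebra it generates with the left one. -/
noncomputable def inrBialgHom : TaftAlgebra q m →ₐc[k] TaftBicrossed p q α l n m :=
  BialgHom.ofAlgHom (inr p q α l n m) (lift_comp_inr _ _ .counit)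
    (lift_comp_inr _ _ (mixedRelations p q α l n m).map_comp_comul).symm

theorem inlBialgHom_apply (a : TaftAlgebra p n) : inlBialgHom p q α l n m a = inl p q α l n m a :=
  rfl

theorem inrBialgHom_apply (b : TaftAlgebra q m) : inrBialgHom p q α l n m b = inr p q α l n m b :=
  rfl

end TaftBicrossed

end Bialgebra

section QCommutation

variable {k E : Type*} [Field k] [Ring E] [Algebra k E]

theorem mul_pow_eq_zero_of_qComm {r : k} {a b : E} (hab : b * a = r • (a * b)) {i : ℕ}
    (hb : b ^ i = 0) : (a * b) ^ i = 0 := by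
  suffices exists_mul_pow : ∀ i, ∃ c : E, (a * b) ^ i = c * b ^ i by
    obtain ⟨c, hc⟩ := exists_mul_pow i
    rw [hc, hb, mul_zero]
  intro i
  induction i with
  | zero => exact ⟨1, by simp⟩
  | succ i ih =>
    obtain ⟨c, hc⟩ := ih
    refine ⟨r ^ i • (c * a), ?_⟩
    rw [pow_succ, hc, mul_assoc, ← mul_assoc _ a, pow_mul_of_qComm hab, smul_mul_assoc,
      mul_smul_comm, smul_mul_assoc, mul_assoc a, ← pow_succ, mul_assoc]

theorem pow_succ_mul_of_mul_eq_smul_add {r l : k} {a b : E}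
    (hab : a * b = r • (b * a) + l • 1) (i : ℕ) :
    a ^ (i + 1) * b =
      r ^ (i + 1) • (b * a ^ (i + 1)) + (l * TaftAlgebra.qInt r (i + 1)) • a ^ i := by
  induction i with
  | zero => simpa [TaftAlgebra.qInt] using hab
  | succ i ih =>
    rw [pow_succ', mul_assoc, ih, mul_add, mul_smul_comm, mul_smul_comm, ← mul_assoc, hab,
      add_mul, smul_mul_assoc, smul_mul_assoc, one_mul, mul_assoc, ← pow_succ', ← pow_succ',
      TaftAlgebra.qInt_add r (i + 1) 1]
    simp only [TaftAlgebra.qInt, Finset.sum_range_one, pow_zero]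
    module

end QCommutation

section Jackson

variable {k : Type u} [Field k] {p q α l : k} {n m : ℕ}

namespace TaftAlgebra

theorem scale_mul_lmul (s t : k) (hs : s ^ n = 1) (a : TaftAlgebra p n) :
    AlgHom.toEnd (scale s t hs) * Algebra.lmul k _ a =
      Algebra.lmul k _ (scale s t hs a) * AlgHom.toEnd (scale s t hs) :=
  LinearMap.ext fun b => map_mul (scale s t hs) a b

variable [n.AtLeastTwo] [hp : Fact (IsPrimitiveRoot p n)]

/-- The Jackson derivative `D` on the left Taft algebra. It governs the commutation rule
`x * a = scale α α _ a * x + D a - H * D a * h` with the generators `h`, `x` of the right Taft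
algebra, `H` being the group-like generator of the left one. -/
noncomputable def jackson (α l : k) (hα : α ^ n = 1) : Module.End k (TaftAlgebra p n) :=
  (l * α⁻¹) • (rightAct (skewDer (q := p) (m := n)) * AlgHom.toEnd (scale α α hα))

theorem jackson_apply (hα : α ^ n = 1) (a : TaftAlgebra p n) :
    jackson α l hα a = (l * α⁻¹) • rightAct skewDer (scale α α hα a) := rfl

theorem jackson_zero_right (hα : α ^ n = 1) :
    jackson α 0 hα = (0 : Module.End k (TaftAlgebra p n)) := by
  rw [jackson, zero_mul, zero_smul]

theorem jackson_one (hα : α ^ n = 1) : jackson α l hα (1 : TaftAlgebra p n) = 0 := by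
  rw [jackson_apply, map_one, rightAct_skewDer_one, smul_zero]

theorem jackson_h_mul (hα : α ^ n = 1) (a : TaftAlgebra p n) :
    jackson α l hα (h p n * a) = α • (h p n * jackson α l hα a) := by
  rw [jackson_apply, jackson_apply, map_mul, scale_h, smul_mul_assoc, map_smul,
    rightAct_skewDer_h_mul, mul_smul_comm, smul_comm α]

theorem jackson_x_mul (hα : Admissible p q α l n m) (a : TaftAlgebra p n) :
    jackson α l hα.pow_left (x p n * a) =
      α • (x p n * jackson α l hα.pow_left a) + l • a := by
  obtain rfl | hl := eq_or_ne l 0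
  · simp [jackson_zero_right]
  have α_mul_p := hα.mul_left_eq_one hl
  have scale_scale : scale p p (q_pow_eq_one p n) (scale α α hα.pow_left a) = a := by
    rw [← AlgHom.mul_apply, scale_mul_scale]
    simp only [mul_comm p, α_mul_p, scale_one_one, AlgHom.one_apply]
  rw [jackson_apply, jackson_apply, map_mul, scale_x, smul_mul_assoc, map_smul,
    rightAct_skewDer_x_mul, scale_scale, smul_add, smul_add, mul_smul_comm, smul_comm α,
    smul_smul _ α a, mul_assoc, inv_mul_cancel₀ (left_ne_zero_of_mul_eq_one α_mul_p), mul_one]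

theorem jackson_mul_lmul_h (hα : α ^ n = 1) :
    jackson α l hα * Algebra.lmul k _ (h p n) =
      α • (Algebra.lmul k _ (h p n) * jackson α l hα) :=
  LinearMap.ext (jackson_h_mul hα)

theorem jackson_mul_lmul_x (hα : Admissible p q α l n m) :
    jackson α l hα.pow_left * Algebra.lmul k _ (x p n) =
      α • (Algebra.lmul k _ (x p n) * jackson α l hα.pow_left) + l • 1 :=
  LinearMap.ext (jackson_x_mul hα)

theorem smul_jackson (hα : Admissible p q α l n m) :
    α • jackson (p := p) α l hα.pow_left = q • jackson α l hα.pow_left := by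
  obtain rfl | hl := eq_or_ne l 0
  · simp [jackson_zero_right]
  · simp only [hα.eq_right hl]

theorem mul_smul_jackson (hα : Admissible p q α l n m) :
    (α * p) • jackson (p := p) α l hα.pow_left = jackson α l hα.pow_left := by
  obtain rfl | hl := eq_or_ne l 0
  · simp [jackson_zero_right]
  · rw [hα.mul_left_eq_one hl, one_smul]

theorem jackson_mul_scale (hα : Admissible p q α l n m) (s t : k) (hs : s ^ n = 1) :
    jackson (p := p) α l hα.pow_left * AlgHom.toEnd (scale s t hs) =
      t • (AlgHom.toEnd (scale s t hs) * jackson α l hα.pow_left) := by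
  ext a
  simp only [Module.End.mul_apply, LinearMap.smul_apply, AlgHom.toEnd_apply,
    AlgHom.toLinearMap_apply]
  induction a using induction_left with
  | one => simp [jackson_one]
  | h_mul a ha =>
    simp only [map_mul, map_smul, scale_h, smul_mul_assoc, jackson_h_mul, ha, mul_smul_comm]
    simp only [smul_smul, mul_comm, mul_left_comm]
  | x_mul a ha =>
    simp only [map_mul, map_smul, map_add, scale_x, smul_mul_assoc, jackson_x_mul hα, ha,
      mul_smul_comm]
  | smul c a ha => rw [map_smul, map_smul, map_smul, map_smul, ha, smul_comm]
  | add a b ha hb => rw [map_add, map_add, map_add, map_add, ha, hb, smul_add]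

theorem jackson_mul_scale_right (hα : Admissible p q α l n m) (s : k) (hs : s ^ n = 1) :
    jackson (p := p) α l hα.pow_left * AlgHom.toEnd (scale s α hs) =
      q • (AlgHom.toEnd (scale s α hs) * jackson α l hα.pow_left) := by
  rw [jackson_mul_scale hα, ← mul_smul_comm, smul_jackson hα, mul_smul_comm]

theorem sub_one_smul_x_mul_jackson (hα : Admissible p q α l n m) (a : TaftAlgebra p n) :
    (α - 1) • (x p n * jackson α l hα.pow_left a) = l • (scale 1 α (one_pow n) a - a) := by
  induction a using induction_left with
  | one => simp [jackson_one]
  | h_mul a ha =>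
    calc (α - 1) • (x p n * jackson α l hα.pow_left (h p n * a))
        = (α - 1) • (h p n * (x p n * (α * p) • jackson α l hα.pow_left a)) := by
          rw [jackson_h_mul, mul_smul_comm, ← mul_assoc, x_mul_h, smul_mul_assoc, smul_smul,
            mul_assoc (h p n), mul_smul_comm, mul_smul_comm, mul_smul (α - 1), mul_smul α]
      _ = h p n * ((α - 1) • (x p n * jackson α l hα.pow_left a)) := by
          rw [← LinearMap.smul_apply, mul_smul_jackson hα, mul_smul_comm]
      _ = l • (scale 1 α (one_pow n) (h p n * a) - h p n * a) := by
          rw [ha, map_mul, scale_h, one_smul, mul_smul_comm, mul_sub]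
  | x_mul a ha =>
    rw [jackson_x_mul hα, mul_add, mul_smul_comm, smul_add, smul_comm, ← mul_smul_comm (α - 1),
      ha, map_mul, scale_x]
    simp only [mul_smul_comm, smul_mul_assoc, mul_sub]
    module
  | smul c a ha => rw [map_smul, mul_smul_comm, smul_comm, ha, map_smul]; module
  | add a b ha hb => rw [map_add, mul_add, smul_add, ha, hb, map_add]; module

theorem h_mul_jackson_x_mul (hα : Admissible p q α l n m) (a : TaftAlgebra p n) :
    h p n * jackson α l hα.pow_left (x p n * a) =
      α • (x p n * (h p n * jackson α l hα.pow_left a)) +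
        l • (h p n * scale 1 α (one_pow n) a) := by
  have x_mul_h_mul : α • (x p n * (h p n * jackson α l hα.pow_left a)) =
      h p n * (x p n * jackson α l hα.pow_left a) := by
    rw [← mul_assoc, x_mul_h, smul_mul_assoc, smul_smul, mul_assoc, ← mul_smul_comm,
      ← mul_smul_comm, ← LinearMap.smul_apply, mul_smul_jackson hα]
  have h_mul_sub := congrArg (h p n * ·) (sub_one_smul_x_mul_jackson hα a)
  simp only [mul_smul_comm, mul_sub, sub_smul, one_smul, smul_sub] at h_mul_sub
  rw [x_mul_h_mul, jackson_x_mul hα, mul_add, mul_smul_comm, mul_smul_comm]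
  exact (sub_eq_sub_iff_add_eq_add.mp h_mul_sub).trans (add_comm _ _)

theorem jackson_pow_eq_zero [m.AtLeastTwo] [hq : Fact (IsPrimitiveRoot q m)]
    (hα : Admissible p q α l n m) : jackson (p := p) α l hα.pow_left ^ m = 0 := by
  obtain rfl | hl := eq_or_ne l 0
  · rw [jackson_zero_right, zero_pow (NeZero.ne m)]
  obtain ⟨i, hi⟩ := Nat.exists_eq_succ_of_ne_zero (NeZero.ne m)
  have qInt_eq_zero : qInt α (i + 1) = 0 := by
    rw [hα.eq_right hl, ← Nat.succ_eq_add_one, ← hi]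
    exact TaftAlgebra.qInt_eq_zero hq.out Nat.AtLeastTwo.one_lt
  have pow_mul_lmul_x := pow_succ_mul_of_mul_eq_smul_add (r := α) (l := l)
    (b := Algebra.lmul k _ (x p n)) (jackson_mul_lmul_x hα) i
  have pow_mul_lmul_h := pow_mul_of_qComm (r := α) (a := Algebra.lmul k _ (h p n))
    (jackson_mul_lmul_h (l := l) hα.pow_left) m
  rw [qInt_eq_zero, mul_zero, zero_smul, add_zero, ← Nat.succ_eq_add_one, ← hi]
    at pow_mul_lmul_x
  refine LinearMap.ext fun a => ?_
  induction a using induction_left with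
  | one =>
    rw [← pow_sub_one_mul (NeZero.ne m), Module.End.mul_apply, jackson_one, map_zero,
      LinearMap.zero_apply]
  | h_mul a ha => simpa [ha] using LinearMap.congr_fun pow_mul_lmul_h a
  | x_mul a ha => simpa [ha] using LinearMap.congr_fun pow_mul_lmul_x a
  | smul c a ha => rw [map_smul, ha, map_smul]
  | add a b ha hb => rw [map_add, ha, hb, map_add]

end TaftAlgebra

end Jackson

namespace TaftBicrossed

open TaftAlgebra

variable {k : Type u} [Field k] {p q α l : k} {n m : ℕ}

section Representation

variable (q m) in
/-- The action of `h` on the tensor product of the two Taft algebras. -/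
noncomputable def hOp (α : k) : Module.End k (TaftAlgebra p n ⊗[k] TaftAlgebra q m) :=
  TensorProduct.map (AlgHom.toEnd (scale 1 α (one_pow n))) (Algebra.lmul k _ (h q m))

variable (p q n m) in
/-- The action of the left Taft algebra on the tensor product by left multiplication. -/
noncomputable def leftRep :
    TaftAlgebra p n →ₐ[k] Module.End k (TaftAlgebra p n ⊗[k] TaftAlgebra q m) :=
  Algebra.lsmul k k (TaftAlgebra p n ⊗[k] TaftAlgebra q m)

theorem hOp_tmul (a : TaftAlgebra p n) (b : TaftAlgebra q m) :
    hOp q m α (a ⊗ₜ[k] b) = scale 1 α (one_pow n) a ⊗ₜ[k] (h q m * b) := rfl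

theorem leftRep_tmul (c a : TaftAlgebra p n) (b : TaftAlgebra q m) :
    leftRep p q n m c (a ⊗ₜ[k] b) = (c * a) ⊗ₜ[k] b := rfl

theorem hOp_pow (hα : α ^ m = 1) :
    (hOp q m α : Module.End k (TaftAlgebra p n ⊗[k] TaftAlgebra q m)) ^ m = 1 := by
  rw [hOp, TensorProduct.map_pow, ← map_pow, ← map_pow, scale_pow, h_pow, map_one]
  simp only [one_pow, hα, scale_one_one, map_one]
  exact TensorProduct.map_one

variable [n.AtLeastTwo] [hp : Fact (IsPrimitiveRoot p n)]

variable (q m) in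
/-- The action of `x` on the tensor product of the two Taft algebras. -/
noncomputable def xOp (l : k) (hα : α ^ n = 1) :
    Module.End k (TaftAlgebra p n ⊗[k] TaftAlgebra q m) :=
  TensorProduct.map (Algebra.lmul k _ (-h p n) * jackson α l hα) (Algebra.lmul k _ (h q m)) +
    TensorProduct.map (AlgHom.toEnd (scale α α hα)) (Algebra.lmul k _ (x q m)) +
    TensorProduct.map (jackson α l hα) 1

theorem xOp_tmul (hα : α ^ n = 1) (a : TaftAlgebra p n) (b : TaftAlgebra q m) :
    xOp q m l hα (a ⊗ₜ[k] b) = (-(h p n * jackson α l hα a)) ⊗ₜ[k] (h q m * b) +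
      scale α α hα a ⊗ₜ[k] (x q m * b) + jackson α l hα a ⊗ₜ[k] b := by
  rw [← neg_mul]
  rfl

theorem jackson_mul_lmul_neg_h (hα : α ^ n = 1) :
    jackson α l hα * Algebra.lmul k _ (-h p n) =
      α • (Algebra.lmul k _ (-h p n) * jackson α l hα) :=
  LinearMap.ext fun a => by simp [jackson_h_mul]

theorem lmul_x_mul_lmul_h :
    Algebra.lmul k _ (x q m) * Algebra.lmul k _ (h q m) =
      q • (Algebra.lmul k _ (h q m) * Algebra.lmul k _ (x q m)) := by
  rw [← map_mul, x_mul_h, map_smul, map_mul]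

theorem xOp_pow [m.AtLeastTwo] [hq : Fact (IsPrimitiveRoot q m)] (hα : Admissible p q α l n m) :
    (xOp q m l hα.pow_left : Module.End k (TaftAlgebra p n ⊗[k] TaftAlgebra q m)) ^ m = 0 := by
  refine add_pow_eq_zero_of_qComm hq.out ?_ (add_pow_eq_zero_of_qComm hq.out ?_ ?_ ?_) ?_
  · rw [mul_add, add_mul, ← TensorProduct.map_mul, ← TensorProduct.map_mul,
      ← TensorProduct.map_mul, ← TensorProduct.map_mul, jackson_mul_scale_right hα,
      ← mul_assoc, jackson_mul_lmul_neg_h, smul_mul_assoc, mul_assoc, ← mul_smul_comm,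
      ← mul_smul_comm, smul_jackson hα, one_mul, mul_one, one_mul, mul_one, mul_smul_comm,
      mul_smul_comm, TensorProduct.map_smul_left, TensorProduct.map_smul_left, smul_add]
  · rw [← TensorProduct.map_mul, ← TensorProduct.map_mul, lmul_x_mul_lmul_h,
      TensorProduct.map_smul_right, ← mul_assoc, scale_mul_lmul, map_neg (scale ..), scale_h,
      ← smul_neg, map_smul, smul_mul_assoc, smul_mul_assoc, mul_assoc, mul_assoc,
      jackson_mul_scale hα, mul_smul_comm]
  · rw [TensorProduct.map_pow, mul_pow_eq_zero_of_qComm (r := α)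
      (jackson_mul_lmul_neg_h hα.pow_left) (jackson_pow_eq_zero hα),
      TensorProduct.map_zero_left]
  · rw [TensorProduct.map_pow, ← map_pow (Algebra.lmul ..), x_pow, map_zero,
      TensorProduct.map_zero_right]
  · rw [TensorProduct.map_pow, jackson_pow_eq_zero hα, TensorProduct.map_zero_left]

theorem xOp_mul_hOp (hα : Admissible p q α l n m) :
    (xOp q m l hα.pow_left * hOp q m α : Module.End k (TaftAlgebra p n ⊗[k] TaftAlgebra q m)) =
      q • (hOp q m α * xOp q m l hα.pow_left) := by
  refine TensorProduct.ext' fun a b => ?_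
  have jackson_scale : jackson α l hα.pow_left (scale 1 α (one_pow n) a) =
      q • scale 1 α (one_pow n) (jackson α l hα.pow_left a) :=
    LinearMap.congr_fun (jackson_mul_scale_right hα 1 (one_pow n)) a
  have scale_scale : scale α α hα.pow_left (scale 1 α (one_pow n) a) =
      scale 1 α (one_pow n) (scale α α hα.pow_left a) :=
    DFunLike.congr_fun (scale_commute α α 1 α hα.pow_left (one_pow n)) a
  simp only [Module.End.mul_apply, LinearMap.smul_apply, hOp_tmul, xOp_tmul, jackson_scale,
    scale_scale, map_add, map_neg, map_mul, scale_h, one_smul, ← mul_assoc, x_mul_h,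
    smul_mul_assoc, mul_smul_comm, smul_add, TensorProduct.tmul_smul, TensorProduct.smul_tmul',
    smul_neg]

/-- The action of the right Taft algebra on the tensor product. -/
noncomputable def rightRep [m.AtLeastTwo] [Fact (IsPrimitiveRoot q m)]
    (hα : Admissible p q α l n m) :
    TaftAlgebra q m →ₐ[k] Module.End k (TaftAlgebra p n ⊗[k] TaftAlgebra q m) :=
  TaftAlgebra.lift (hOp q m α) (xOp q m l hα.pow_left) (hOp_pow hα.pow_right) (xOp_pow hα)
    (xOp_mul_hOp hα)

variable [m.AtLeastTwo] [hq : Fact (IsPrimitiveRoot q m)]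

theorem rightRep_h (hα : Admissible p q α l n m) : rightRep hα (h q m) = hOp q m α :=
  TaftAlgebra.lift_h ..

theorem rightRep_x (hα : Admissible p q α l n m) :
    rightRep hα (x q m) = xOp q m l hα.pow_left :=
  TaftAlgebra.lift_x ..

theorem rightRep_one_tmul (hα : Admissible p q α l n m) (b : TaftAlgebra q m) :
    rightRep hα b (1 ⊗ₜ[k] 1) = 1 ⊗ₜ[k] b := by
  induction b using TaftAlgebra.induction_left with
  | one => simp
  | h_mul b hb => rw [map_mul, Module.End.mul_apply, hb, rightRep_h, hOp_tmul, map_one]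
  | x_mul b hb =>
    rw [map_mul, Module.End.mul_apply, hb, rightRep_x, xOp_tmul, jackson_one, map_one]
    simp
  | smul c b hb => rw [map_smul, LinearMap.smul_apply, hb, TensorProduct.tmul_smul]
  | add a b ha hb => rw [map_add, LinearMap.add_apply, ha, hb, TensorProduct.tmul_add]

theorem mixedRelations_rep (hα : Admissible p q α l n m) :
    MixedRelations α l (leftRep p q n m) (rightRep hα) := by
  constructor <;> refine TensorProduct.ext' fun a b => ?_
  · simp [rightRep_h, hOp_tmul, leftRep_tmul, scale_h]
  · simp [rightRep_h, hOp_tmul, leftRep_tmul, scale_x, TensorProduct.smul_tmul']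
  · simp only [rightRep_x, Module.End.mul_apply, leftRep_tmul, xOp_tmul, jackson_h_mul, map_mul,
      scale_h, LinearMap.smul_apply, map_add, smul_add, TensorProduct.smul_tmul', smul_mul_assoc,
      mul_smul_comm, mul_neg, smul_neg]
  · simp only [rightRep_h, rightRep_x, Module.End.mul_apply, leftRep_tmul, xOp_tmul, hOp_tmul,
      LinearMap.smul_apply, LinearMap.add_apply, LinearMap.sub_apply, Module.End.one_apply]
    rw [h_mul_jackson_x_mul hα, jackson_x_mul hα]
    simp only [map_mul, map_add, map_neg, leftRep_tmul, scale_x, smul_add, smul_sub, smul_neg,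
      neg_add, TensorProduct.smul_tmul', smul_mul_assoc, TensorProduct.add_tmul,
      TensorProduct.neg_tmul]
    abel

end Representation

section Normalization

theorem inr_h_mul_inl (a : TaftAlgebra p n) :
    inr p q α l n m (h q m) * inl p q α l n m a =
      inl p q α l n m (scale 1 α (one_pow n) a) * inr p q α l n m (h q m) := by
  have hmix := mixedRelations p q α l n m
  induction a using TaftAlgebra.induction_left with
  | one => simp
  | h_mul a ha =>
    rw [map_mul, ← mul_assoc, hmix.h_mul_h, mul_assoc, ha, ← mul_assoc, ← map_mul,
      map_mul (scale ..), scale_h, one_smul]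
  | x_mul a ha =>
    rw [map_mul, ← mul_assoc, hmix.h_mul_x, smul_mul_assoc, mul_assoc, ha, ← mul_assoc, ← map_mul,
      map_mul (scale ..), scale_x, smul_mul_assoc, map_smul, smul_mul_assoc]
  | smul c a ha => simp only [map_smul, mul_smul_comm, smul_mul_assoc, ha]
  | add a b ha hb => simp only [map_add, mul_add, add_mul, ha, hb]

variable [n.AtLeastTwo] [hp : Fact (IsPrimitiveRoot p n)]

theorem inr_x_mul_inl (hα : Admissible p q α l n m) (a : TaftAlgebra p n) :
    inr p q α l n m (x q m) * inl p q α l n m a =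
      inl p q α l n m (scale α α hα.pow_left a) * inr p q α l n m (x q m) +
        (inl p q α l n m (jackson α l hα.pow_left a) -
          inl p q α l n m (h p n * jackson α l hα.pow_left a) * inr p q α l n m (h q m)) := by
  have hmix := mixedRelations p q α l n m
  induction a using TaftAlgebra.induction_left with
  | one => simp [jackson_one]
  | h_mul a ha =>
    rw [map_mul, ← mul_assoc, hmix.x_mul_h, smul_mul_assoc, mul_assoc, ha]
    simp only [jackson_h_mul, map_mul, map_smul, scale_h, mul_add, mul_sub, smul_add, smul_sub,
      mul_smul_comm, smul_mul_assoc, mul_assoc]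
  | x_mul a ha =>
    rw [map_mul, ← mul_assoc, hmix.x_mul_x, add_mul, smul_mul_assoc, mul_assoc, ha, smul_mul_assoc,
      sub_mul, one_mul, mul_assoc, inr_h_mul_inl, h_mul_jackson_x_mul hα, jackson_x_mul hα]
    simp only [map_add, map_mul, map_smul, scale_x, mul_add, mul_sub, add_mul, smul_add, smul_sub,
      smul_mul_assoc, mul_assoc]
    abel
  | smul c a ha =>
    rw [map_smul, mul_smul_comm, ha]
    simp only [map_smul, mul_smul_comm, smul_mul_assoc, smul_add, smul_sub]
  | add a b ha hb =>
    rw [map_add, mul_add, ha, hb]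
    simp only [map_add, mul_add, add_mul]
    abel

variable [m.AtLeastTwo] [hq : Fact (IsPrimitiveRoot q m)]

theorem mul_mem_range_mulMap (hα : Admissible p q α l n m) (e : TaftBicrossed p q α l n m) :
    ∀ z ∈ LinearMap.range (mulMap (inlBialgHom p q α l n m) (inrBialgHom p q α l n m)),
      e * z ∈ LinearMap.range (mulMap (inlBialgHom p q α l n m) (inrBialgHom p q α l n m)) := by
  set R := LinearMap.range (mulMap (inlBialgHom p q α l n m) (inrBialgHom p q α l n m))
  have inl_mul_inr_mem (a b) : inl p q α l n m a * inr p q α l n m b ∈ R := ⟨a ⊗ₜ[k] b, rfl⟩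
  have mul_mem (y : TaftBicrossed p q α l n m)
      (hy : ∀ a b, y * (inl p q α l n m a * inr p q α l n m b) ∈ R) : ∀ z ∈ R, y * z ∈ R := by
    rintro _ ⟨z, rfl⟩
    induction z using TensorProduct.induction_on with
    | zero => simp
    | tmul a b => exact hy a b
    | add y z hy hz => rw [map_add, mul_add]; exact R.add_mem hy hz
  induction e using TaftBicrossed.induction with
  | left c => exact mul_mem _ fun a b => by rw [← mul_assoc, ← map_mul]; exact inl_mul_inr_mem ..
  | right c =>
    induction c using TaftAlgebra.induction_left with
    | one => simp
    | h_mul c hc =>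
      intro z hz
      rw [map_mul, mul_assoc]
      refine mul_mem _ (fun a b => ?_) _ (hc z hz)
      rw [← mul_assoc, inr_h_mul_inl, mul_assoc, ← map_mul]
      exact inl_mul_inr_mem ..
    | x_mul c hc =>
      intro z hz
      rw [map_mul, mul_assoc]
      refine mul_mem _ (fun a b => ?_) _ (hc z hz)
      rw [← mul_assoc, inr_x_mul_inl hα, add_mul, sub_mul, mul_assoc, mul_assoc, ← map_mul,
        ← map_mul]
      exact R.add_mem (inl_mul_inr_mem ..) (R.sub_mem (inl_mul_inr_mem ..) (inl_mul_inr_mem ..))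
    | smul r c hc => intro z hz; rw [map_smul, smul_mul_assoc]; exact R.smul_mem r (hc z hz)
    | add a b ha hb => intro z hz; rw [map_add, add_mul]; exact R.add_mem (ha z hz) (hb z hz)
  | mul a b ha hb => intro z hz; rw [mul_assoc]; exact ha _ (hb z hz)
  | add a b ha hb => intro z hz; rw [add_mul]; exact R.add_mem (ha z hz) (hb z hz)

theorem mulMap_bijective (hα : Admissible p q α l n m) :
    Function.Bijective (mulMap (inlBialgHom p q α l n m) (inrBialgHom p q α l n m)) := by
  refine ⟨?_, fun e => ?_⟩
  · let φ := lift _ _ (mixedRelations_rep hα)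
    refine Function.LeftInverse.injective (g := fun e => φ e (1 ⊗ₜ[k] 1)) fun z => ?_
    induction z using TensorProduct.induction_on with
    | zero => simp
    | add a b ha hb => simp only [map_add, LinearMap.add_apply, ha, hb]
    | tmul a b =>
      simp only [mulMap_tmul, inlBialgHom_apply, inrBialgHom_apply, map_mul, φ, lift_inl, lift_inr,
        Module.End.mul_apply, rightRep_one_tmul, leftRep_tmul, mul_one]
  · simpa using mul_mem_range_mulMap hα e 1 ⟨1, mulMap_one _ _⟩

end Normalization

end TaftBicrossed

namespace TaftAlgebra

section Rescaling

variable {k : Type u} {E : Type*} [Field k] [Ring E] [Algebra k E] {r p : k} {N n : ℕ}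

/-- Two homomorphisms from Taft algebras agree up to rescaling the skew-primitive generator. -/
structure IsRescaling (f : TaftAlgebra r N →ₐ[k] E) (i : TaftAlgebra p n →ₐ[k] E) : Prop where
  parameter_eq : r = p
  map_h : f (h r N) = i (h p n)
  exists_map_x : ∃ c : k, c ≠ 0 ∧ f (x r N) = c • i (x p n)

theorem parameter_eq_of_linearIndependent {H X : E} {c c' : k} (hXH : X * H = p • (H * X))
    (hind : LinearIndependent k ![1 - H, X]) (hH : IsUnit H) (hr : r ≠ 1) (hc : c ≠ 0)
    (hr_comm : (c • X + c' • (1 - H)) * H = r • (H * (c • X + c' • (1 - H)))) :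
    r = p ∧ c' = 0 := by
  have combination_eq_zero : (c' * (1 - r)) • (1 - H) + (c * (p - r)) • X = 0 := by
    refine hH.mul_right_eq_zero.mp ?_
    calc H * ((c' * (1 - r)) • (1 - H) + (c * (p - r)) • X)
        = (c • X + c' • (1 - H)) * H - r • (H * (c • X + c' • (1 - H))) := by
          simp only [add_mul, mul_add, mul_sub, sub_mul, smul_mul_assoc, mul_smul_comm, hXH,
            mul_one, one_mul]
          module
      _ = 0 := sub_eq_zero.mpr hr_comm
  obtain ⟨hc', hpr⟩ := LinearIndependent.pair_iff.mp hind _ _ combination_eq_zero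
  exact ⟨(sub_eq_zero.mp ((mul_eq_zero.mp hpr).resolve_left hc)).symm,
    (mul_eq_zero.mp hc').resolve_right (sub_ne_zero.mpr hr.symm)⟩

theorem isRescaling_of_map_x_eq [NeZero n] [N.AtLeastTwo] [Fact (IsPrimitiveRoot r N)]
    {f : TaftAlgebra r N →ₐ[k] E} {i : TaftAlgebra p n →ₐ[k] E} (hi : i (h p n) ≠ 1)
    (hix : ∀ c : k, i (x p n) ≠ c • (1 - i (h p n)))
    (hfx : ∀ c : k, f (x r N) ≠ c • (1 - f (h r N))) (map_h : f (h r N) = i (h p n)) {c c' : k}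
    (map_x : f (x r N) = c • i (x p n) + c' • (1 - f (h r N))) : IsRescaling f i := by
  have hc : c ≠ 0 := by
    rintro rfl
    exact hfx c' (by rw [map_x, zero_smul, zero_add])
  have hind : LinearIndependent k ![1 - i (h p n), i (x p n)] :=
    (LinearIndependent.pair_iff' (sub_ne_zero.mpr hi.symm)).mpr fun c => (hix c).symm
  have hf_comm : f (x r N) * f (h r N) = r • (f (h r N) * f (x r N)) := by
    rw [← map_mul, x_mul_h, map_smul, map_mul]
  rw [map_x, map_h] at hf_comm
  obtain ⟨rfl, rfl⟩ := parameter_eq_of_linearIndependent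
    (by rw [← map_mul, x_mul_h, map_smul, map_mul]) hind (isUnit_h.map i) (parameter_ne_one r N) hc
    hf_comm
  exact ⟨rfl, map_h, c, hc, by rw [map_x, zero_smul, add_zero]⟩

variable {r' q : k} {N' m : ℕ} {f : TaftAlgebra r N →ₐ[k] E} {g : TaftAlgebra r' N' →ₐ[k] E}
  {i : TaftAlgebra p n →ₐ[k] E} {j : TaftAlgebra q m →ₐ[k] E} {α l α' l' : k}

theorem MixedRelations.parameters_eq [NeZero m] (hfg : MixedRelations α l f g)
    (hij : MixedRelations α' l' i j) (hf : IsRescaling f i) (hg : IsRescaling g j)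
    (hix : i (x p n) ≠ 0) (hne : i (h p n) * j (h q m) ≠ 1) : α = α' ∧ (l = 0 ↔ l' = 0) := by
  obtain ⟨c, hc, hfx⟩ := hf.exists_map_x
  obtain ⟨c', hc', hgx⟩ := hg.exists_map_x
  have h_mul_x := hfg.h_mul_x
  have x_mul_x := hfg.x_mul_x
  rw [hg.map_h, hfx, mul_smul_comm, hij.h_mul_x, smul_mul_assoc, smul_comm α] at h_mul_x
  obtain rfl : α' = α := smul_left_injective k
    (mt (isUnit_h.map j).mul_left_eq_zero.mp hix) (smul_right_injective E hc h_mul_x)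
  rw [hf.map_h, hg.map_h, hfx, hgx, smul_mul_smul_comm, smul_mul_smul_comm, hij.x_mul_x, smul_add,
    smul_comm α', mul_comm c, add_right_inj, smul_smul] at x_mul_x
  rw [← smul_left_injective k (sub_ne_zero.mpr hne.symm) x_mul_x]
  simp [hc, hc']

theorem MixedRelations.parameters_mul_eq_one [NeZero n] (hfg : MixedRelations α l f g)
    (hij : MixedRelations α' l' i j) (hf : IsRescaling f j) (hg : IsRescaling g i)
    (hjx : j (x q m) ≠ 0) (hne : i (h p n) * j (h q m) ≠ 1) :
    α * α' = 1 ∧ (l = 0 ↔ l' = 0) := by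
  obtain ⟨c, hc, hfx⟩ := hf.exists_map_x
  obtain ⟨c', hc', hgx⟩ := hg.exists_map_x
  have h_mul_x := hfg.h_mul_x
  have x_mul_x := hfg.x_mul_x
  rw [hg.map_h, hfx, smul_mul_assoc, hij.x_mul_h, mul_smul_comm, smul_comm α, smul_smul α]
    at h_mul_x
  have α_mul_α' : 1 = α * α' := by
    refine smul_left_injective k (mt (isUnit_h.map i).mul_right_eq_zero.mp hjx)
      (smul_right_injective E hc ?_)
    simpa only [one_smul] using h_mul_x
  rw [hf.map_h, hg.map_h, hfx, hgx, smul_mul_smul_comm, smul_mul_smul_comm, hij.x_mul_x,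
    hij.h_mul_h, mul_comm c', smul_add, smul_add, smul_comm _ α', smul_smul α, ← α_mul_α', one_smul,
    add_assoc, left_eq_add, smul_smul, smul_smul, ← add_smul] at x_mul_x
  have add_eq_zero := (smul_eq_zero.mp x_mul_x).resolve_right (sub_ne_zero.mpr hne.symm)
  refine ⟨α_mul_α'.symm, ?_⟩
  rw [eq_neg_of_add_eq_zero_right add_eq_zero]
  simp [hc, hc', left_ne_zero_of_mul_eq_one α_mul_α'.symm]

end Rescaling

section Embedding

variable {k : Type u} {E : Type*} [Field k] [Ring E] [Bialgebra k E] {p q r : k} {n m N : ℕ}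
  [n.AtLeastTwo] [m.AtLeastTwo] [N.AtLeastTwo] [Fact (IsPrimitiveRoot p n)]
  [Fact (IsPrimitiveRoot q m)] [Fact (IsPrimitiveRoot r N)]

variable (r N) in
theorem x_ne_smul (c : k) : x r N ≠ c • (1 - h r N) := fun hx => by
  simpa [skewDer_x, skewDer_one, skewDer_h] using congrArg skewDer hx

theorem isRescaling_of_mulMap_bijective {i : TaftAlgebra p n →ₐc[k] E}
    {j : TaftAlgebra q m →ₐc[k] E} (hij : Function.Bijective (mulMap i j))
    {f : TaftAlgebra r N →ₐc[k] E} (hf : Function.Injective f) :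
    IsRescaling (f : TaftAlgebra r N →ₐ[k] E) (i : TaftAlgebra p n →ₐ[k] E) ∨
      IsRescaling (f : TaftAlgebra r N →ₐ[k] E) (j : TaftAlgebra q m →ₐ[k] E) := by
  have hfx (c : k) : f (x r N) ≠ c • (1 - f (h r N)) := fun hc =>
    x_ne_smul r N c (hf (by rw [hc, map_smul, map_sub, map_one]))
  rcases skewPrimitive_of_mulMap_bijective hij (isGroupLikeElem_map_h f) (comul_map_x f) with
    ⟨c, map_x⟩ | ⟨map_h, c, c', map_x⟩ | ⟨map_h, c, c', map_x⟩
  · exact absurd map_x (hfx c)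
  · exact .inl (isRescaling_of_map_x_eq (map_h_left_ne_one hij) (map_x_left_ne hij) hfx map_h map_x)
  · exact .inr
      (isRescaling_of_map_x_eq (map_h_right_ne_one hij) (map_x_right_ne hij) hfx map_h map_x)

end Embedding

section ScaleBialgHom

variable {k : Type u} [Field k] {q : k} {m : ℕ} [NeZero m] [hq : Fact (IsPrimitiveRoot q m)]

/-- The rescaling `x ↦ t x` as a bialgebra endomorphism. -/
noncomputable def scaleBialgHom (t : k) : TaftAlgebra q m →ₐc[k] TaftAlgebra q m :=
  BialgHom.ofAlgHom (scale 1 t (one_pow m))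
    (algHom_ext (by simp [scale_h, counit_h]) (by simp [scale_x, counit_x]))
    (algHom_ext (by simp [scale_h, comul_h])
      (by simp [scale_x, scale_h, comul_x, TensorProduct.smul_tmul', smul_add,
        TensorProduct.tmul_smul]))

theorem scaleBialgHom_h (t : k) : scaleBialgHom t (h q m) = h q m :=
  (scale_h _ _ _).trans (one_smul _ _)

theorem scaleBialgHom_x (t : k) : scaleBialgHom t (x q m) = t • x q m := scale_x ..

end ScaleBialgHom

end TaftAlgebra

namespace TaftBicrossed

open TaftAlgebra

section UniversalProperty

variable {k : Type u} [Field k] {p q α l : k} {n m : ℕ} [NeZero n] [NeZero m]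
  [hp : Fact (IsPrimitiveRoot p n)] [hq : Fact (IsPrimitiveRoot q m)]
  {E : Type*} [Ring E] [Bialgebra k E]

theorem bialgHom_ext {φ ψ : TaftBicrossed p q α l n m →ₐc[k] E}
    (inl_h : φ (inl p q α l n m (h p n)) = ψ (inl p q α l n m (h p n)))
    (inl_x : φ (inl p q α l n m (x p n)) = ψ (inl p q α l n m (x p n)))
    (inr_h : φ (inr p q α l n m (h q m)) = ψ (inr p q α l n m (h q m)))
    (inr_x : φ (inr p q α l n m (x q m)) = ψ (inr p q α l n m (x q m))) : φ = ψ :=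
  BialgHom.ext <| AlgHom.congr_fun (φ₁ := (φ : TaftBicrossed p q α l n m →ₐ[k] E)) (φ₂ := ψ) <|
    algHom_ext (TaftAlgebra.algHom_ext inl_h inl_x) (TaftAlgebra.algHom_ext inr_h inr_x)

variable (f : TaftAlgebra p n →ₐc[k] E) (g : TaftAlgebra q m →ₐc[k] E)
  (hfg : MixedRelations α l (f : TaftAlgebra p n →ₐ[k] E) (g : TaftAlgebra q m →ₐ[k] E))

theorem counitAlgHom_comp_lift :
    (Bialgebra.counitAlgHom k E).comp (lift f g hfg) =
      Bialgebra.counitAlgHom k (TaftBicrossed p q α l n m) := by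
  refine algHom_ext ?_ ?_
  · rw [AlgHom.comp_assoc, lift_comp_inl, BialgHom.counitAlgHom_comp]
    exact (BialgHom.counitAlgHom_comp (inlBialgHom p q α l n m)).symm
  · rw [AlgHom.comp_assoc, lift_comp_inr, BialgHom.counitAlgHom_comp]
    exact (BialgHom.counitAlgHom_comp (inrBialgHom p q α l n m)).symm

theorem map_lift_comp_comulAlgHom :
    (Algebra.TensorProduct.map (lift f g hfg) (lift f g hfg)).comp
        (Bialgebra.comulAlgHom k (TaftBicrossed p q α l n m)) =
      (Bialgebra.comulAlgHom k E).comp (lift f g hfg) := by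
  have comul_inl :
      (Algebra.TensorProduct.map (inl p q α l n m) (inl p q α l n m)).comp
          (Bialgebra.comulAlgHom k (TaftAlgebra p n)) =
        (Bialgebra.comulAlgHom k (TaftBicrossed p q α l n m)).comp (inl p q α l n m) :=
    BialgHom.map_comp_comulAlgHom (inlBialgHom p q α l n m)
  have comul_inr :
      (Algebra.TensorProduct.map (inr p q α l n m) (inr p q α l n m)).comp
          (Bialgebra.comulAlgHom k (TaftAlgebra q m)) =
        (Bialgebra.comulAlgHom k (TaftBicrossed p q α l n m)).comp (inr p q α l n m) :=
    BialgHom.map_comp_comulAlgHom (inrBialgHom p q α l n m)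
  refine algHom_ext ?_ ?_
  · rw [AlgHom.comp_assoc, ← comul_inl, ← AlgHom.comp_assoc, ← Algebra.TensorProduct.map_comp,
      AlgHom.comp_assoc, lift_comp_inl, BialgHom.map_comp_comulAlgHom]
  · rw [AlgHom.comp_assoc, ← comul_inr, ← AlgHom.comp_assoc, ← Algebra.TensorProduct.map_comp,
      AlgHom.comp_assoc, lift_comp_inr, BialgHom.map_comp_comulAlgHom]

/-- The bialgebra homomorphism induced by two bialgebra homomorphisms that satisfy the mixed
relations. -/
noncomputable def liftBialgHom : TaftBicrossed p q α l n m →ₐc[k] E :=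
  BialgHom.ofAlgHom (lift f g hfg) (counitAlgHom_comp_lift f g hfg)
    (map_lift_comp_comulAlgHom f g hfg)

theorem liftBialgHom_inl (a : TaftAlgebra p n) :
    liftBialgHom f g hfg (inl p q α l n m a) = f a := lift_inl ..

theorem liftBialgHom_inr (b : TaftAlgebra q m) :
    liftBialgHom f g hfg (inr p q α l n m b) = g b := lift_inr ..

theorem liftBialgHom_mulMap (z : TaftAlgebra p n ⊗[k] TaftAlgebra q m) :
    liftBialgHom f g hfg
      (mulMap (inlBialgHom p q α l n m) (inrBialgHom p q α l n m) z) = mulMap f g z := by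
  induction z using TensorProduct.induction_on with
  | zero => simp
  | add a b ha hb => simp only [map_add, ha, hb]
  | tmul a b =>
    rw [mulMap_tmul, map_mul, inlBialgHom_apply, inrBialgHom_apply, liftBialgHom_inl,
      liftBialgHom_inr, mulMap_tmul]

end UniversalProperty

section Classification

variable {k : Type u} [Field k] {p q α l α' l' : k} {n m : ℕ} [n.AtLeastTwo] [m.AtLeastTwo]
  [hp : Fact (IsPrimitiveRoot p n)] [hq : Fact (IsPrimitiveRoot q m)]

theorem exists_bialgEquiv_of_mulMap_bijective {E : Type*} [Ring E] [Bialgebra k E]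
    {i : TaftAlgebra p n →ₐc[k] E} {j : TaftAlgebra q m →ₐc[k] E}
    (hij : Function.Bijective (mulMap i j)) :
    ∃ α l : k, Admissible p q α l n m ∧ Nonempty (TaftBicrossed p q α l n m ≃ₐc[k] E) := by
  obtain ⟨α, l, hα, hmix⟩ := exists_mixedRelations hij
  refine ⟨α, l, hα, ⟨BialgEquiv.ofBijective (liftBialgHom i j hmix) ?_⟩⟩
  rw [← Function.Bijective.of_comp_iff _ (mulMap_bijective hα)]
  exact (funext (liftBialgHom_mulMap i j hmix) : liftBialgHom i j hmix ∘ _ = mulMap i j) ▸ hij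

theorem inlBialgHom_injective (hα : Admissible p q α l n m) :
    Function.Injective (inlBialgHom p q α l n m) := fun a b hab =>
  Algebra.TensorProduct.includeLeft_injective (R := k) (S := k) (B := TaftAlgebra q m)
    (FaithfulSMul.algebraMap_injective _ _) ((mulMap_bijective hα).1 (by simp [hab]))

theorem inrBialgHom_injective (hα : Admissible p q α l n m) :
    Function.Injective (inrBialgHom p q α l n m) := fun a b hab =>
  Algebra.TensorProduct.includeRight_injective (R := k) (A := TaftAlgebra p n)
    (FaithfulSMul.algebraMap_injective _ _) ((mulMap_bijective hα).1 (by simp [hab]))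

theorem parameters_of_bialgEquiv (hα : Admissible p q α l n m) (hα' : Admissible p q α' l' n m)
    (φ : TaftBicrossed p q α l n m ≃ₐc[k] TaftBicrossed p q α' l' n m) :
    (α = α' ∨ p = q ∧ α * α' = 1) ∧ (l = 0 ↔ l' = 0) := by
  let f := (φ : TaftBicrossed p q α l n m →ₐc[k] TaftBicrossed p q α' l' n m).comp
    (inlBialgHom p q α l n m)
  let g := (φ : TaftBicrossed p q α l n m →ₐc[k] TaftBicrossed p q α' l' n m).comp
    (inrBialgHom p q α l n m)
  have hfg : MixedRelations α l (f : TaftAlgebra p n →ₐ[k] TaftBicrossed p q α' l' n m)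
      (g : TaftAlgebra q m →ₐ[k] TaftBicrossed p q α' l' n m) :=
    (mixedRelations p q α l n m).map ((φ : TaftBicrossed p q α l n m →ₐc[k]
      TaftBicrossed p q α' l' n m) : TaftBicrossed p q α l n m →ₐ[k] TaftBicrossed p q α' l' n m)
  have hmix := mixedRelations p q α' l' n m
  have map_h_ne : f (h p n) ≠ g (h q m) := fun heq =>
    map_h_left_ne_map_h_right (mulMap_bijective hα) (EquivLike.injective φ heq)
  have hij := mulMap_bijective hα'
  rcases isRescaling_of_mulMap_bijective hij (f := f)
      ((EquivLike.injective φ).comp (inlBialgHom_injective hα)),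
    isRescaling_of_mulMap_bijective hij (f := g)
      ((EquivLike.injective φ).comp (inrBialgHom_injective hα)) with
    ⟨hf | hf, hg | hg⟩
  · exact absurd (hf.map_h.trans hg.map_h.symm) map_h_ne
  · obtain ⟨hαα', hll'⟩ := hfg.parameters_eq hmix hf hg (map_x_left_ne_zero hij)
      (map_h_mul_map_h_ne_one hij)
    exact ⟨.inl hαα', hll'⟩
  · obtain ⟨hαα', hll'⟩ := hfg.parameters_mul_eq_one hmix hf hg (map_x_right_ne_zero hij)
      (map_h_mul_map_h_ne_one hij)
    exact ⟨.inr ⟨hf.parameter_eq, hαα'⟩, hll'⟩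
  · exact absurd (hf.map_h.trans hg.map_h.symm) map_h_ne

end Classification

section Isomorphisms

variable {k : Type u} [Field k] {p q : k} {n m : ℕ} [NeZero n] [NeZero m]
  [hp : Fact (IsPrimitiveRoot p n)] [hq : Fact (IsPrimitiveRoot q m)]

variable (p q n m) in
/-- The homomorphism that rescales the skew-primitive generator of the right Taft algebra. -/
noncomputable def rescaleHom (α l l' t : k) (ht : l' * t = l) :
    TaftBicrossed p q α l n m →ₐc[k] TaftBicrossed p q α l' n m :=
  liftBialgHom (inlBialgHom p q α l' n m) ((inrBialgHom p q α l' n m).comp (scaleBialgHom t)) (by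
    have hmix := mixedRelations p q α l' n m
    constructor <;> simp only [BialgHom.coe_toAlgHom, BialgHom.comp_apply, scaleBialgHom_h,
      scaleBialgHom_x, inlBialgHom_apply, inrBialgHom_apply, map_smul]
    · exact hmix.h_mul_h
    · exact hmix.h_mul_x
    · rw [smul_mul_assoc, hmix.x_mul_h, mul_smul_comm, smul_comm]
    · rw [smul_mul_assoc, hmix.x_mul_x, mul_smul_comm, smul_add, smul_comm t α, smul_smul t,
        mul_comm t, ht])

variable (p q n m) in
theorem rescaleHom_comp_rescaleHom {α l l' t t' : k} (ht : l' * t = l) (ht' : l * t' = l')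
    (htt' : t * t' = 1) :
    (rescaleHom p q n m α l' l t' ht').comp (rescaleHom p q n m α l l' t ht) =
      BialgHom.id k (TaftBicrossed p q α l n m) := by
  apply bialgHom_ext <;>
    simp [rescaleHom, liftBialgHom_inl, liftBialgHom_inr, inlBialgHom_apply, inrBialgHom_apply,
      scaleBialgHom_h, scaleBialgHom_x, smul_smul, htt']

theorem nonempty_bialgEquiv_one (α : k) {l : k} (hl : l ≠ 0) :
    Nonempty (TaftBicrossed p q α l n m ≃ₐc[k] TaftBicrossed p q α 1 n m) :=
  ⟨BialgEquiv.ofBialgHom (rescaleHom p q n m α l 1 l (one_mul l))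
    (rescaleHom p q n m α 1 l l⁻¹ (mul_inv_cancel₀ hl))
    (rescaleHom_comp_rescaleHom p q n m _ _ (inv_mul_cancel₀ hl))
    (rescaleHom_comp_rescaleHom p q n m _ _ (mul_inv_cancel₀ hl))⟩

variable (p n) in
/-- The homomorphism that exchanges the two Taft algebras. -/
noncomputable def swapHom {α α' : k} (hα : α * α' = 1) :
    TaftBicrossed p p α 0 n n →ₐc[k] TaftBicrossed p p α' 0 n n :=
  liftBialgHom (inrBialgHom p p α' 0 n n) (inlBialgHom p p α' 0 n n) (by
    have hmix := mixedRelations p p α' 0 n n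
    constructor <;> simp only [BialgHom.coe_toAlgHom, inlBialgHom_apply, inrBialgHom_apply]
    · exact hmix.h_mul_h.symm
    · rw [hmix.x_mul_h, smul_smul, hα, one_smul]
    · rw [hmix.h_mul_x, smul_smul, hα, one_smul]
    · rw [hmix.x_mul_x, zero_smul, zero_smul, add_zero, add_zero, smul_smul, hα, one_smul])

variable (p n) in
theorem swapHom_comp_swapHom {α α' : k} (hα : α * α' = 1) (hα' : α' * α = 1) :
    (swapHom p n hα').comp (swapHom p n hα) = BialgHom.id k (TaftBicrossed p p α 0 n n) := by
  apply bialgHom_ext <;>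
    simp [swapHom, liftBialgHom_inl, liftBialgHom_inr, inlBialgHom_apply, inrBialgHom_apply]

theorem nonempty_bialgEquiv_of_mul_eq_one {α α' : k} (hα : α * α' = 1) :
    Nonempty (TaftBicrossed p p α 0 n n ≃ₐc[k] TaftBicrossed p p α' 0 n n) :=
  have hα' : α' * α = 1 := by rw [mul_comm, hα]
  ⟨BialgEquiv.ofBialgHom (swapHom p n hα) (swapHom p n hα')
    (swapHom_comp_swapHom p n hα' hα) (swapHom_comp_swapHom p n hα hα')⟩

end Isomorphisms

end TaftBicrossed

theorem cardinalMk_eq_of_bijective {P Q : Type*} [Finite P] {f : P → Q}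
    (hf : Function.Bijective f) : Cardinal.mk Q = Nat.card P := by
  have : Finite Q := Finite.of_surjective f hf.surjective
  rw [Nat.card_eq_of_bijective f hf, Nat.cast_card]

section RootsOfUnity

variable {k : Type u} [Field k] {q : k} {m : ℕ}

theorem finite_pow_eq_one {d : ℕ} (hd : 0 < d) : Finite {ω : k // ω ^ d = 1} :=
  (Fintype.subtype _ fun _ => Polynomial.mem_nthRootsFinset hd 1).finite

theorem card_pow_eq_one [NeZero m] (hq : IsPrimitiveRoot q m) :
    Nat.card {ω : k // ω ^ m = 1} = m := by
  rw [Nat.subtype_card _ fun _ => Polynomial.mem_nthRootsFinset (NeZero.pos m) 1,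
    hq.card_nthRootsFinset]

theorem eq_of_pow_mul_pow_eq_one (hq : IsPrimitiveRoot q m) {i j : ℕ} (hi : i ≤ m / 2)
    (hj : j ≤ m / 2) (hij : q ^ i * q ^ j = 1) : i = j := by
  rw [← pow_add, hq.pow_eq_one_iff_dvd] at hij
  rcases Nat.eq_zero_or_pos (i + j) with h_zero | h_pos
  · omega
  · have := Nat.le_of_dvd h_pos hij
    omega

theorem mul_self_ne_one (hq : IsPrimitiveRoot q m) (hm : 3 ≤ m) : q * q ≠ 1 := by
  rw [← pow_two]
  exact hq.pow_ne_one_of_pos_of_lt two_ne_zero hm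

theorem mul_eq_one_iff_eq_pow {p : k} {n : ℕ} [NeZero m] (hq : IsPrimitiveRoot q m)
    (hp : IsPrimitiveRoot p n) : q * p = 1 ↔ m = n ∧ p = q ^ (n - 1) := by
  have mul_pow_pred : q * q ^ (m - 1) = 1 := by
    rw [mul_pow_sub_one (NeZero.ne m), hq.pow_eq_one]
  constructor
  · intro hqp
    obtain rfl : m = n := hq.unique (eq_inv_of_mul_eq_one_left hqp ▸ hp.inv)
    exact ⟨rfl, mul_left_cancel₀ (hq.ne_zero (NeZero.ne m)) (hqp.trans mul_pow_pred.symm)⟩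
  · rintro ⟨rfl, rfl⟩
    exact mul_pow_pred

end RootsOfUnity

namespace TaftBicrossed

open TaftAlgebra

section Counting

variable {k : Type u} [Field k] {p q α l : k} {n m : ℕ}

theorem admissible_zero (hα : α ^ n.gcd m = 1) : Admissible p q α 0 n m where
  pow_left := (pow_gcd_eq_one.mp hα).1
  pow_right := (pow_gcd_eq_one.mp hα).2
  eq_right := absurd rfl
  mul_left_eq_one := absurd rfl

theorem admissible_one [hp : Fact (IsPrimitiveRoot p n)] [hq : Fact (IsPrimitiveRoot q m)]
    (hqp : q * p = 1) : Admissible p q q 1 n m where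
  pow_left := by rw [eq_inv_of_mul_eq_one_left hqp, inv_pow, hp.out.pow_eq_one, inv_one]
  pow_right := hq.out.pow_eq_one
  eq_right _ := rfl
  mul_left_eq_one _ := hqp

variable [n.AtLeastTwo] [m.AtLeastTwo] [hp : Fact (IsPrimitiveRoot p n)]
  [hq : Fact (IsPrimitiveRoot q m)]

variable (p q n m) in
/-- The isomorphism types of the Hopf algebras that factor through two Taft algebras. -/
abbrev FactorizationType : Type (u + 1) :=
  Quotient (factorizationSetoid (HopfAlgCat.of k (TaftAlgebra p n))
    (HopfAlgCat.of k (TaftAlgebra q m)))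

/-- The isomorphism type of `TaftBicrossed p q α l n m`. -/
noncomputable def isoType (hα : Admissible p q α l n m) : FactorizationType p q n m :=
  letI := productHopfAlgebra (A := TaftAlgebra p n) (B := TaftAlgebra q m) (mulMap_bijective hα)
  Quotient.mk _ ⟨HopfAlgCat.of k (TaftBicrossed p q α l n m), inlBialgHom p q α l n m,
    inrBialgHom p q α l n m, inlBialgHom_injective hα, inrBialgHom_injective hα,
    mulMap_bijective hα⟩

theorem isoType_eq_iff {α' l' : k} (hα : Admissible p q α l n m)
    (hα' : Admissible p q α' l' n m) : isoType hα = isoType hα' ↔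
      Nonempty (TaftBicrossed p q α l n m ≃ₐc[k] TaftBicrossed p q α' l' n m) :=
  Quotient.eq

theorem exists_isoType_eq (z : FactorizationType p q n m) :
    ∃ (α l : k) (hα : Admissible p q α l n m), isoType hα = z := by
  obtain ⟨⟨E, i, j, hi, hj, hij⟩, rfl⟩ := Quotient.exists_rep z
  obtain ⟨α, l, hα, e⟩ := exists_bialgEquiv_of_mulMap_bijective (p := p) (q := q) (i := i)
    (j := j) hij
  exact ⟨α, l, hα, Quotient.sound e⟩

variable (p q) in
/-- The isomorphism type of `TaftBicrossed p q α 0 n m`, for a common root of unity `α`. -/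
noncomputable def isoTypeZero (α : {ω : k // ω ^ n.gcd m = 1}) : FactorizationType p q n m :=
  isoType (admissible_zero α.2)

theorem eq_or_mul_eq_one_of_isoTypeZero_eq {α β : {ω : k // ω ^ n.gcd m = 1}}
    (h : isoTypeZero p q α = isoTypeZero p q β) : α = β ∨ p = q ∧ (α : k) * β = 1 := by
  obtain ⟨e⟩ := (isoType_eq_iff _ _).mp h
  exact (parameters_of_bialgEquiv (admissible_zero α.2) (admissible_zero β.2) e).1.imp_left
    Subtype.ext

theorem isoTypeZero_ne_isoType (α : {ω : k // ω ^ n.gcd m = 1})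
    (h : Admissible p q q 1 n m) : isoTypeZero p q α ≠ isoType h := fun heq => by
  obtain ⟨e⟩ := (isoType_eq_iff _ _).mp heq
  exact one_ne_zero ((parameters_of_bialgEquiv (admissible_zero α.2) h e).2.mp rfl)

theorem exists_isoTypeZero_eq_or (z : FactorizationType p q n m) :
    (∃ α, isoTypeZero p q α = z) ∨
      q * p = 1 ∧ ∀ h : Admissible p q q 1 n m, isoType h = z := by
  obtain ⟨α, l, hα, rfl⟩ := exists_isoType_eq z
  by_cases hl : l = 0
  · subst hl
    exact .inl ⟨⟨α, pow_gcd_eq_one.mpr ⟨hα.pow_left, hα.pow_right⟩⟩, rfl⟩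
  · obtain rfl := hα.eq_right hl
    exact .inr ⟨hα.mul_left_eq_one hl, fun _ =>
      ((isoType_eq_iff _ _).mpr (nonempty_bialgEquiv_one α hl)).symm⟩

theorem isoTypeZero_surjective (hqp : q * p ≠ 1) :
    Function.Surjective (isoTypeZero p q (n := n) (m := m)) := fun z =>
  (exists_isoTypeZero_eq_or z).resolve_right fun hz => hqp hz.1

theorem cardinalMk_of_mul_ne_one (hqp : q * p ≠ 1) (hpq : p ≠ q) :
    Cardinal.mk (FactorizationType p q n m) = Nat.card {ω : k // ω ^ n.gcd m = 1} := by
  have := finite_pow_eq_one (k := k) (Nat.gcd_pos_of_pos_left m (NeZero.pos n))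
  exact cardinalMk_eq_of_bijective ⟨fun α β h =>
    (eq_or_mul_eq_one_of_isoTypeZero_eq h).resolve_right fun h => hpq h.1,
    isoTypeZero_surjective hqp⟩

theorem cardinalMk_of_mul_eq_one (hqp : q * p = 1)
    (hinv : p = q → ∀ α β : k, α ^ n.gcd m = 1 → α * β = 1 → α = β) :
    Cardinal.mk (FactorizationType p q n m) =
      (Nat.card {ω : k // ω ^ n.gcd m = 1} + 1 : ℕ) := by
  have := finite_pow_eq_one (k := k) (Nat.gcd_pos_of_pos_left m (NeZero.pos n))
  have hq_one : Admissible p q q 1 n m := admissible_one hqp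
  rw [← Finite.card_option]
  refine cardinalMk_eq_of_bijective
    (f := fun o => Option.elim o (isoType hq_one) (isoTypeZero p q)) ⟨?_, fun z => ?_⟩
  · rintro (_ | α) (_ | β) h
    · rfl
    · exact absurd h.symm (isoTypeZero_ne_isoType _ hq_one)
    · exact absurd h (isoTypeZero_ne_isoType _ hq_one)
    · rcases eq_or_mul_eq_one_of_isoTypeZero_eq h with rfl | ⟨hpq, hαβ⟩
      · rfl
      · rw [Subtype.ext (hinv hpq α β α.2 hαβ)]
  · rcases exists_isoTypeZero_eq_or z with ⟨α, rfl⟩ | ⟨-, hz⟩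
    · exact ⟨some α, rfl⟩
    · exact ⟨none, hz hq_one⟩

theorem cardinalMk_self (hqq : q * q ≠ 1) :
    Cardinal.mk (FactorizationType q q m m) = (m / 2 + 1 : ℕ) := by
  have pow_mem (i : ℕ) : (q ^ i) ^ m.gcd m = 1 := by
    rw [Nat.gcd_self, pow_right_comm, hq.out.pow_eq_one, one_pow]
  rw [← Nat.card_fin (m / 2 + 1)]
  -- Inversion exchanges `q ^ i` and `q ^ (m - i)`, so the exponents up to `m / 2` represent its
  -- orbits.
  refine cardinalMk_eq_of_bijective
    (f := fun i : Fin (m / 2 + 1) => isoTypeZero q q ⟨q ^ (i : ℕ), pow_mem i⟩)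
    ⟨fun i j h => Fin.ext ?_, fun z => ?_⟩
  · have := NeZero.pos m
    rcases eq_or_mul_eq_one_of_isoTypeZero_eq h with pow_eq | ⟨-, mul_eq_one⟩
    · exact hq.out.pow_inj (by omega) (by omega) (congrArg Subtype.val pow_eq)
    · exact eq_of_pow_mul_pow_eq_one hq.out (by omega) (by omega) mul_eq_one
  · obtain ⟨⟨α, hα⟩, rfl⟩ := isoTypeZero_surjective hqq z
    obtain ⟨i, hi, rfl⟩ := hq.out.eq_pow_of_pow_eq_one (by rwa [Nat.gcd_self] at hα)
    rcases le_or_gt i (m / 2) with hi_le | hi_gt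
    · exact ⟨⟨i, by omega⟩, rfl⟩
    · refine ⟨⟨m - i, by omega⟩,
        (isoType_eq_iff _ _).mpr (nonempty_bialgEquiv_of_mul_eq_one ?_)⟩
      rw [← pow_add, Nat.sub_add_cancel hi.le, hq.out.pow_eq_one]

end Counting

section Cases

variable {k : Type u} [Field k] {p q : k} {n m : ℕ} [n.AtLeastTwo] [m.AtLeastTwo]
  [hp : Fact (IsPrimitiveRoot p n)] [hq : Fact (IsPrimitiveRoot q m)]

theorem cardinalMk_two {p q : k} [hp : Fact (IsPrimitiveRoot p 2)]
    [hq : Fact (IsPrimitiveRoot q 2)] : Cardinal.mk (FactorizationType p q 2 2) = 3 := by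
  have hqp : q * p = 1 := by
    rw [hq.out.eq_neg_one_of_two_right, hp.out.eq_neg_one_of_two_right, neg_one_mul, neg_neg]
  rw [cardinalMk_of_mul_eq_one hqp, Nat.gcd_self, card_pow_eq_one hq.out]
  · norm_num
  · intro _ α β hα hαβ
    have hα_ne : α ≠ 0 := left_ne_zero_of_mul_eq_one hαβ
    exact mul_left_cancel₀ hα_ne (by rw [hαβ, ← pow_two]; exact hα)

theorem cardinalMk_of_ne (hmn : m ≠ n ∨ p ≠ q ∧ p ≠ q ^ (n - 1)) :
    Cardinal.mk (FactorizationType p q n m) = Nat.card {ω : k // ω ^ n.gcd m = 1} := by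
  refine cardinalMk_of_mul_ne_one (fun hqp => ?_) (fun hpq => ?_)
  · obtain ⟨heq, hpow⟩ := (mul_eq_one_iff_eq_pow hq.out hp.out).mp hqp
    exact hmn.elim (· heq) fun hne => hne.2 hpow
  · exact hmn.elim (· (hq.out.unique (hpq ▸ hp.out))) fun hne => hne.1 hpq

theorem cardinalMk_of_eq_pow {p : k} [Fact (IsPrimitiveRoot p m)] (hm : 3 ≤ m)
    (hpq : p = q ^ (m - 1)) : Cardinal.mk (FactorizationType p q m m) =
      (Nat.card {ω : k // ω ^ m.gcd m = 1} + 1 : ℕ) := by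
  have hqp : q * p = 1 := by rw [hpq, mul_pow_sub_one (NeZero.ne m), hq.out.pow_eq_one]
  refine cardinalMk_of_mul_eq_one hqp fun heq => absurd hqp ?_
  rw [heq]
  exact mul_self_ne_one hq.out hm

end Cases

end TaftBicrossed

theorem mainTheorem4_general {k : Type u} [Field k] {m n : ℕ} (hm : 2 ≤ m) (hn : 2 ≤ n)
    {q qbar : k} (hq : IsPrimitiveRoot q m) (hqbar : IsPrimitiveRoot qbar n)
    (d ν : ℕ) (hd : d = Nat.gcd m n) (hν : ν = Nat.card {ω : k // ω ^ d = 1}) :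
    (m = n → n = 2 → numFactorizationTypes (taftHopf hn hqbar) (taftHopf hm hq) = 3) ∧
    ((m ≠ n ∨ (m = n ∧ 3 ≤ n ∧ qbar ≠ q ∧ qbar ≠ q ^ (n - 1))) →
      numFactorizationTypes (taftHopf hn hqbar) (taftHopf hm hq) = (ν : Cardinal)) ∧
    (m = n → 3 ≤ n → qbar = q → Even ν →
      numFactorizationTypes (taftHopf hn hqbar) (taftHopf hm hq) = ((ν / 2 + 1 : ℕ) : Cardinal)) ∧
    (m = n → 3 ≤ n → qbar = q → Odd ν →
      numFactorizationTypes (taftHopf hn hqbar) (taftHopf hm hq) =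
        (((ν + 1) / 2 : ℕ) : Cardinal)) ∧
    (m = n → 3 ≤ n → qbar = q ^ (n - 1) →
      numFactorizationTypes (taftHopf hn hqbar) (taftHopf hm hq) = ((ν + 1 : ℕ) : Cardinal)) := by
  have : m.AtLeastTwo := ⟨hm⟩
  have : n.AtLeastTwo := ⟨hn⟩
  have : Fact (IsPrimitiveRoot q m) := ⟨hq⟩
  have : Fact (IsPrimitiveRoot qbar n) := ⟨hqbar⟩
  rw [Nat.gcd_comm] at hd
  subst hd hν
  refine ⟨?_, fun hmn => TaftBicrossed.cardinalMk_of_ne (hmn.imp_right fun h => h.2.2), ?_, ?_, ?_⟩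
  · rintro rfl rfl
    exact TaftBicrossed.cardinalMk_two
  · rintro rfl hm3 rfl -
    rw [Nat.gcd_self, card_pow_eq_one hq]
    exact TaftBicrossed.cardinalMk_self (mul_self_ne_one hq hm3)
  · rintro rfl hm3 rfl hodd
    rw [Nat.gcd_self, card_pow_eq_one hq] at hodd ⊢
    have half_succ : (m + 1) / 2 = m / 2 + 1 := by grind
    rw [half_succ]
    exact TaftBicrossed.cardinalMk_self (mul_self_ne_one hq hm3)
  · rintro rfl hm3 hqbar_eq
    exact TaftBicrossed.cardinalMk_of_eq_pow hm3 hqbar_eq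

theorem mainTheorem4 {k : Type u} [Field k] [CharZero k] {m n : ℕ} (hm : 2 ≤ m) (hn : 2 ≤ n)
    {q qbar : k} (hq : IsPrimitiveRoot q m) (hqbar : IsPrimitiveRoot qbar n)
    (d ν : ℕ) (hd : d = Nat.gcd m n) (hν : ν = Nat.card {ω : k // ω ^ d = 1}) :
    (m = n → n = 2 → numFactorizationTypes (taftHopf hn hqbar) (taftHopf hm hq) = 3) ∧
    ((m ≠ n ∨ (m = n ∧ 3 ≤ n ∧ qbar ≠ q ∧ qbar ≠ q ^ (n - 1))) →
      numFactorizationTypes (taftHopf hn hqbar) (taftHopf hm hq) = (ν : Cardinal)) ∧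
    (m = n → 3 ≤ n → qbar = q → Even ν →
      numFactorizationTypes (taftHopf hn hqbar) (taftHopf hm hq) = ((ν / 2 + 1 : ℕ) : Cardinal)) ∧
    (m = n → 3 ≤ n → qbar = q → Odd ν →
      numFactorizationTypes (taftHopf hn hqbar) (taftHopf hm hq) =
        (((ν + 1) / 2 : ℕ) : Cardinal)) ∧
    (m = n → 3 ≤ n → qbar = q ^ (n - 1) →
      numFactorizationTypes (taftHopf hn hqbar) (taftHopf hm hq) = ((ν + 1 : ℕ) : Cardinal)) := by
  exact mainTheorem4_general hm hn hq hqbar d ν hd hν
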